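/- Let $\mathbb{H}$ be the upper half-plane, let $q=e^{2\pi i\tau}$ for $\tau\in\mathbb{H}$, let $\eta(\tau)=q^{1/24}\prod_{n\ge1}(1-q^n)$ be the Dedekind eta function, let $f_r=\prod_{n\ge1}(1-q^{rn})$, and write $\eta_d=\eta(d\tau)$. Let $\mathrm{ped}(n)$ (resp. $\mathrm{pod}(n)$) be the number of partitions of $n$ whose even (resp. odd) parts are distinct, let $\overline{p}(n)$ be the number of overpartitions of $n$ (partitions in which the first occurrence of each part size may be overlined), and let $\overline{p_o}(n)$ be the number of overpartitions of $n$ into odd parts. For a positive integer $d$ let $U_d\left(\sum_n a(n)q^n\right)=\sum_n a(dn)q^n$. Put \begin{align*} P^{\mathrm{ped}} &= \frac{\eta_9^2\eta_{12}^3}{\eta_3^3\eta_{36}^2}\left[\frac{\eta_4}{\eta_1}+\frac{\eta_2^2\eta_3^4\eta_4}{\eta_1^5\eta_6^2}+24\frac{\eta_2^3\eta_3^3\eta_4\eta_6^3}{\eta_1^{10}}\right],\\ P^{\mathrm{pod}} &= \frac{\eta_6^4\eta_{12}^5\eta_{36}^2}{\eta_3\eta_9^4\eta_{18}^5}\left[\frac{\eta_2}{\eta_1\eta_4}+10\frac{\eta_2\eta_6^{24}}{\eta_1^7\eta_3^6\eta_4^7\eta_{12}^6}+16\frac{\eta_2^7\eta_3^3\eta_6^6\eta_{12}^3}{\eta_1^{10}\eta_4^{10}}+\frac{\eta_2^{13}\eta_3^{12}\eta_{12}^{12}}{\eta_1^{13}\eta_4^{13}\eta_6^{12}}\right],\\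 P^{\overline{p_o}} &= \frac{\eta_6^9\eta_9^4\eta_{36}^2}{\eta_3^6\eta_{12}^3\eta_{18}^6}\left[\frac{\eta_2^3}{\eta_1^2\eta_4}-\frac{\eta_2^5\eta_3^4}{\eta_1^6\eta_4\eta_6^2}-24\frac{\eta_2^6\eta_3^3\eta_6^3}{\eta_1^{11}\eta_4}\right],\\ P^{\overline{p}} &= \frac{\eta_6^{19}\eta_{18}}{\eta_3^6\eta_9^6\eta_{12}^5\eta_{36}^2}\left[\frac{\eta_4}{\eta_2^2}-\frac{\eta_4^{13}\eta_6^{24}}{\eta_2^{26}\eta_{12}^{12}}-128\frac{\eta_4^{10}\eta_6^{15}}{\eta_2^{23}\eta_{12}^3}-640\frac{\eta_4^7\eta_6^6\eta_{12}^6}{\eta_2^{20}}\right], \end{align*} and let $L^*=U_3(P^*)$ for $*\in\{\mathrm{ped},\mathrm{pod},\overline{p_o},\overline{p}\}$. Let $\nu=\begin{pmatrix}1&1/2\\0&1\end{pmatrix}$ (the map $q\mapsto-q$), let $W=\begin{pmatrix}28&3\\36&4\end{pmatrix}$ (the Atkin--Lehner involution at level $36$ for the prime power $4$), let $\gamma=\nu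 W\nu$, and let $(F\mid\gamma)(\tau)=F(\gamma\tau)$ for a function $F$ on $\mathbb{H}$. Theorem 1.2. One has $\gamma=\begin{pmatrix}46&28\\36&22\end{pmatrix}$. Each of the four functions $L^*$ is a weakly holomorphic modular function for $\Gamma_0(12)$, and they encode internal congruences in the following sense: \begin{align*} L^{\mathrm{ped}} &= \frac{f_3^2f_4^3}{f_1^3f_{12}^2}\sum_{n\ge0}\bigl(\mathrm{ped}(3n+1)+\mathrm{ped}(27n+10)\bigr)q^n,\\ L^{\mathrm{pod}} &= \frac{f_2^4f_4^5f_{12}^2}{f_1f_3^4f_6^5}\sum_{n\ge0}\bigl(\mathrm{pod}(3n+2)+\mathrm{pod}(27n+17)\bigr)q^{n+1},\\ L^{\overline{p_o}} &= \frac{f_2^9f_3^4f_{12}^2}{f_1^6f_4^3f_6^6}\sum_{n\ge0}\bigl(\overline{p_o}(3n)-\overline{p_o}(27n)\bigr)q^n,\\ L^{\overline{p}} &= q^{-1}\frac{f_2^{19}f_6}{f_1^6f_3^6f_4^5f_{12}^2}\sum_{n\ge0}\bigl(\overline{p}(3n)-\overline{p}(27n)\bigr)q^{2n}. \end{align*}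 Moreover, on $\mathbb{H}$, $$L^{\mathrm{ped}}\mid\gamma=\tfrac12L^{\overline{p_o}},\qquad L^{\mathrm{pod}}\mid\gamma=-\tfrac18L^{\overline{p}}.$$ -/

import Mathlib

open scoped UpperHalfPlane MatrixGroups Manifold

noncomputable section

namespace InternalCongruence

/-! ### Partition functions -/

/-- The number of partitions of `n` in which the even parts are distinct. -/
def ped (n : ℕ) : ℕ :=
  (Finset.univ.filter fun p : n.Partition => ∀ i ∈ p.parts, Even i → p.parts.count i ≤ 1).card

/-- The number of partitions of `n` in which the odd parts are distinct. -/
def pod (n : ℕ) : ℕ :=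
  (Finset.univ.filter fun p : n.Partition => ∀ i ∈ p.parts, Odd i → p.parts.count i ≤ 1).card

/-- Overpartitions of `n`: a partition `p` of `n` together with the set of those part sizes of `p`
whose first occurrence is overlined. -/
def overpartitions (n : ℕ) : Finset (Σ _ : n.Partition, Finset ℕ) :=
  (Finset.univ : Finset n.Partition).sigma fun p => p.parts.toFinset.powerset

/-- The number of overpartitions of `n`. -/
def pbar (n : ℕ) : ℕ := (overpartitions n).card

/-- The number of overpartitions of `n` all of whose parts are odd. -/
def pobar (n : ℕ) : ℕ := ((overpartitions n).filter fun x => ∀ i ∈ x.1.parts, Odd i).card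

/-! ### The nome, weakly holomorphic modular functions, and the operator `U` -/

/-- The nome `q = e^{2πiτ}`. -/
def q (τ : ℍ) : ℂ := Complex.exp (2 * Real.pi * Complex.I * τ)

/-- `f` is a weakly holomorphic modular function for `Γ₀(N)`: it is holomorphic on the upper
half-plane, invariant under `Γ₀(N)`, and meromorphic at every cusp. The last condition says that
for each `g` in `SL₂(ℤ)` the (periodic, holomorphic) function `f ∘ g` has a Fourier expansion with
only finitely many negative exponents, i.e. that `q ^ m * (f ∘ g)` is bounded near `i∞` for
some `m`. -/
structure IsWeaklyHolomorphicModularFunction (N : ℕ) (f : ℍ → ℂ) : Prop where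
  holo : MDifferentiable 𝓘(ℂ) 𝓘(ℂ) f
  invariant : ∀ g ∈ CongruenceSubgroup.Gamma0 N, ∀ τ : ℍ, f (g • τ) = f τ
  meromorphic_at_cusps : ∀ g : SL(2, ℤ), ∃ m : ℕ, UpperHalfPlane.IsBoundedAtImInfty
    fun τ : ℍ => q τ ^ m * f (g • τ)

/-- The `n`-th Fourier coefficient `a(n)` of a `1`-periodic function `f(τ) = ∑ a(n) qⁿ` on the upper
half-plane: `a(n) = ∫₀¹ f(x + i) e^{-2πin(x + i)} dx`. -/
def fourierCoeff (f : ℍ → ℂ) (n : ℤ) : ℂ :=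
  ∫ x in (0 : ℝ)..1, f (x +ᵥ UpperHalfPlane.I) * q (x +ᵥ UpperHalfPlane.I) ^ (-n)

/-- Atkin's operator `U_d`, sending `∑ a(n) qⁿ` to `∑ a(dn) qⁿ`. -/
def U (d : ℕ) (f : ℍ → ℂ) (τ : ℍ) : ℂ :=
  ∑' n : ℤ, fourierCoeff f (d * n) * q τ ^ n

/-! ### The matrix `γ` -/

/-- The matrix of the substitution `τ ↦ τ + 1/2`, i.e. `q ↦ -q`. -/
def nu : GL (Fin 2) ℝ := Matrix.GeneralLinearGroup.mkOfDetNeZero !![1, 1 / 2; 0, 1] (by norm_num)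

/-- An Atkin–Lehner matrix for the prime power `4` at level `36`: it has the shape
`[[4x, y], [36z, 4w]]` with `x, y, z, w` integers, and determinant `4`. -/
def W : GL (Fin 2) ℝ := Matrix.GeneralLinearGroup.mkOfDetNeZero !![28, 3; 36, 4] (by norm_num)

/-- The conjugated Atkin–Lehner matrix `γ = ν W ν`. -/
def gamma : GL (Fin 2) ℝ := nu * W * nu

/-- The action `f ∣ g` of a real `2 × 2` matrix of positive determinant on modular functions (of
weight `0`): `(f ∣ g)(τ) = f(gτ)`. -/
def act (f : ℍ → ℂ) (g : GL (Fin 2) ℝ) (τ : ℍ) : ℂ := f (g • τ)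

/-! ### The functions `P` and `L` -/

/-- `e d τ = η(dτ)`, with `η` the Dedekind eta function. -/
def e (d : ℕ) (τ : ℍ) : ℂ := ModularForm.eta ((d : ℂ) * (τ : ℂ))

/-- `f_r = ∏_{n ≥ 1} (1 - q^{rn})`. -/
def f (r : ℕ) (τ : ℍ) : ℂ := ∏' n : ℕ, (1 - q τ ^ (r * (n + 1)))

def Pped (τ : ℍ) : ℂ :=
  (e 9 τ ^ 2 * e 12 τ ^ 3) / (e 3 τ ^ 3 * e 36 τ ^ 2) *
    (e 4 τ / e 1 τ
      + (e 2 τ ^ 2 * e 3 τ ^ 4 * e 4 τ) / (e 1 τ ^ 5 * e 6 τ ^ 2)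
      + 24 * ((e 2 τ ^ 3 * e 3 τ ^ 3 * e 4 τ * e 6 τ ^ 3) / e 1 τ ^ 10))

def Ppod (τ : ℍ) : ℂ :=
  (e 6 τ ^ 4 * e 12 τ ^ 5 * e 36 τ ^ 2) / (e 3 τ * e 9 τ ^ 4 * e 18 τ ^ 5) *
    (e 2 τ / (e 1 τ * e 4 τ)
      + 10 * ((e 2 τ * e 6 τ ^ 24) / (e 1 τ ^ 7 * e 3 τ ^ 6 * e 4 τ ^ 7 * e 12 τ ^ 6))
      + 16 * ((e 2 τ ^ 7 * e 3 τ ^ 3 * e 6 τ ^ 6 * e 12 τ ^ 3) / (e 1 τ ^ 10 * e 4 τ ^ 10))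
      + (e 2 τ ^ 13 * e 3 τ ^ 12 * e 12 τ ^ 12) / (e 1 τ ^ 13 * e 4 τ ^ 13 * e 6 τ ^ 12))

def Ppobar (τ : ℍ) : ℂ :=
  (e 6 τ ^ 9 * e 9 τ ^ 4 * e 36 τ ^ 2) / (e 3 τ ^ 6 * e 12 τ ^ 3 * e 18 τ ^ 6) *
    (e 2 τ ^ 3 / (e 1 τ ^ 2 * e 4 τ)
      - (e 2 τ ^ 5 * e 3 τ ^ 4) / (e 1 τ ^ 6 * e 4 τ * e 6 τ ^ 2)
      - 24 * ((e 2 τ ^ 6 * e 3 τ ^ 3 * e 6 τ ^ 3) / (e 1 τ ^ 11 * e 4 τ)))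

def Ppbar (τ : ℍ) : ℂ :=
  (e 6 τ ^ 19 * e 18 τ) / (e 3 τ ^ 6 * e 9 τ ^ 6 * e 12 τ ^ 5 * e 36 τ ^ 2) *
    (e 4 τ / e 2 τ ^ 2
      - (e 4 τ ^ 13 * e 6 τ ^ 24) / (e 2 τ ^ 26 * e 12 τ ^ 12)
      - 128 * ((e 4 τ ^ 10 * e 6 τ ^ 15) / (e 2 τ ^ 23 * e 12 τ ^ 3))
      - 640 * ((e 4 τ ^ 7 * e 6 τ ^ 6 * e 12 τ ^ 6) / e 2 τ ^ 20))

def Lped : ℍ → ℂ := U 3 Pped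

def Lpod : ℍ → ℂ := U 3 Ppod

def Lpobar : ℍ → ℂ := U 3 Ppobar

def Lpbar : ℍ → ℂ := U 3 Ppbar

end InternalCongruence

end

open scoped UpperHalfPlane MatrixGroups Manifold
noncomputable section
namespace InternalCongruence
open Filter Topology

/-! The four generating functions are theta quotients: ψ(-q)/φ(-q) for `ped`, φ(-q²)/φ(-q) for
`pobar`, 1/φ(-q) for `pbar`, 1/ψ(-q) for `pod`. The Jacobi triple product (`hasSum_jacobi`) gives
the 3-dissections φ(-r) = φ(-r⁹) - 2rΩ(r³) and ψ(r) = A(r³) + rψ(r⁹). Since (1 - y)⁻ᵏ = (1 + y +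
y²)ᵏ/(1 - y³)ᵏ, every section modulo 3 of a product involving negative powers of these thetas is
computed algebraically (`triComp`). Sectioning twice identifies the bracket of each P, up to a power
of q, with the generating function of a(n) ± a(9n + c), taken at q² in the case of `pbar`. The outer
eta quotient is, up to a power of q, a function of q³, so it passes through U₃, and U₃ extracts one
further section. This proves the four expansions.

The remaining claims come from expressing everything in the Hauptmodul x = `haupt` of Γ₀(12).
Multiplying a dissection over the cube roots of unity yields a cubic theta identity
(`thetaPhi_cube`, `thetaPsi_cube`). At z and z² these become polynomial relations among x and the
eta quotients `unitA`, `unitB`, `unitC`, `unitD`. Together with the symmetry z ↦ -z they force these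
quotients to be 1 + x, 1 - x, 1 - 3x, 1 + 3x: elimination leaves finitely many branches, the value
at 0 selects one, and the identity theorem spreads it over the disc. The parameters of all the
dissections are monomials in x and the units, so each L is an explicit rational function of x
(`Lped_eq_ratPed` and its companions).

The denominators of these rational functions are products of 1 + x, 1 - 3x and 1 + 3x, which are eta
quotients and hence do not vanish on ℍ. Thus the L are holomorphic, and they are Γ₀(12)-invariant
because x is: x(τ) is a quotient of values of one weight 1 eta quotient at 6τ and 2τ, whose
transformation law (`etaPsi_moebius`) follows by a Euclidean algorithm. Meromorphy at the cusps
holds because x and the inverses of the units are weight 0 eta quotients, whose growth is controlled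
by two-sided bounds for |Δ|² im¹² on SL₂(ℤ)-orbits (`exists_discNorm_bounds`).

Finally γ is twice the product of a matrix in Γ₀(12) and the matrix of τ ↦ τ/(6τ + 1), and the
latter acts on x by x ↦ (1 - x)/(1 + 3x) (`haupt_q_gamma`). Both transformation formulas become
identities between rational functions (`ratPed_transform`, `ratPod_transform`). -/

/-! ### Infinite products in the unit disc -/

/-- The `q`-Pochhammer symbol `(a; z)_∞ = ∏_{n ≥ 0} (1 - a zⁿ)`. -/
def poch (a z : ℂ) : ℂ := ∏' n : ℕ, (1 - a * z ^ n)

/-- The Euler product `∏_{n ≥ 1} (1 - zⁿ)`. -/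
def euler (z : ℂ) : ℂ := ∏' n : ℕ, (1 - z ^ (n + 1))

theorem summable_poch (a : ℂ) {z : ℂ} (hz : ‖z‖ < 1) : Summable fun n : ℕ => ‖-(a * z ^ n)‖ := by
  simpa using (summable_geometric_of_lt_one (norm_nonneg z) hz).mul_left ‖a‖

theorem multipliable_poch (a : ℂ) {z : ℂ} (hz : ‖z‖ < 1) :
    Multipliable fun n : ℕ => 1 - a * z ^ n := by
  simpa [sub_eq_add_neg] using multipliable_one_add_of_summable (summable_poch a hz)

theorem tendsto_poch (a : ℂ) {z : ℂ} (hz : ‖z‖ < 1) :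
    Tendsto (fun N => ∏ n ∈ Finset.range N, (1 - a * z ^ n)) atTop (𝓝 (poch a z)) :=
  (multipliable_poch a hz).tendsto_prod_tprod_nat

theorem euler_eq_poch (z : ℂ) : euler z = poch z z := by
  simp only [euler, poch, pow_succ']

theorem poch_ne_zero {a z : ℂ} (hz : ‖z‖ < 1) (h : ∀ n : ℕ, a * z ^ n ≠ 1) : poch a z ≠ 0 := by
  have := tprod_one_add_ne_zero_of_summable (f := fun n : ℕ => -(a * z ^ n))
    (fun n => by rw [← sub_eq_add_neg]; exact sub_ne_zero.2 (h n).symm) (summable_poch a hz)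
  simpa [poch, sub_eq_add_neg] using this

theorem pow_ne_one_of_norm_lt {z : ℂ} (hz : ‖z‖ < 1) {n : ℕ} (hn : n ≠ 0) : z ^ n ≠ 1 := fun h => by
  have := pow_lt_one₀ (norm_nonneg z) hz hn
  rw [← norm_pow, h, norm_one] at this
  exact lt_irrefl _ this

theorem euler_ne_zero {z : ℂ} (hz : ‖z‖ < 1) : euler z ≠ 0 := by
  rw [euler_eq_poch]
  refine poch_ne_zero hz fun n => ?_
  rw [← pow_succ']
  exact pow_ne_one_of_norm_lt hz n.succ_ne_zero

theorem norm_pow_lt {z : ℂ} (hz : ‖z‖ < 1) {n : ℕ} (hn : n ≠ 0) : ‖z ^ n‖ < 1 := by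
  rw [norm_pow]; exact pow_lt_one₀ (norm_nonneg z) hz hn

theorem euler_pow_ne_zero {z : ℂ} (hz : ‖z‖ < 1) {n : ℕ} (hn : n ≠ 0) : euler (z ^ n) ≠ 0 :=
  euler_ne_zero (norm_pow_lt hz hn)

theorem tendsto_euler {z : ℂ} (hz : ‖z‖ < 1) :
    Tendsto (fun N => ∏ n ∈ Finset.range N, (1 - z ^ (n + 1))) atTop (𝓝 (euler z)) := by
  simpa [euler_eq_poch, pow_succ'] using tendsto_poch z hz

theorem differentiableOn_euler : DifferentiableOn ℂ euler (Metric.ball 0 1) :=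
  ModularForm.differentiableOn_tprod_one_sub_pow

theorem euler_zero : euler 0 = 1 := by simp [euler]

theorem prod_range_mul_eq {M : Type*} [CommMonoid M] (g : ℕ → M) (k N : ℕ) :
    ∏ n ∈ Finset.range (k * N), g n
      = ∏ m ∈ Finset.range N, ∏ i ∈ Finset.range k, g (k * m + i) := by
  induction N with
  | zero => simp
  | succ N ih => rw [Nat.mul_succ, Finset.prod_range_add, ih, Finset.prod_range_succ]

/-- Splitting a Pochhammer symbol into residue classes. -/
theorem poch_split (a : ℂ) {z : ℂ} (hz : ‖z‖ < 1) {k : ℕ} (hk : k ≠ 0) :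
    poch a z = ∏ i ∈ Finset.range k, poch (a * z ^ i) (z ^ k) := by
  have h1 : Tendsto (fun N => ∏ n ∈ Finset.range (k * N), (1 - a * z ^ n)) atTop
      (𝓝 (poch a z)) :=
    (tendsto_poch a hz).comp (tendsto_id.const_mul_atTop' (Nat.pos_of_ne_zero hk))
  refine tendsto_nhds_unique h1 ?_
  simp_rw [prod_range_mul_eq, Finset.prod_comm (s := Finset.range _) (t := Finset.range k)]
  refine tendsto_finsetProd _ fun i _ => ?_
  refine (tendsto_poch (a * z ^ i) (norm_pow_lt hz hk)).congr fun N => ?_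
  refine Finset.prod_congr rfl fun m _ => ?_
  rw [pow_add, pow_mul]; ring

theorem poch_mul_poch_neg (a : ℂ) {z : ℂ} (hz : ‖z‖ < 1) :
    poch a z * poch (-a) z = poch (a ^ 2) (z ^ 2) := by
  refine tendsto_nhds_unique ((tendsto_poch a hz).mul (tendsto_poch (-a) hz)) ?_
  refine (tendsto_poch (a ^ 2) (norm_pow_lt hz two_ne_zero)).congr fun N => ?_
  rw [← Finset.prod_mul_distrib]
  refine Finset.prod_congr rfl fun m _ => ?_
  ring

/-- The product of `∏ (1 - a zⁿ)` over the cube roots of unity multiplying `a` -/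
theorem poch_mul_three (a : ℂ) {z ω : ℂ} (hω : ω ^ 2 + ω + 1 = 0) (hz : ‖z‖ < 1) :
    poch a z * poch (ω * a) z * poch (ω ^ 2 * a) z = poch (a ^ 3) (z ^ 3) := by
  refine tendsto_nhds_unique
    (((tendsto_poch a hz).mul (tendsto_poch _ hz)).mul (tendsto_poch _ hz)) ?_
  refine (tendsto_poch (a ^ 3) (norm_pow_lt hz three_ne_zero)).congr fun N => ?_
  rw [← Finset.prod_mul_distrib, ← Finset.prod_mul_distrib]
  refine Finset.prod_congr rfl fun m _ => ?_
  have h3 : ω ^ 3 = 1 := by linear_combination (ω - 1) * hω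
  generalize hy : z ^ m = y
  rw [← pow_mul, mul_comm 3 m, pow_mul, hy]
  linear_combination ((a * y) - (a*y)^2 * ω) * hω + (a * y) ^ 3 * h3

theorem poch_odd_mul {z : ℂ} (hz : ‖z‖ < 1) : poch z (z ^ 2) * euler (z ^ 2) = euler z := by
  rw [euler_eq_poch z, poch_split z hz two_ne_zero, euler_eq_poch, Finset.prod_range_succ,
    Finset.prod_range_one, pow_zero, mul_one, pow_one, ← sq]

/-- The sign change affects only the factors with odd exponent, and (z; z²)(-z; z²) = (z²; z⁴). This
is the tool by which the symmetry z ↦ -z acts on eta quotients. -/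
theorem euler_neg {z : ℂ} (hz : ‖z‖ < 1) :
    euler (-z) = euler (z ^ 2) ^ 3 / (euler z * euler (z ^ 4)) := by
  have hz2 := norm_pow_lt hz two_ne_zero
  have h1 := poch_odd_mul hz
  have h2 := poch_odd_mul (z := -z) (by simpa using hz)
  have h3 := poch_odd_mul hz2
  have h4 := poch_mul_poch_neg z hz2
  rw [neg_sq] at h2
  rw [← h4, ← pow_mul] at h3
  rw [eq_div_iff (mul_ne_zero (euler_ne_zero hz) (euler_pow_ne_zero hz four_ne_zero)), ← h2, ← h1]
  linear_combination (euler (z ^ 2)) ^ 2 * h3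

/-- Splitting of the Euler product in steps of `k`, with the last factor again an Euler product. -/
theorem euler_split {z : ℂ} (hz : ‖z‖ < 1) (k : ℕ) :
    euler z = (∏ i ∈ Finset.range k, poch (z ^ (i + 1)) (z ^ (k + 1))) * euler (z ^ (k + 1)) := by
  rw [euler_eq_poch z, poch_split z hz k.succ_ne_zero, Finset.prod_range_succ, euler_eq_poch]
  simp [pow_succ']


/-! ### The Jacobi triple product -/

/-- The finite product `(p; p)_n`. -/
def qfact (p : ℂ) (n : ℕ) : ℂ := ∏ i ∈ Finset.range n, (1 - p ^ (i + 1))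

/-- `1 / (p; p)_k`, extended by zero to negative `k`. -/
def qfactInv (p : ℂ) : ℤ → ℂ
  | Int.ofNat k => (qfact p k)⁻¹
  | Int.negSucc _ => 0

theorem qfact_ne_zero {p : ℂ} (hp : ‖p‖ < 1) (n : ℕ) : qfact p n ≠ 0 :=
  Finset.prod_ne_zero_iff.2 fun i _ =>
    sub_ne_zero.2 (pow_ne_one_of_norm_lt hp i.succ_ne_zero).symm

/-- The extension by zero makes the recursion hold for all integers: at k = 0 the left side is zero
by convention and the right side because 1 - p⁰ = 0. No boundary cases then arise in the Pascal rule
below. -/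
theorem qfactInv_pred {p : ℂ} (hp : ‖p‖ < 1) (k : ℤ) :
    qfactInv p (k - 1) = qfactInv p k * (1 - p ^ k) := by
  rcases k with k | k
  · rcases k with _ | k
    · rw [show (Int.ofNat 0 - 1 : ℤ) = Int.negSucc 0 from rfl]
      simp [qfactInv]
    · have h1 : (Int.ofNat (k + 1) - 1 : ℤ) = Int.ofNat k := by simp
      have h2 : 1 - p ^ (k + 1) ≠ 0 := sub_ne_zero.2 (pow_ne_one_of_norm_lt hp k.succ_ne_zero).symm
      have h3 := qfact_ne_zero hp k
      rw [h1]
      simp only [qfactInv, qfact, Finset.prod_range_succ, Int.ofNat_eq_natCast, zpow_natCast] at h3 ⊢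
      field_simp
  · have h1 : (Int.negSucc k - 1 : ℤ) = Int.negSucc (k + 1) := by grind
    rw [h1]; simp [qfactInv]

/-- Coefficients of the finite triple product. -/
def jtpCoeff (p : ℂ) (N : ℕ) (m : ℤ) : ℂ :=
  qfact p (2 * N) * qfactInv p (N + m) * qfactInv p (N - m)

theorem triangle_pred (m : ℤ) : (m - 1) * (m - 1 - 1) / 2 = m * (m - 1) / 2 - (m - 1) := by
  rw [show (m - 1) * (m - 1 - 1) = m * (m - 1) + -(m - 1) * 2 by ring,
    Int.add_mul_ediv_right _ _ two_ne_zero]; ring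

theorem triangle_succ (m : ℤ) : (m + 1) * (m + 1 - 1) / 2 = m * (m - 1) / 2 + m := by
  rw [show (m + 1) * (m + 1 - 1) = m * (m - 1) + m * 2 by ring,
    Int.add_mul_ediv_right _ _ two_ne_zero]

/-- `jtpCoeff p N m` is the Gaussian binomial of 2N over N + m, and this is its two-step Pascal
rule. It matches the expansion (1 + wp^N)(1 + p^(N+1)/w) = 1 + p^(2N+1) + wp^N + p^(N+1)/w once the
factors p^(m(m-1)/2) are taken into account. -/
theorem jtpCoeff_succ {p : ℂ} (hp : ‖p‖ < 1) (hp0 : p ≠ 0) (N : ℕ) (m : ℤ) :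
    jtpCoeff p (N + 1) m = (1 + p ^ (2 * N + 1)) * jtpCoeff p N m
      + p ^ (N + 1 - m) * jtpCoeff p N (m - 1) + p ^ (N + 1 + m) * jtpCoeff p N (m + 1) := by
  have a1 := qfactInv_pred hp (N + 1 + m)
  have a2 := qfactInv_pred hp (N + m)
  have b1 := qfactInv_pred hp (N + 1 - m)
  have b2 := qfactInv_pred hp (N - m)
  rw [show (N + 1 + m - 1 : ℤ) = N + m by ring] at a1
  rw [show (N + 1 - m - 1 : ℤ) = N - m by ring] at b1
  have hq : qfact p (2 * (N + 1)) = qfact p (2 * N) * (1 - p ^ (2 * N + 1)) * (1 - p ^ (2 * N + 2)) := by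
    rw [Nat.mul_succ, qfact, Finset.prod_range_succ, Finset.prod_range_succ]; rfl
  have ha : p ^ (N + m : ℤ) = p ^ (N + 1 + m : ℤ) * p⁻¹ := by
    rw [← zpow_neg_one, ← zpow_add₀ hp0]; congr 1; ring
  have hb : p ^ (N - m : ℤ) = p ^ (N + 1 - m : ℤ) * p⁻¹ := by
    rw [← zpow_neg_one, ← zpow_add₀ hp0]; congr 1; ring
  have hab : p ^ (2 * N + 2) = p ^ (N + 1 + m : ℤ) * p ^ (N + 1 - m : ℤ) := by
    rw [← zpow_add₀ hp0, ← zpow_natCast]; congr 1; push_cast; ring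
  have hab' : p ^ (2 * N + 1) = p ^ (N + 1 + m : ℤ) * p ^ (N + 1 - m : ℤ) * p⁻¹ := by
    rw [← hab, pow_succ p (2 * N + 1)]; field_simp
  simp only [jtpCoeff]
  rw [show (N + (m - 1) : ℤ) = N + m - 1 by ring, show (N - (m - 1) : ℤ) = N + 1 - m by ring,
    show (N + (m + 1) : ℤ) = N + 1 + m by ring, show (N - (m + 1) : ℤ) = N - m - 1 by ring,
    Nat.cast_succ, a2, a1, b2, b1, hq, ha, hb, hab, hab']
  generalize p ^ (N + 1 + m : ℤ) = a
  generalize p ^ (N + 1 - m : ℤ) = b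
  ring

theorem hasSum_jtp_finite {p w : ℂ} (hp : ‖p‖ < 1) (hp0 : p ≠ 0) (hw : w ≠ 0) (N : ℕ) :
    HasSum (fun m : ℤ => jtpCoeff p N m * (p ^ (m * (m - 1) / 2) * w ^ m))
      ((∏ n ∈ Finset.range N, (1 - -w * p ^ n)) * ∏ n ∈ Finset.range N, (1 - -(p / w) * p ^ n)) := by
  induction N with
  | zero =>
    convert hasSum_ite_eq (0 : ℤ) (1 : ℂ) using 2 with m
    · split_ifs with h
      · simp [h, jtpCoeff, qfact, qfactInv]
      -- For N = 0 and m ≠ 0 one of m and -m is negative, so one factor `qfactInv` vanishes.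
      · rcases m with m | m
        · obtain ⟨k, rfl⟩ := Nat.exists_eq_succ_of_ne_zero (n := m) (by simpa using h)
          simp [jtpCoeff, qfactInv,
            show (-1 + -(k : ℤ)) = Int.negSucc k by grind]
        · simp [jtpCoeff, qfactInv]
    · simp
  | succ N ih =>
    have h1 := ih.mul_left (1 + p ^ (2 * N + 1))
    have h2 := ((Equiv.subRight (1 : ℤ)).hasSum_iff.2 ih).mul_left (w * p ^ N)
    have h3 := ((Equiv.addRight (1 : ℤ)).hasSum_iff.2 ih).mul_left (p ^ (N + 1) / w)
    have h := (h1.add h2).add h3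
    -- The three shifted copies of the induction hypothesis add up to multiplication by the two new
    -- factors.
    rw [show ∀ P Q : ℂ, (1 + p ^ (2 * N + 1)) * (P * Q) + w * p ^ N * (P * Q) + p ^ (N + 1) / w * (P * Q)
      = (P * (1 - -w * p ^ N)) * (Q * (1 - -(p / w) * p ^ N)) from fun P Q => by field_simp; ring,
      ← Finset.prod_range_succ, ← Finset.prod_range_succ] at h
    refine h.congr_fun fun m => ?_
    simp only [Function.comp, Equiv.subRight_apply, Equiv.coe_addRight]
    rw [jtpCoeff_succ hp hp0, triangle_pred, triangle_succ, zpow_sub₀ hp0 (_ / 2),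
      zpow_add₀ hp0 (_ / 2), zpow_sub₀ hw, zpow_add₀ hw, zpow_sub₀ hp0 _ 1, zpow_sub₀ hp0 _ m,
      zpow_add₀ hp0 _ m, zpow_one, zpow_one]
    norm_cast
    have : p ^ m ≠ 0 := zpow_ne_zero _ hp0
    field_simp
    ring

theorem norm_qfactInv_le {p : ℂ} (hp : ‖p‖ < 1) : ∃ K : ℝ, ∀ k : ℤ, ‖qfactInv p k‖ ≤ K := by
  have h : Tendsto (fun n => (qfact p n)⁻¹) atTop (𝓝 (euler p)⁻¹) :=
    (tendsto_euler hp).inv₀ (euler_ne_zero hp)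
  obtain ⟨K, hK⟩ := h.norm.bddAbove_range
  refine ⟨K, fun k => ?_⟩
  rcases k with k | k
  · exact hK ⟨k, rfl⟩
  · have := hK ⟨0, rfl⟩
    simp only [qfactInv, norm_zero]
    exact (norm_nonneg _).trans this

theorem tendsto_qfactInv {p : ℂ} (hp : ‖p‖ < 1) :
    Tendsto (qfactInv p) atTop (𝓝 (euler p)⁻¹) := by
  have h : Tendsto (fun n => (qfact p n)⁻¹) atTop (𝓝 (euler p)⁻¹) :=
    (tendsto_euler hp).inv₀ (euler_ne_zero hp)
  have h2 : Tendsto Int.toNat atTop atTop := tendsto_atTop.2 fun b => by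
    filter_upwards [eventually_ge_atTop (b : ℤ)] with a ha; omega
  refine (h.comp h2).congr' ?_
  filter_upwards [eventually_ge_atTop 0] with a ha
  obtain ⟨n, rfl⟩ := Int.eq_ofNat_of_zero_le ha
  rfl

theorem summable_theta {p w : ℂ} (hp : ‖p‖ < 1) (hp0 : p ≠ 0) (hw : w ≠ 0) :
    Summable fun m : ℤ => p ^ (m * (m - 1) / 2) * w ^ m := by
  have key : ∀ v : ℂ, v ≠ 0 → Summable fun n : ℕ => p ^ ((n : ℤ) * (n - 1) / 2) * v ^ n := by
    intro v hv
    refine summable_of_ratio_test_tendsto_lt_one (l := 0) one_pos (Eventually.of_forall fun n => ?_) ?_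
    · exact mul_ne_zero (zpow_ne_zero _ hp0) (pow_ne_zero _ hv)
    · have : Tendsto (fun n : ℕ => ‖p‖ ^ n * ‖v‖) atTop (𝓝 (0 * ‖v‖)) :=
        (tendsto_pow_atTop_nhds_zero_of_lt_one (norm_nonneg p) hp).mul_const _
      rw [zero_mul] at this
      refine this.congr fun n => ?_
      have e := triangle_succ n
      push_cast
      rw [e, zpow_add₀ hp0, pow_succ, zpow_natCast, ← norm_div]
      have h1 : p ^ ((n : ℤ) * (n - 1) / 2) ≠ 0 := zpow_ne_zero _ hp0
      have h2 : v ^ n ≠ 0 := pow_ne_zero _ hv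
      rw [← norm_pow, ← norm_mul]
      congr 1
      field_simp
  refine Summable.of_nat_of_neg (by simpa using key w hw) ?_
  -- The reflection m ↦ -m turns the negative half into the positive half for p/w, since the
  -- triangular exponent at -n exceeds the one at n by n.
  refine (key (p / w) (div_ne_zero hp0 hw)).congr fun n => ?_
  have e : (-(n : ℤ)) * (-n - 1) / 2 = (n : ℤ) * (n - 1) / 2 + n := by
    rw [← triangle_succ]; congr 1; ring
  rw [e, zpow_add₀ hp0, zpow_neg, div_pow, zpow_natCast, zpow_natCast]
  ring

/-- The Jacobi triple product identity. -/
theorem hasSum_jacobi {p w : ℂ} (hp : ‖p‖ < 1) (hp0 : p ≠ 0) (hw : w ≠ 0) :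
    HasSum (fun m : ℤ => p ^ (m * (m - 1) / 2) * w ^ m)
      (poch (-w) p * poch (-(p / w)) p * euler p) := by
  have hs := summable_theta hp hp0 hw
  obtain ⟨K, hK⟩ := norm_qfactInv_le hp
  have hE : Tendsto (fun N : ℕ => qfact p (2 * N)) atTop (𝓝 (euler p)) :=
    (tendsto_euler hp).comp (tendsto_id.const_mul_atTop' two_pos)
  obtain ⟨K', hK'⟩ := hE.norm.bddAbove_range
  -- For fixed m the three factors of the Gaussian binomial tend to E, 1/E and 1/E with E = `euler
  -- p`. Uniform boundedness of the coefficients then permits dominated convergence.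
  have hlim : ∀ m : ℤ, Tendsto (fun N : ℕ => jtpCoeff p N m * (p ^ (m * (m - 1) / 2) * w ^ m))
      atTop (𝓝 ((euler p)⁻¹ * (p ^ (m * (m - 1) / 2) * w ^ m))) := by
    intro m
    refine Tendsto.mul_const _ ?_
    have t1 : Tendsto (fun N : ℕ => (N : ℤ) + m) atTop atTop :=
      tendsto_atTop_add_const_right _ _ tendsto_natCast_atTop_atTop
    have t2 : Tendsto (fun N : ℕ => (N : ℤ) - m) atTop atTop :=
      tendsto_atTop_add_const_right _ (-m) tendsto_natCast_atTop_atTop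
    have := (hE.mul ((tendsto_qfactInv hp).comp t1)).mul ((tendsto_qfactInv hp).comp t2)
    rwa [mul_inv_cancel₀ (euler_ne_zero hp), one_mul] at this
  have hT := tendsto_tsum_of_dominated_convergence (hs.norm.mul_left (K' * K * K)) hlim
    (Eventually.of_forall fun N m => by
      rw [norm_mul, jtpCoeff, norm_mul, norm_mul]
      have h0 : ‖qfact p (2 * N)‖ ≤ K' := hK' ⟨N, rfl⟩
      have := hK (N + m)
      have := hK (N - m)
      have := (norm_nonneg _).trans h0
      have := (norm_nonneg _).trans (hK 0)
      gcongr)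
  rw [tsum_mul_left] at hT
  have hT' := (tendsto_poch (-w) hp).mul (tendsto_poch (-(p / w)) hp)
  have := tendsto_nhds_unique (hT'.congr fun N => (hasSum_jtp_finite hp hp0 hw N).tsum_eq.symm) hT
  have h2 := hs.hasSum
  rwa [show ∑' m : ℤ, p ^ (m * (m - 1) / 2) * w ^ m = poch (-w) p * poch (-(p / w)) p * euler p by
    rw [this]; field_simp [euler_ne_zero hp]] at h2


/-! ### Four theta functions and their 3-dissections -/

/-- Ramanujan's `φ(-z) = ∑ (-1)ⁿ z^{n²}`. -/
def thetaPhi (z : ℂ) : ℂ := euler z ^ 2 / euler (z ^ 2)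

/-- Ramanujan's `ψ(z) = ∑_{n ≥ 0} z^{n(n+1)/2}`. -/
def thetaPsi (z : ℂ) : ℂ := euler (z ^ 2) ^ 2 / euler z

/-- The theta function `∑ (-1)ⁿ z^{3n² - 2n}`. -/
def thetaOmega (z : ℂ) : ℂ := euler z * euler (z ^ 6) ^ 2 / (euler (z ^ 2) * euler (z ^ 3))

/-- The theta function `∑ z^{n(3n-1)/2}`. -/
def thetaA (z : ℂ) : ℂ := euler (z ^ 2) * euler (z ^ 3) ^ 2 / (euler z * euler (z ^ 6))

theorem poch_succ (a : ℂ) {z : ℂ} (hz : ‖z‖ < 1) : poch a z = (1 - a) * poch (a * z) z := by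
  refine tendsto_nhds_unique ((tendsto_add_atTop_iff_nat 1).2 (tendsto_poch a hz)) ?_
  refine ((tendsto_poch (a * z) hz).const_mul (1 - a)).congr fun N => ?_
  rw [Finset.prod_range_succ', mul_comm]
  simp [pow_succ', mul_assoc]

theorem two_mul_triangle (m : ℤ) : 2 * (m * (m - 1) / 2) = m * (m - 1) := by
  refine Int.mul_ediv_cancel' ?_
  rcases Int.even_or_odd m with h | h
  · exact h.two_dvd.mul_right _
  · exact (h.sub_odd odd_one).two_dvd.mul_left _

/-- Triple product with p = z² and w = -z. -/
theorem hasSum_thetaPhi {z : ℂ} (hz : ‖z‖ < 1) (hz0 : z ≠ 0) :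
    HasSum (fun m : ℤ => (-1) ^ m * z ^ (m ^ 2)) (thetaPhi z) := by
  have hz2 := norm_pow_lt hz two_ne_zero
  have h := hasSum_jacobi hz2 (pow_ne_zero 2 hz0) (neg_ne_zero.2 hz0)
  convert h using 2 with m
  · rw [← zpow_natCast z 2, ← zpow_mul, Nat.cast_ofNat, two_mul_triangle, neg_eq_neg_one_mul z, mul_zpow,
      mul_left_comm, ← zpow_add₀ hz0]
    congr 2; ring
  · have := poch_odd_mul hz
    have e : -(z ^ 2 / -z) = z := by field_simp
    rw [neg_neg, e, thetaPhi, div_eq_iff (euler_ne_zero hz2)]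
    linear_combination (-euler z - poch z (z ^ 2) * euler (z ^ 2)) * this

/-- Triple product with p = z and w = 1. Summation over ℤ meets each triangular number twice; on the
product side the 2 is the first factor 1 - (-1). -/
theorem hasSum_thetaPsi {z : ℂ} (hz : ‖z‖ < 1) (hz0 : z ≠ 0) :
    HasSum (fun m : ℤ => z ^ (m * (m - 1) / 2)) (2 * thetaPsi z) := by
  have h := hasSum_jacobi hz hz0 one_ne_zero
  have := poch_mul_poch_neg z hz
  rw [← euler_eq_poch, ← euler_eq_poch] at this
  rw [poch_succ _ hz, div_one, neg_one_mul] at h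
  rw [thetaPsi, ← this]
  simp only [one_zpow, mul_one] at h
  convert h using 1
  field_simp [euler_ne_zero hz]
  ring

/-- Triple product with p = z⁶ and w = -z; the residues 1 and 5 modulo 6 are isolated by inclusion
and exclusion over the multiples of 2 and 3. -/
theorem hasSum_thetaOmega {z : ℂ} (hz : ‖z‖ < 1) (hz0 : z ≠ 0) :
    HasSum (fun m : ℤ => (-1) ^ m * z ^ (3 * m ^ 2 - 2 * m)) (thetaOmega z) := by
  have hz6 := norm_pow_lt hz (n := 6) (by norm_num)
  have h := hasSum_jacobi hz6 (pow_ne_zero 6 hz0) (neg_ne_zero.2 hz0)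
  convert h using 2 with m
  · rw [← zpow_natCast z 6, ← zpow_mul, Nat.cast_ofNat, show (6 : ℤ) * (m * (m - 1) / 2) = 3 * (2 * (m * (m - 1) / 2)) by ring,
      two_mul_triangle, neg_eq_neg_one_mul z, mul_zpow,
      mul_left_comm, ← zpow_add₀ hz0]
    congr 2; ring
  · have e : -(z ^ 6 / -z) = z ^ 5 := by field_simp
    have h1 := euler_split hz 5
    have h2 := euler_split (norm_pow_lt hz two_ne_zero) 2
    have h3 := euler_split (norm_pow_lt hz three_ne_zero) 1
    simp only [Finset.prod_range_succ, Finset.prod_range_zero, ← pow_mul] at h1 h2 h3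
    norm_num at h1 h2 h3
    rw [neg_neg, e, thetaOmega, div_eq_iff (mul_ne_zero (euler_pow_ne_zero hz two_ne_zero)
      (euler_pow_ne_zero hz three_ne_zero)), h1, h2, h3]
    ring

/-- Triple product with p = z³ and w = z. -/
theorem hasSum_thetaA {z : ℂ} (hz : ‖z‖ < 1) (hz0 : z ≠ 0) :
    HasSum (fun m : ℤ => z ^ (3 * (m * (m - 1) / 2) + m)) (thetaA z) := by
  have hz3 := norm_pow_lt hz three_ne_zero
  have h := hasSum_jacobi hz3 (pow_ne_zero 3 hz0) hz0
  convert h using 2 with m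
  · rw [← zpow_natCast z 3, ← zpow_mul, ← zpow_add₀ hz0]; rfl
  · have e : z ^ 3 / z = z ^ 2 := by field_simp
    have h1 := euler_split hz 2
    have h2 := euler_split (norm_pow_lt hz two_ne_zero) 2
    have h3 := poch_mul_poch_neg z hz3
    have h4 := poch_mul_poch_neg (z ^ 2) hz3
    simp only [Finset.prod_range_succ, Finset.prod_range_zero, ← pow_mul] at h1 h2 h3 h4
    norm_num at h1 h2 h3 h4
    rw [e, thetaA, div_eq_iff (mul_ne_zero (euler_ne_zero hz)
      (euler_pow_ne_zero hz (by norm_num))), h1, h2, ← h3, ← h4]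
    ring

theorem hasSum_int_mod_three {g : ℤ → ℂ} {S a b c : ℂ} (h : HasSum g S)
    (h0 : HasSum (fun m => g (3 * m)) a) (h1 : HasSum (fun m => g (3 * m + 1)) b)
    (h2 : HasSum (fun m => g (3 * m + 2)) c) : S = a + b + c := by
  have H := ((Equiv.prodComm _ _).trans (Int.divModEquiv 3).symm).hasSum_iff.2 h
  have H2 : HasSum (![a, b, c] : Fin 3 → ℂ) S := by
    refine H.prod_fiberwise fun i => ?_
    fin_cases i
    · refine h0.congr_fun fun m => ?_
      simp [Int.divModEquiv, mul_comm]
    · refine h1.congr_fun fun m => ?_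
      simp [Int.divModEquiv, mul_comm]
    · refine h2.congr_fun fun m => ?_
      simp [Int.divModEquiv, mul_comm]
  rw [H2.unique (hasSum_fintype _), Fin.sum_univ_three]; rfl

theorem hasSum_neg_int {g : ℤ → ℂ} {S : ℂ} (h : HasSum g S) : HasSum (fun m => g (-m)) S :=
  (Equiv.neg ℤ).hasSum_iff.2 h

/-- Split the sum over squares m² by m modulo 3: multiples of 3 give the theta function at r⁹, and
the classes 1 and 2 each give -rΩ(r³). -/
theorem thetaPhi_dissection {r : ℂ} (hr : ‖r‖ < 1) (hr0 : r ≠ 0) :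
    thetaPhi r = thetaPhi (r ^ 9) - 2 * r * thetaOmega (r ^ 3) := by
  have hP := hasSum_thetaPhi (norm_pow_lt hr (n := 9) (by norm_num)) (pow_ne_zero 9 hr0)
  have hO := hasSum_thetaOmega (norm_pow_lt hr three_ne_zero) (pow_ne_zero 3 hr0)
  have hm : (-1 : ℂ) ≠ 0 := by norm_num
  have hs : ∀ m : ℤ, (-1 : ℂ) ^ (3 * m) = (-1) ^ m := fun m => by rw [zpow_mul]; norm_num
  have := hasSum_int_mod_three (hasSum_thetaPhi hr hr0) (a := thetaPhi (r ^ 9))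
    (b := -r * thetaOmega (r ^ 3)) (c := -r * thetaOmega (r ^ 3)) ?_ ?_ ?_
  · rw [this]; ring
  · refine hP.congr_fun fun m => ?_
    rw [hs, ← zpow_natCast r 9, ← zpow_mul]
    congr 2; push_cast; ring
  · refine ((hasSum_neg_int hO).mul_left (-r)).congr_fun fun m => ?_
    have e : r ^ ((3 * m + 1) ^ 2) = r * (r ^ 3) ^ (3 * (-m) ^ 2 - 2 * -m) := by
      rw [← zpow_natCast r 3, ← zpow_mul, ← zpow_one_add₀ hr0]
      congr 1; push_cast; ring
    rw [e, zpow_add₀ hm, hs, zpow_neg, ← inv_zpow, show (-1 : ℂ)⁻¹ = -1 by norm_num]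
    ring
  · refine (((Equiv.addRight (1 : ℤ)).hasSum_iff.2 hO).mul_left (-r)).congr_fun fun m => ?_
    simp only [Function.comp, Equiv.coe_addRight]
    have e : r ^ ((3 * m + 2) ^ 2) = r * (r ^ 3) ^ (3 * (m + 1) ^ 2 - 2 * (m + 1)) := by
      rw [← zpow_natCast r 3, ← zpow_mul, ← zpow_one_add₀ hr0]
      congr 1; push_cast; ring
    rw [e, zpow_add₀ hm, zpow_add₀ hm, hs]
    norm_num
    ring

/-- Split the triangular exponents m(m - 1)/2 by m modulo 3: the classes 0 and 1 each give A(r³),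
and the class 2 gives exponents 1 plus nine times a triangular number. -/
theorem thetaPsi_dissection {r : ℂ} (hr : ‖r‖ < 1) (hr0 : r ≠ 0) :
    thetaPsi r = thetaA (r ^ 3) + r * thetaPsi (r ^ 9) := by
  have hP := hasSum_thetaPsi (norm_pow_lt hr (n := 9) (by norm_num)) (pow_ne_zero 9 hr0)
  have hA := hasSum_thetaA (norm_pow_lt hr three_ne_zero) (pow_ne_zero 3 hr0)
  -- Exponents are compared after doubling, where `two_mul_triangle` removes the integer division.
  have key : ∀ k l : ℤ, 2 * k = 2 * l → k = l := fun k l h => by omega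
  have := hasSum_int_mod_three (hasSum_thetaPsi hr hr0) (a := thetaA (r ^ 3))
    (b := thetaA (r ^ 3)) (c := r * (2 * thetaPsi (r ^ 9))) ?_ ?_ ?_
  · linear_combination this / 2
  · refine hA.congr_fun fun m => ?_
    rw [← zpow_natCast r 3, ← zpow_mul]
    congr 1
    have a := two_mul_triangle (3 * m)
    have b := two_mul_triangle m
    push_cast
    exact key _ _ (by linear_combination a - 9 * b)
  · refine (hasSum_neg_int hA).congr_fun fun m => ?_
    rw [← zpow_natCast r 3, ← zpow_mul]
    congr 1
    have a := two_mul_triangle (3 * m + 1)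
    have b := two_mul_triangle (-m)
    push_cast
    exact key _ _ (by linear_combination a - 9 * b)
  · refine (((Equiv.addRight (1 : ℤ)).hasSum_iff.2 hP).mul_left r).congr_fun fun m => ?_
    simp only [Function.comp, Equiv.coe_addRight]
    rw [← zpow_natCast r 9, ← zpow_mul, ← zpow_one_add₀ hr0]
    congr 1
    have a := two_mul_triangle (3 * m + 2)
    have b := two_mul_triangle (m + 1)
    push_cast
    exact key _ _ (by linear_combination a - 9 * b)

/-! ### Products over the cube roots of unity -/

/-- Factors with exponent prime to 3 multiply, over the cube roots of unity, to the corresponding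
factors in r³, that is `euler (r ^ 3) / euler (r ^ 9)`. Factors with exponent divisible by 3 are
unchanged and occur three times. -/
theorem euler_mul_three {r ω : ℂ} (hω : ω ^ 2 + ω + 1 = 0) (hr : ‖r‖ < 1) :
    euler r * euler (ω * r) * euler (ω ^ 2 * r) = euler (r ^ 3) ^ 4 / euler (r ^ 9) := by
  have h3 : ω ^ 3 = 1 := by linear_combination (ω - 1) * hω
  have hn : ‖ω‖ = 1 := by
    have : ‖ω‖ ^ 3 = 1 := by rw [← norm_pow, h3, norm_one]
    exact (pow_eq_one_iff_of_nonneg (norm_nonneg _) three_ne_zero).1 this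
  have hr3 := norm_pow_lt hr three_ne_zero
  have e0 := euler_split hr 2
  have e1 := euler_split (z := ω * r) (by rw [norm_mul, hn, one_mul]; exact hr) 2
  have e2 := euler_split (z := ω ^ 2 * r) (by rw [norm_mul, norm_pow, hn, one_pow, one_mul]; exact hr) 2
  have e3 := euler_split hr3 2
  have p1 := poch_mul_three r hω hr3
  have p2 := poch_mul_three (r ^ 2) (ω := ω) hω hr3
  have o4 : (ω ^ 2) ^ 2 = ω := by linear_combination ω * h3
  simp only [Finset.prod_range_succ, Finset.prod_range_zero, mul_pow, ← pow_mul] at e0 e1 e2 e3 p1 p2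
  norm_num [h3] at e0 e1 e2 e3 p1 p2
  rw [show ω ^ 4 = ω by linear_combination ω * h3, show ω ^ 6 = 1 by linear_combination (ω^3 + 1) * h3,
    one_mul] at e2
  rw [eq_div_iff (euler_pow_ne_zero hr (by norm_num)), e0, e1, e2]
  linear_combination (euler (r ^ 9) * euler (r ^ 3) ^ 3) *
    (poch (r ^ 2) (r ^ 3) * poch (ω * r ^ 2) (r ^ 3) * poch (ω ^ 2 * r ^ 2) (r ^ 3) * p1
      + poch (r ^ 3) (r ^ 9) * p2) - (euler (r ^ 3) ^ 3) * e3

theorem exists_cubeRoot_unity : ∃ ω : ℂ, ω ^ 2 + ω + 1 = 0 ∧ ‖ω‖ = 1 := by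
  refine ⟨Complex.exp (2 * Real.pi * Complex.I / 3), ?_, ?_⟩
  · have h := Complex.isPrimitiveRoot_exp 3 three_ne_zero
    have := h.geom_sum_eq_zero (by norm_num)
    simp [Finset.sum_range_succ] at this
    linear_combination this
  · rw [Complex.norm_exp]; simp

theorem exists_pow_three {z : ℂ} (hz : ‖z‖ < 1) (hz0 : z ≠ 0) :
    ∃ r : ℂ, r ^ 3 = z ∧ ‖r‖ < 1 ∧ r ≠ 0 := by
  obtain ⟨r, hr⟩ := IsAlgClosed.exists_pow_nat_eq z (n := 3) (by norm_num)
  refine ⟨r, hr, ?_, ?_⟩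
  · by_contra h
    rw [not_lt] at h
    have := one_le_pow₀ (n := 3) h
    rw [← norm_pow, hr] at this
    linarith
  · rintro rfl; simp at hr; exact hz0 hr.symm

theorem norm_unit_mul {ω r : ℂ} (h : ‖ω‖ = 1) (hr : ‖r‖ < 1) : ‖ω * r‖ < 1 := by
  rwa [norm_mul, h, one_mul]

/-- With z = r³, multiply the dissection of φ over r, ωr, ω²r. The dissected side is the norm X³ -
(2rΩ)³; the product side is evaluated by `euler_mul_three`. -/
theorem thetaPhi_cube {z : ℂ} (hz : ‖z‖ < 1) (hz0 : z ≠ 0) :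
    thetaPhi (z ^ 3) ^ 3 - 8 * z * thetaOmega z ^ 3 = thetaPhi z ^ 4 / thetaPhi (z ^ 3) := by
  obtain ⟨r, rfl, hr, hr0⟩ := exists_pow_three hz hz0
  obtain ⟨ω, hω, hn⟩ := exists_cubeRoot_unity
  have h3 : ω ^ 3 = 1 := by linear_combination (ω - 1) * hω
  have hω0 : ω ≠ 0 := by rintro rfl; simp at hn
  have hn2 : ‖ω ^ 2‖ = 1 := by rw [norm_pow, hn, one_pow]
  have d0 := thetaPhi_dissection hr hr0
  have d1 := thetaPhi_dissection (norm_unit_mul hn hr) (mul_ne_zero hω0 hr0)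
  have d2 := thetaPhi_dissection (norm_unit_mul hn2 hr) (mul_ne_zero (pow_ne_zero 2 hω0) hr0)
  have o9 : ω ^ 9 = 1 := by rw [show 9 = 3 * 3 from rfl, pow_mul, h3, one_pow]
  have o6 : (ω ^ 2) ^ 3 = 1 := by rw [← pow_mul, show 2 * 3 = 3 * 2 from rfl, pow_mul, h3, one_pow]
  have o18 : (ω ^ 2) ^ 9 = 1 := by rw [← pow_mul, show 2 * 9 = 3 * 6 from rfl, pow_mul, h3, one_pow]
  rw [mul_pow, mul_pow, o9, h3, one_mul, one_mul] at d1
  rw [mul_pow, mul_pow, o18, o6, one_mul, one_mul] at d2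
  have P : thetaPhi r * thetaPhi (ω * r) * thetaPhi (ω ^ 2 * r)
      = thetaPhi (r ^ 9) ^ 3 - 8 * r ^ 3 * thetaOmega (r ^ 3) ^ 3 := by
    rw [d0, d1, d2]
    generalize thetaPhi (r ^ 9) = X
    generalize thetaOmega (r ^ 3) = y
    linear_combination (-2 * X ^ 2 * r * y + 4 * X * r ^ 2 * y ^ 2 * ω) * hω - 8 * r ^ 3 * y ^ 3 * h3
  have E1 := euler_mul_three hω hr
  -- The factors in r² are permuted by ω², so the norm formula is used with ω² as the cube root of
  -- unity.
  have E2 := euler_mul_three (ω := ω ^ 2) (by linear_combination (1 - ω + ω ^ 2) * hω)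
    (norm_pow_lt hr two_ne_zero)
  have o4 : (ω ^ 2) ^ 2 = ω := by linear_combination ω * h3
  rw [o4] at E2
  simp only [← pow_mul] at E2 P ⊢
  norm_num at E2 P ⊢
  rw [← P]
  simp only [thetaPhi, mul_pow, o4, ← pow_mul]
  norm_num
  have q1 := euler_pow_ne_zero hr (n := 2) (by norm_num)
  have q3 := euler_pow_ne_zero hr (n := 3) (by norm_num)
  have q6 := euler_pow_ne_zero hr (n := 6) (by norm_num)
  have q9 := euler_pow_ne_zero hr (n := 9) (by norm_num)
  have q18 := euler_pow_ne_zero hr (n := 18) (by norm_num)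
  have n2 : ‖r ^ 2‖ < 1 := norm_pow_lt hr two_ne_zero
  have w1 := euler_ne_zero (norm_unit_mul hn n2)
  have w2 := euler_ne_zero (norm_unit_mul hn2 n2)
  calc _ = (euler r * euler (ω * r) * euler (ω ^ 2 * r)) ^ 2 /
        (euler (r ^ 2) * euler (ω ^ 2 * r ^ 2) * euler (ω * r ^ 2)) := by field_simp
    _ = _ := by rw [E1, E2]; field_simp

theorem thetaPsi_cube {z : ℂ} (hz : ‖z‖ < 1) (hz0 : z ≠ 0) :
    thetaA z ^ 3 + z * thetaPsi (z ^ 3) ^ 3 = thetaPsi z ^ 4 / thetaPsi (z ^ 3) := by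
  obtain ⟨r, rfl, hr, hr0⟩ := exists_pow_three hz hz0
  obtain ⟨ω, hω, hn⟩ := exists_cubeRoot_unity
  have h3 : ω ^ 3 = 1 := by linear_combination (ω - 1) * hω
  have hω0 : ω ≠ 0 := by rintro rfl; simp at hn
  have hn2 : ‖ω ^ 2‖ = 1 := by rw [norm_pow, hn, one_pow]
  have d0 := thetaPsi_dissection hr hr0
  have d1 := thetaPsi_dissection (norm_unit_mul hn hr) (mul_ne_zero hω0 hr0)
  have d2 := thetaPsi_dissection (norm_unit_mul hn2 hr) (mul_ne_zero (pow_ne_zero 2 hω0) hr0)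
  have o9 : ω ^ 9 = 1 := by rw [show 9 = 3 * 3 from rfl, pow_mul, h3, one_pow]
  have o6 : (ω ^ 2) ^ 3 = 1 := by rw [← pow_mul, show 2 * 3 = 3 * 2 from rfl, pow_mul, h3, one_pow]
  have o18 : (ω ^ 2) ^ 9 = 1 := by rw [← pow_mul, show 2 * 9 = 3 * 6 from rfl, pow_mul, h3, one_pow]
  rw [mul_pow, mul_pow, o9, h3, one_mul, one_mul] at d1
  rw [mul_pow, mul_pow, o18, o6, one_mul, one_mul] at d2
  have P : thetaPsi r * thetaPsi (ω * r) * thetaPsi (ω ^ 2 * r)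
      = thetaA (r ^ 3) ^ 3 + r ^ 3 * thetaPsi (r ^ 9) ^ 3 := by
    rw [d0, d1, d2]
    generalize thetaPsi (r ^ 9) = y
    generalize thetaA (r ^ 3) = X
    linear_combination (X ^ 2 * r * y + X * r ^ 2 * y ^ 2 * ω) * hω + r ^ 3 * y ^ 3 * h3
  have E1 := euler_mul_three hω hr
  have E2 := euler_mul_three (ω := ω ^ 2) (by linear_combination (1 - ω + ω ^ 2) * hω)
    (norm_pow_lt hr two_ne_zero)
  have o4 : (ω ^ 2) ^ 2 = ω := by linear_combination ω * h3
  rw [o4] at E2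
  simp only [← pow_mul] at E2 P ⊢
  norm_num at E2 P ⊢
  rw [← P]
  simp only [thetaPsi, mul_pow, o4, ← pow_mul]
  norm_num
  have q1 := euler_ne_zero hr
  have q3 := euler_pow_ne_zero hr (n := 3) (by norm_num)
  have q6 := euler_pow_ne_zero hr (n := 6) (by norm_num)
  have q9 := euler_pow_ne_zero hr (n := 9) (by norm_num)
  have q18 := euler_pow_ne_zero hr (n := 18) (by norm_num)
  have w1 := euler_ne_zero (norm_unit_mul hn hr)
  have w2 := euler_ne_zero (norm_unit_mul hn2 hr)
  calc _ = (euler (r ^ 2) * euler (ω ^ 2 * r ^ 2) * euler (ω * r ^ 2)) ^ 2 /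
        (euler r * euler (ω * r) * euler (ω ^ 2 * r)) := by field_simp
    _ = _ := by rw [E1, E2]; field_simp


/-! ### A Hauptmodul of level 12 -/

/-- The Hauptmodul `x = η₂² η₁₂⁴ / (η₄⁴ η₆²)` of `Γ₀(12)`, as a function of `z = q`. -/
def haupt (z : ℂ) : ℂ :=
  z * (euler (z ^ 2) ^ 2 * euler (z ^ 12) ^ 4 / (euler (z ^ 4) ^ 4 * euler (z ^ 6) ^ 2))

/-- The eta quotient equal to `1 + x`. -/
def unitA (z : ℂ) : ℂ := euler (z ^ 3) ^ 3 * euler (z ^ 2) ^ 2 * euler (z ^ 12) /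
  (euler z * euler (z ^ 4) ^ 3 * euler (z ^ 6) ^ 2)

/-- The eta quotient equal to `1 - x`. -/
def unitB (z : ℂ) : ℂ := euler (z ^ 6) ^ 7 * euler z /
  (euler (z ^ 3) ^ 3 * euler (z ^ 2) * euler (z ^ 4) ^ 2 * euler (z ^ 12) ^ 2)

/-- The eta quotient equal to `1 - 3x`. -/
def unitC (z : ℂ) : ℂ := euler z ^ 3 * euler (z ^ 12) / (euler (z ^ 3) * euler (z ^ 4) ^ 3)

/-- The eta quotient equal to `1 + 3x`. -/
def unitD (z : ℂ) : ℂ := euler (z ^ 2) ^ 9 * euler (z ^ 3) * euler (z ^ 12) ^ 2 /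
  (euler z ^ 3 * euler (z ^ 4) ^ 6 * euler (z ^ 6) ^ 3)

section
variable {z : ℂ} (hz : ‖z‖ < 1)
include hz

/-- This and the next three relations are the two cubic theta identities at z and at z², each
multiplied by the eta quotient that turns its terms into monomials in x and the units. -/
theorem unitA_sq_add (hz0 : z ≠ 0) : unitA z ^ 2 + haupt z * unitB z = unitD z := by
  have h1 := euler_ne_zero hz
  have h2 := euler_pow_ne_zero hz (n := 2) (by norm_num)
  have h3 := euler_pow_ne_zero hz (n := 3) (by norm_num)
  have h4 := euler_pow_ne_zero hz (n := 4) (by norm_num)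
  have h6 := euler_pow_ne_zero hz (n := 6) (by norm_num)
  have h12 := euler_pow_ne_zero hz (n := 12) (by norm_num)
  have h := thetaPsi_cube hz hz0
  simp only [thetaA, thetaPsi, ← pow_mul, Nat.reduceMul] at h
  simp only [unitA, unitB, unitD, haupt]
  have hK := congrArg (euler z * euler (z ^ 2) * euler (z ^ 12) ^ 2 / (euler (z ^ 4) ^ 6 * euler (z ^ 6)) * ·) h
  rw [mul_add] at hK
  convert hK using 1
  · congr 1 <;> field_simp
  · field_simp

theorem unitA_sq_sub (hz0 : z ≠ 0) : unitA z ^ 2 - 8 * (haupt z * unitB z) = unitC z ^ 2 := by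
  have h1 := euler_ne_zero hz
  have h2 := euler_pow_ne_zero hz (n := 2) (by norm_num)
  have h3 := euler_pow_ne_zero hz (n := 3) (by norm_num)
  have h4 := euler_pow_ne_zero hz (n := 4) (by norm_num)
  have h6 := euler_pow_ne_zero hz (n := 6) (by norm_num)
  have h12 := euler_pow_ne_zero hz (n := 12) (by norm_num)
  have h := thetaPhi_cube hz hz0
  simp only [thetaPhi, thetaOmega, ← pow_mul, Nat.reduceMul] at h
  simp only [unitA, unitB, unitC, haupt]
  have hK := congrArg (euler (z ^ 2) ^ 4 * euler (z ^ 12) ^ 2 /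
    (euler (z ^ 4) ^ 6 * euler (z ^ 6) * euler z ^ 2) * ·) h
  rw [mul_sub] at hK
  convert hK using 1
  · congr 1 <;> field_simp
  · field_simp

theorem unitA_mul_unitB (hz0 : z ≠ 0) : unitA z * unitB z + haupt z ^ 2 = 1 := by
  have h1 := euler_ne_zero hz
  have h2 := euler_pow_ne_zero hz (n := 2) (by norm_num)
  have h3 := euler_pow_ne_zero hz (n := 3) (by norm_num)
  have h4 := euler_pow_ne_zero hz (n := 4) (by norm_num)
  have h6 := euler_pow_ne_zero hz (n := 6) (by norm_num)
  have h12 := euler_pow_ne_zero hz (n := 12) (by norm_num)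
  have h := thetaPsi_cube (norm_pow_lt hz two_ne_zero) (pow_ne_zero 2 hz0)
  simp only [thetaA, thetaPsi, ← pow_mul, Nat.reduceMul] at h
  simp only [unitA, unitB, haupt]
  have hK := congrArg (euler (z ^ 2) ^ 4 * euler (z ^ 12) ^ 2 / (euler (z ^ 4) ^ 8 * euler (z ^ 6)) * ·) h
  rw [mul_add] at hK
  convert hK using 1
  · congr 1 <;> field_simp
  · field_simp

theorem unitC_mul_unitD (hz0 : z ≠ 0) :
    unitA z * unitB z - 8 * haupt z ^ 2 = unitC z * unitD z := by
  have h1 := euler_ne_zero hz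
  have h2 := euler_pow_ne_zero hz (n := 2) (by norm_num)
  have h3 := euler_pow_ne_zero hz (n := 3) (by norm_num)
  have h4 := euler_pow_ne_zero hz (n := 4) (by norm_num)
  have h6 := euler_pow_ne_zero hz (n := 6) (by norm_num)
  have h12 := euler_pow_ne_zero hz (n := 12) (by norm_num)
  have h := thetaPhi_cube (norm_pow_lt hz two_ne_zero) (pow_ne_zero 2 hz0)
  simp only [thetaPhi, thetaOmega, ← pow_mul, Nat.reduceMul] at h
  simp only [unitA, unitB, unitC, unitD, haupt]
  have hK := congrArg (euler (z ^ 2) * euler (z ^ 12) ^ 2 / (euler (z ^ 4) ^ 5 * euler (z ^ 6)) * ·) h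
  rw [mul_sub] at hK
  convert hK using 1
  · congr 1 <;> field_simp
  · field_simp

theorem euler_neg_pow_three : euler ((-z) ^ 3) = euler (z ^ 6) ^ 3 / (euler (z ^ 3) * euler (z ^ 12)) := by
  have := euler_neg (norm_pow_lt hz three_ne_zero)
  simp only [← pow_mul, Nat.reduceMul] at this
  rw [← this]; congr 1; ring

omit hz in
theorem haupt_neg : haupt (-z) = -haupt z := by
  simp only [haupt, Even.neg_pow (show Even 2 by decide), Even.neg_pow (show Even 4 by decide),
    Even.neg_pow (show Even 6 by decide), Even.neg_pow (show Even 12 by decide)]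
  ring

theorem unitA_neg : unitA (-z) = unitB z := by
  have h1 := euler_ne_zero hz
  have h2 := euler_pow_ne_zero hz (n := 2) (by norm_num)
  have h3 := euler_pow_ne_zero hz (n := 3) (by norm_num)
  have h4 := euler_pow_ne_zero hz (n := 4) (by norm_num)
  have h6 := euler_pow_ne_zero hz (n := 6) (by norm_num)
  have h12 := euler_pow_ne_zero hz (n := 12) (by norm_num)
  simp only [unitA, unitB, euler_neg_pow_three hz, euler_neg hz,
    Even.neg_pow (show Even 4 by decide), Even.neg_pow (show Even 12 by decide)]
  field_simp

theorem unitC_neg : unitC (-z) = unitD z := by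
  have h1 := euler_ne_zero hz
  have h2 := euler_pow_ne_zero hz (n := 2) (by norm_num)
  have h3 := euler_pow_ne_zero hz (n := 3) (by norm_num)
  have h4 := euler_pow_ne_zero hz (n := 4) (by norm_num)
  have h6 := euler_pow_ne_zero hz (n := 6) (by norm_num)
  have h12 := euler_pow_ne_zero hz (n := 12) (by norm_num)
  simp only [unitC, unitD, euler_neg_pow_three hz, euler_neg hz,
    Even.neg_pow (show Even 4 by decide), Even.neg_pow (show Even 12 by decide)]
  field_simp

theorem unitB_neg : unitB (-z) = unitA z := by
  rw [← unitA_neg (z := -z) (by simpa using hz), neg_neg]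

theorem unitD_neg : unitD (-z) = unitC z := by
  rw [← unitC_neg (z := -z) (by simpa using hz), neg_neg]

theorem unitB_sq_sub (hz0 : z ≠ 0) : unitB z ^ 2 - haupt z * unitA z = unitC z := by
  have := unitA_sq_add (z := -z) (by simpa using hz) (neg_ne_zero.2 hz0)
  rw [unitA_neg hz, unitB_neg hz, unitD_neg hz, haupt_neg] at this
  rw [← this]; ring

/-- Inserting D = A² + xB and C = B² - xA into CD = AB - 8x² and using AB = 1 - x² leaves x times a
cubic in A - B. It factors with the root A - B = 2x. -/
theorem unit_cubic (hz0 : z ≠ 0) :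
    (unitA z - unitB z - 2 * haupt z) * ((unitA z - unitB z + haupt z) ^ 2 + 3) = 0 := by
  have a := unitA_sq_add hz hz0
  have b := unitB_sq_sub hz hz0
  have c := unitA_mul_unitB hz hz0
  have d := unitC_mul_unitD hz hz0
  have hx : haupt z ≠ 0 := by
    refine mul_ne_zero hz0 (div_ne_zero ?_ ?_) <;>
    exact mul_ne_zero (pow_ne_zero _ (euler_pow_ne_zero hz (by norm_num)))
      (pow_ne_zero _ (euler_pow_ne_zero hz (by norm_num)))
  refine (mul_eq_zero.1 (?_ : haupt z * _ = 0)).resolve_left hx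
  rw [← a, ← b] at d
  generalize haupt z = x at *
  generalize unitA z = A at *
  generalize unitB z = B at *
  linear_combination d + (A * B - 3 * x * (A - B) - 2 * x ^ 2) * c

end

/-! ### The units as linear functions of the Hauptmodul -/

theorem differentiableOn_euler_pow {n : ℕ} (hn : n ≠ 0) :
    DifferentiableOn ℂ (fun z => euler (z ^ n)) (Metric.ball 0 1) :=
  differentiableOn_euler.comp (by fun_prop) fun z hz => by
    simp only [Metric.mem_ball, dist_zero_right] at hz ⊢
    exact norm_pow_lt hz hn

theorem differentiableOn_haupt : DifferentiableOn ℂ haupt (Metric.ball 0 1) := by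
  have h2 := differentiableOn_euler_pow (n := 2) (by norm_num)
  have h4 := differentiableOn_euler_pow (n := 4) (by norm_num)
  have h6 := differentiableOn_euler_pow (n := 6) (by norm_num)
  have h12 := differentiableOn_euler_pow (n := 12) (by norm_num)
  refine differentiableOn_id.mul (((h2.pow 2).mul (h12.pow 4)).div ((h4.pow 4).mul (h6.pow 2)) ?_)
  intro z hz
  simp only [Metric.mem_ball, dist_zero_right] at hz
  exact mul_ne_zero (pow_ne_zero _ (euler_pow_ne_zero hz (by norm_num)))
      (pow_ne_zero _ (euler_pow_ne_zero hz (by norm_num)))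

theorem differentiableOn_unitA : DifferentiableOn ℂ unitA (Metric.ball 0 1) := by
  have h2 := differentiableOn_euler_pow (n := 2) (by norm_num)
  have h3 := differentiableOn_euler_pow (n := 3) (by norm_num)
  have h4 := differentiableOn_euler_pow (n := 4) (by norm_num)
  have h6 := differentiableOn_euler_pow (n := 6) (by norm_num)
  have h12 := differentiableOn_euler_pow (n := 12) (by norm_num)
  refine (((h3.pow 3).mul (h2.pow 2)).mul h12).div
    ((differentiableOn_euler.mul (h4.pow 3)).mul (h6.pow 2)) ?_
  intro z hz
  simp only [Metric.mem_ball, dist_zero_right] at hz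
  exact mul_ne_zero (mul_ne_zero (euler_ne_zero hz) (pow_ne_zero _ (euler_pow_ne_zero hz (by norm_num))))
      (pow_ne_zero _ (euler_pow_ne_zero hz (by norm_num)))

theorem differentiableOn_unitB : DifferentiableOn ℂ unitB (Metric.ball 0 1) := by
  refine (differentiableOn_unitA.comp (f := Neg.neg) (s := Metric.ball 0 1) differentiable_neg.differentiableOn (t := Metric.ball 0 1) fun z hz => ?_).congr fun z hz => ?_
  · simpa using hz
  · exact (unitA_neg (by simpa using hz)).symm

/-- Two holomorphic functions on the unit disc that agree near `0` agree everywhere. -/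
theorem eqOn_unitBall_of_eventually {g h : ℂ → ℂ} (hg : DifferentiableOn ℂ g (Metric.ball 0 1))
    (hh : DifferentiableOn ℂ h (Metric.ball 0 1)) (H : ∀ᶠ z in 𝓝[≠] 0, g z = h z) {z : ℂ}
    (hz : ‖z‖ < 1) : g z = h z :=
  (hg.analyticOnNhd Metric.isOpen_ball).eqOn_of_preconnected_of_frequently_eq
    (hh.analyticOnNhd Metric.isOpen_ball) (convex_ball 0 1).isPreconnected
    (Metric.mem_ball_self one_pos) H.frequently (by simpa using hz)

theorem eventually_norm_lt_one : ∀ᶠ z : ℂ in 𝓝[≠] 0, ‖z‖ < 1 ∧ z ≠ 0 := by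
  refine Filter.Eventually.and (nhdsWithin_le_nhds ?_) self_mem_nhdsWithin
  filter_upwards [Metric.ball_mem_nhds (0 : ℂ) one_pos] with z hz
  simpa using hz

theorem haupt_zero : haupt 0 = 0 := by simp [haupt]
theorem unitA_zero : unitA 0 = 1 := by simp [unitA, euler_zero]
theorem unitB_zero : unitB 0 = 1 := by simp [unitB, euler_zero]

/-- The quadratic factor in `unit_cubic` equals 3 at the origin, so near 0 the linear factor must
vanish; the identity theorem extends this to the disc. -/
theorem unitA_sub_unitB {z : ℂ} (hz : ‖z‖ < 1) : unitA z - unitB z = 2 * haupt z := by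
  refine eqOn_unitBall_of_eventually (g := fun z => unitA z - unitB z) (h := fun z => 2 * haupt z)
    (differentiableOn_unitA.sub differentiableOn_unitB) (differentiableOn_haupt.const_mul 2) ?_ hz
  have hball := Metric.ball_mem_nhds (0 : ℂ) one_pos
  have ca := (differentiableOn_unitA.differentiableAt hball).continuousAt
  have cb := (differentiableOn_unitB.differentiableAt hball).continuousAt
  have cx := (differentiableOn_haupt.differentiableAt hball).continuousAt
  have hc : ContinuousAt (fun z => (unitA z - unitB z + haupt z) ^ 2 + 3) 0 := by fun_prop
  have hne := hc.eventually_ne (y := 0) (by simp [haupt_zero, unitA_zero, unitB_zero])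
  filter_upwards [nhdsWithin_le_nhds hne, eventually_norm_lt_one] with z h1 h2
  exact sub_eq_zero.1 ((mul_eq_zero.1 (unit_cubic h2.1 h2.2)).resolve_right h1)

/-- (A + B)² = (A - B)² + 4AB = 4x² + 4(1 - x²) = 4, and the value at 0 fixes the sign. -/
theorem unitA_add_unitB {z : ℂ} (hz : ‖z‖ < 1) : unitA z + unitB z = 2 := by
  refine eqOn_unitBall_of_eventually (g := fun z => unitA z + unitB z) (h := fun z => 2)
    (differentiableOn_unitA.add differentiableOn_unitB) (differentiableOn_const 2) ?_ hz
  have hball := Metric.ball_mem_nhds (0 : ℂ) one_pos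
  have ca := (differentiableOn_unitA.differentiableAt hball).continuousAt
  have cb := (differentiableOn_unitB.differentiableAt hball).continuousAt
  have hc : ContinuousAt (fun z => unitA z + unitB z + 2) 0 := by fun_prop
  have hne := hc.eventually_ne (y := 0) (by simp [unitA_zero, unitB_zero]; norm_num)
  filter_upwards [nhdsWithin_le_nhds hne, eventually_norm_lt_one] with z h1 h2
  have a := unitA_sub_unitB h2.1
  have b := unitA_mul_unitB h2.1 h2.2
  refine sub_eq_zero.1 ((mul_eq_zero.1 (?_ : _ * (unitA z + unitB z + 2) = 0)).resolve_right h1)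
  linear_combination (unitA z - unitB z + 2 * haupt z) * a + 4 * b

section
variable {z : ℂ} (hz : ‖z‖ < 1) (hz0 : z ≠ 0)
include hz

theorem unitA_eq : unitA z = 1 + haupt z := by
  linear_combination (unitA_sub_unitB hz + unitA_add_unitB hz) / 2

theorem unitB_eq : unitB z = 1 - haupt z := by
  linear_combination (-unitA_sub_unitB hz + unitA_add_unitB hz) / 2

include hz0

theorem unitC_eq : unitC z = 1 - 3 * haupt z := by
  rw [← unitB_sq_sub hz hz0, unitA_eq hz, unitB_eq hz]; ring

theorem unitD_eq : unitD z = 1 + 3 * haupt z := by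
  rw [← unitA_sq_add hz hz0, unitA_eq hz, unitB_eq hz]; ring

end


/-! ### Sections of power series and the operator `U` -/

theorem hasSum_nat_mod_three {g : ℕ → ℂ} {S a b c : ℂ} (h : HasSum g S)
    (h0 : HasSum (fun m => g (3 * m)) a) (h1 : HasSum (fun m => g (3 * m + 1)) b)
    (h2 : HasSum (fun m => g (3 * m + 2)) c) : S = a + b + c := by
  have H := ((Equiv.prodComm _ _).trans (Nat.divModEquiv 3).symm).hasSum_iff.2 h
  have H2 : HasSum (![a, b, c] : Fin 3 → ℂ) S := by
    refine H.prod_fiberwise fun i => ?_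
    fin_cases i
    · refine h0.congr_fun fun m => ?_
      simp [Nat.divModEquiv, mul_comm]
    · refine h1.congr_fun fun m => ?_
      simp [Nat.divModEquiv, mul_comm]
    · refine h2.congr_fun fun m => ?_
      simp [Nat.divModEquiv, mul_comm]
  rw [H2.unique (hasSum_fintype _), Fin.sum_univ_three]; rfl

/-- The sections of a power series are read off from a 3-dissection of its sum. -/
theorem hasSum_of_dissection {a : ℕ → ℂ} {G₀ G₁ G₂ : ℂ → ℂ}
    (hS : ∀ r : ℂ, ‖r‖ < 1 → r ≠ 0 →
      HasSum (fun n => a n * r ^ n) (G₀ (r ^ 3) + r * G₁ (r ^ 3) + r ^ 2 * G₂ (r ^ 3)))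
    {z : ℂ} (hz : ‖z‖ < 1) (hz0 : z ≠ 0) :
    HasSum (fun n => a (3 * n) * z ^ n) (G₀ z) ∧ HasSum (fun n => a (3 * n + 1) * z ^ n) (G₁ z) ∧
      HasSum (fun n => a (3 * n + 2) * z ^ n) (G₂ z) := by
  obtain ⟨r, rfl, hr, hr0⟩ := exists_pow_three hz hz0
  obtain ⟨ω, hω, hn⟩ := exists_cubeRoot_unity
  have h3 : ω ^ 3 = 1 := by linear_combination (ω - 1) * hω
  have hω0 : ω ≠ 0 := by rintro rfl; simp at hn
  have hn2 : ‖ω ^ 2‖ = 1 := by rw [norm_pow, hn, one_pow]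
  have hs := (hS r hr hr0).summable
  have inj : ∀ i, Function.Injective fun n : ℕ => 3 * n + i := fun i m n h => by
    simp only at h; omega
  have hsum : ∀ i, Summable fun n => a (3 * n + i) * (r ^ 3) ^ n := fun i => by
    refine ((hs.comp_injective (inj i)).mul_right (r ^ i)⁻¹).congr fun n => ?_
    simp only [Function.comp, pow_add, ← pow_mul]
    field_simp
  -- Evaluating at the three cube roots of r³ gives an invertible Vandermonde system in the
  -- components. Hence no regularity of `G₀`, `G₁`, `G₂` is needed.
  have key : ∀ ρ : ℂ, ‖ρ‖ < 1 → ρ ≠ 0 → ρ ^ 3 = r ^ 3 →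
      G₀ (r ^ 3) + ρ * G₁ (r ^ 3) + ρ ^ 2 * G₂ (r ^ 3) = (∑' n, a (3 * n + 0) * (r ^ 3) ^ n)
        + ρ * (∑' n, a (3 * n + 1) * (r ^ 3) ^ n) + ρ ^ 2 * ∑' n, a (3 * n + 2) * (r ^ 3) ^ n := by
    intro ρ h1 h2 h
    rw [← h]
    refine hasSum_nat_mod_three (hS ρ h1 h2) ?_ ?_ ?_
    · rw [h]; refine (hsum 0).hasSum.congr_fun fun n => ?_
      rw [← h, ← pow_mul]; rfl
    · rw [h]; refine ((hsum 1).hasSum.mul_left ρ).congr_fun fun n => ?_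
      rw [← h, ← pow_mul, pow_succ]; ring
    · rw [h]; refine ((hsum 2).hasSum.mul_left (ρ ^ 2)).congr_fun fun n => ?_
      rw [← h, ← pow_mul, pow_add]; ring
  have k0 := key r hr hr0 rfl
  have k1 := key (ω * r) (norm_unit_mul hn hr) (mul_ne_zero hω0 hr0) (by rw [mul_pow, h3, one_mul])
  have k2 := key (ω ^ 2 * r) (norm_unit_mul hn2 hr) (mul_ne_zero (pow_ne_zero 2 hω0) hr0)
    (by rw [mul_pow, ← pow_mul, mul_comm 2, pow_mul, h3, one_pow, one_mul])
  have s0 := (hsum 0).hasSum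
  have s1 := (hsum 1).hasSum
  have s2 := (hsum 2).hasSum
  generalize (∑' n, a (3 * n + 0) * (r ^ 3) ^ n) = A at *
  generalize (∑' n, a (3 * n + 1) * (r ^ 3) ^ n) = B at *
  generalize (∑' n, a (3 * n + 2) * (r ^ 3) ^ n) = C at *
  have e0 : G₀ (r ^ 3) = A := by
    linear_combination (k0 + k1 + k2) / 3 - (r * (G₁ (r ^ 3) - B) + r ^ 2 * (ω ^ 2 - ω + 1) * (G₂ (r ^ 3) - C)) / 3 * hω
  have e1 : G₁ (r ^ 3) = B := by
    refine mul_left_cancel₀ hr0 ?_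
    linear_combination (k0 + ω ^ 2 * k1 + ω * k2) / 3 - ((G₀ (r ^ 3) - A) + r ^ 2 * (G₂ (r ^ 3) - C)) / 3 * hω
      - (2 * r * (G₁ (r ^ 3) - B) + r ^ 2 * (ω + ω ^ 2) * (G₂ (r ^ 3) - C)) / 3 * h3
  have e2 : G₂ (r ^ 3) = C := by
    refine mul_left_cancel₀ (pow_ne_zero 2 hr0) ?_
    linear_combination k0 - (e0 + r * e1)
  rw [e0, e1, e2]
  exact ⟨s0, s1, s2⟩

theorem q_ne_zero (τ : ℍ) : q τ ≠ 0 := Complex.exp_ne_zero _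

theorem norm_q (τ : ℍ) : ‖q τ‖ = Real.exp (-2 * Real.pi * τ.im) := by
  rw [q, Complex.norm_exp]; simp

theorem norm_q_lt_one (τ : ℍ) : ‖q τ‖ < 1 := by
  rw [norm_q, Real.exp_lt_one_iff]
  have := mul_pos Real.pi_pos τ.im_pos
  linarith

theorem q_vadd_I (x : ℝ) :
    q (x +ᵥ UpperHalfPlane.I) = Complex.exp (2 * Real.pi * Complex.I * x) * Complex.exp (-2 * Real.pi) := by
  rw [q, ← Complex.exp_add]
  congr 1
  simp only [UpperHalfPlane.coe_vadd, UpperHalfPlane.coe_I]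
  linear_combination (2 * Real.pi : ℂ) * Complex.I_sq

theorem integral_q_zpow (j : ℤ) :
    ∫ x in (0 : ℝ)..1, q (x +ᵥ UpperHalfPlane.I) ^ j = if j = 0 then 1 else 0 := by
  split_ifs with h
  · simp [h]
  · have hc : (2 * Real.pi * Complex.I * j : ℂ) ≠ 0 := by
      simp [Real.pi_ne_zero, h]
    have e : ∀ x : ℝ, q (x +ᵥ UpperHalfPlane.I) ^ j
        = Complex.exp (2 * Real.pi * Complex.I * j * x) * Complex.exp (-2 * Real.pi) ^ j := fun x => by
      rw [q_vadd_I, mul_zpow, ← Complex.exp_int_mul]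
      congr 2; ring
    simp_rw [e]
    rw [intervalIntegral.integral_mul_const, integral_exp_mul_complex hc]
    have : Complex.exp (2 * Real.pi * Complex.I * j * (1 : ℝ)) = 1 := by
      rw [Complex.exp_eq_one_iff]; exact ⟨j, by push_cast; ring⟩
    rw [this]; simp

theorem continuous_q_vadd_I : Continuous fun x : ℝ => q (x +ᵥ UpperHalfPlane.I) := by
  simp_rw [q_vadd_I]; fun_prop

/-- Fourier coefficients of the sum of a Laurent series in `q`. -/
theorem fourierCoeff_eq {P : ℍ → ℂ} {k : ℕ → ℂ} {d : ℤ}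
    (h : ∀ τ, HasSum (fun n : ℕ => k n * q τ ^ (n + d)) (P τ)) (m : ℤ) :
    HasSum (fun n : ℕ => if n + d = m then k n else 0) (fourierCoeff P m) := by
  -- The absolute value of the nome is constant on the line of integration, so absolute convergence
  -- at i dominates the whole series.
  have hI : ∀ x : ℝ, ‖q (x +ᵥ UpperHalfPlane.I)‖ = ‖q UpperHalfPlane.I‖ := fun x => by
    simp [norm_q]
  have H := intervalIntegral.hasSum_integral_of_dominated_convergence (μ := MeasureTheory.volume)
    (a := 0) (b := 1) (F := fun (n : ℕ) (x : ℝ) => k n * q (x +ᵥ UpperHalfPlane.I) ^ (n + d - m))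
    (f := fun x : ℝ => P (x +ᵥ UpperHalfPlane.I) * q (x +ᵥ UpperHalfPlane.I) ^ (-m))
    (fun n _ => ‖k n‖ * ‖q UpperHalfPlane.I‖ ^ (n + d - m)) ?_ ?_ ?_ ?_ ?_
  · refine H.congr_fun fun n => ?_
    rw [intervalIntegral.integral_const_mul, integral_q_zpow]
    simp only [sub_eq_zero]
    split_ifs <;> simp
  · intro n
    have hc : Continuous fun x : ℝ => k n * q (x +ᵥ UpperHalfPlane.I) ^ (n + d - m) :=
      continuous_const.mul (continuous_q_vadd_I.zpow₀ _ fun x => Or.inl (q_ne_zero _))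
    exact hc.aestronglyMeasurable
  · intro n
    refine Eventually.of_forall fun x _ => ?_
    rw [norm_mul, norm_zpow, hI]
  · refine Eventually.of_forall fun x _ => ?_
    refine ((h UpperHalfPlane.I).summable.norm.mul_right (‖q UpperHalfPlane.I‖ ^ (-m))).congr fun n => ?_
    rw [norm_mul, norm_zpow, mul_assoc, ← zpow_add₀ (norm_ne_zero_iff.2 (q_ne_zero _))]; rfl
  · exact intervalIntegrable_const
  · refine Eventually.of_forall fun x _ => ?_
    refine ((h _).mul_right (q (x +ᵥ UpperHalfPlane.I) ^ (-m))).congr_fun fun n => ?_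
    rw [mul_assoc, ← zpow_add₀ (q_ne_zero _)]; rfl

/-- The common shift by q⁻³ accommodates the deepest pole among the four P, that of `Ppbar`. As 3
divides the exponent, the shift becomes a single factor q⁻¹ after U₃. -/
theorem hasSum_U_three {P : ℍ → ℂ} {k : ℕ → ℂ}
    (h : ∀ τ, HasSum (fun n : ℕ => k n * q τ ^ (n + (-3) : ℤ)) (P τ)) {τ : ℍ} {S : ℂ}
    (hS : HasSum (fun n : ℕ => k (3 * n) * q τ ^ n) S) : U 3 P τ = S / q τ := by
  have hinj : Function.Injective fun n : ℕ => (n : ℤ) - 1 := fun m n h => by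
    simp only at h; omega
  refine HasSum.tsum_eq ((hinj.hasSum_iff ?_).1 ?_)
  · intro j hj
    have hz : HasSum (fun n : ℕ => if (n : ℤ) + -3 = (3 : ℕ) * j then k n else 0) 0 := by
      convert hasSum_zero with n
      rw [if_neg]
      intro h
      -- A nonzero coefficient at 3j requires 3j ≥ -3, so only j = n - 1 with n natural contribute.
      exact hj ⟨(j + 1).toNat, by simp only; omega⟩
    rw [(fourierCoeff_eq h _).unique hz, zero_mul]
  · refine (hS.div_const (q τ)).congr_fun fun n => ?_
    have hz : HasSum (fun l : ℕ => if (l : ℤ) + -3 = (3 : ℕ) * ((n : ℤ) - 1) then k l else 0) (k (3 * n)) := by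
      convert hasSum_ite_eq (3 * n) (k (3 * n)) using 2 with l
      by_cases h : l = 3 * n
      · subst h; rw [if_pos (by push_cast; ring), if_pos rfl]
      · rw [if_neg (by omega), if_neg h]
    simp only [Function.comp]
    rw [(fourierCoeff_eq h _).unique hz, zpow_sub_one₀ (q_ne_zero _), zpow_natCast]
    ring

theorem exists_hasSum_of_differentiableOn {K : ℂ → ℂ} (hK : DifferentiableOn ℂ K (Metric.ball 0 1)) :
    ∃ k : ℕ → ℂ, ∀ z : ℂ, ‖z‖ < 1 → HasSum (fun n => k n * z ^ n) (K z) := by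
  refine ⟨fun n => (n.factorial : ℂ)⁻¹ * iteratedDeriv n K 0, fun z hz => ?_⟩
  have := Complex.hasSum_taylorSeries_on_ball (r := 1) (c := 0) (f := K) (by simpa using hK)
    (z := z) (by simpa using hz)
  refine this.congr_fun fun n => ?_
  simp only [sub_zero, smul_eq_mul]
  ring

/-- The action of `U₃` on a function with a 3-dissection. -/
theorem U_three_eq {P : ℍ → ℂ} {G H H₀ H₁ H₂ : ℂ → ℂ}
    (hK : DifferentiableOn ℂ (fun z => G (z ^ 3) * H z) (Metric.ball 0 1))
    (hP : ∀ τ, P τ = G (q τ ^ 3) * H (q τ) / q τ ^ 3)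
    (hH : ∀ r : ℂ, ‖r‖ < 1 → r ≠ 0 → H r = H₀ (r ^ 3) + r * H₁ (r ^ 3) + r ^ 2 * H₂ (r ^ 3)) (τ : ℍ) :
    U 3 P τ = G (q τ) * H₀ (q τ) / q τ := by
  obtain ⟨k, hk⟩ := exists_hasSum_of_differentiableOn hK
  refine hasSum_U_three (k := k) (fun τ => ?_) ?_
  · rw [hP]
    refine ((hk _ (norm_q_lt_one τ)).div_const (q τ ^ 3)).congr_fun fun n => ?_
    rw [zpow_add₀ (q_ne_zero τ), zpow_natCast, zpow_neg]
    norm_cast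
    ring
  · refine (hasSum_of_dissection (G₀ := fun z => G z * H₀ z) (G₁ := fun z => G z * H₁ z)
      (G₂ := fun z => G z * H₂ z) (fun r hr hr0 => ?_) (norm_q_lt_one τ) (q_ne_zero τ)).1
    convert hk r hr using 1
    rw [hH r hr hr0]; ring


/-! ### Generating functions of partitions -/

theorem hasSum_coeff_mul {A B : PowerSeries ℝ} {z a b : ℂ}
    (hA : HasSum (fun n => (A.coeff n : ℂ) * z ^ n) a)
    (hB : HasSum (fun n => (B.coeff n : ℂ) * z ^ n) b) :
    HasSum (fun n => ((A * B).coeff n : ℂ) * z ^ n) (a * b) := by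
  have h1 := summable_norm_sum_mul_antidiagonal_of_summable_norm hA.summable.norm hB.summable.norm
  have h2 := tsum_mul_tsum_eq_tsum_sum_antidiagonal_of_summable_norm hA.summable.norm hB.summable.norm
  rw [hA.tsum_eq, hB.tsum_eq] at h2
  rw [h2]
  refine h1.of_norm.hasSum.congr_fun fun n => ?_
  rw [PowerSeries.coeff_mul]
  push_cast
  rw [Finset.sum_mul]
  refine Finset.sum_congr rfl fun p hp => ?_
  rw [← Finset.HasAntidiagonal.mem_antidiagonal.1 hp, pow_add]
  ring

open scoped PowerSeries.WithPiTopology in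
/-- The factor of the generating function `genFun f` belonging to the part `i + 1`. -/
def genFactor (f : ℕ → ℕ → ℝ) (i : ℕ) : PowerSeries ℝ :=
  1 + ∑' j, f (i + 1) (j + 1) • PowerSeries.X ^ ((i + 1) * (j + 1))

open scoped PowerSeries.WithPiTopology in
theorem coeff_genFactor (f : ℕ → ℕ → ℝ) (i n : ℕ) : (genFactor f i).coeff n =
    (if n = 0 then 1 else 0) + ∑' j, if n = (i + 1) * (j + 1) then f (i + 1) (j + 1) else 0 := by
  rw [genFactor, map_add, (Nat.Partition.summable_genFun_term f i).map_tsum _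
    (PowerSeries.WithPiTopology.continuous_coeff _ _)]
  simp [PowerSeries.coeff_one, PowerSeries.coeff_X_pow]

theorem hasSum_genFactor {f : ℕ → ℕ → ℝ} {i : ℕ} {z v : ℂ}
    (h : HasSum (fun j : ℕ => (f (i + 1) (j + 1) : ℂ) * z ^ ((i + 1) * (j + 1))) (v - 1)) :
    HasSum (fun n => ((genFactor f i).coeff n : ℂ) * z ^ n) v := by
  have hinj : Function.Injective fun j : ℕ => (i + 1) * (j + 1) := fun a b h => by
    simpa using h
  have hval : ∀ j, (∑' k, if (i + 1) * (j + 1) = (i + 1) * (k + 1) then f (i + 1) (k + 1) else 0)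
      = f (i + 1) (j + 1) := fun j => by
    rw [tsum_eq_single j fun k hk => if_neg fun h => hk (hinj h).symm, if_pos rfl]
  have h1 : HasSum (fun n => ((∑' j, if n = (i + 1) * (j + 1) then f (i + 1) (j + 1) else 0 : ℝ) : ℂ)
      * z ^ n) (v - 1) := by
    refine (hinj.hasSum_iff fun n hn => ?_).1 (h.congr_fun fun j => ?_)
    · rw [tsum_congr (fun j => if_neg fun h => hn ⟨j, h.symm⟩)]; simp
    · simp only [Function.comp]; rw [hval]
  have h0 := (hasSum_ite_eq (0 : ℕ) (1 : ℂ)).add h1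
  rw [add_sub_cancel] at h0
  refine h0.congr_fun fun n => ?_
  rw [coeff_genFactor]
  split_ifs with hn
  · subst hn; simp
  · simp

theorem genFactor_coeff_zero (f : ℕ → ℕ → ℝ) (i : ℕ) : (genFactor f i).coeff 0 = 1 := by
  rw [coeff_genFactor]; simp

theorem genFactor_coeff_nonneg {f : ℕ → ℕ → ℝ} (hf : ∀ i j, 0 ≤ f i j) (i n : ℕ) :
    0 ≤ (genFactor f i).coeff n := by
  rw [coeff_genFactor]
  refine add_nonneg (by split_ifs <;> norm_num) (tsum_nonneg fun j => ?_)
  split_ifs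
  · exact hf _ _
  · exact le_rfl

open scoped PowerSeries.WithPiTopology in
/-- Convergence of the generating function of a weighted partition count to its Euler product. -/
theorem hasSum_genFun {f : ℕ → ℕ → ℝ} (hf : ∀ i j, 0 ≤ f i j) {φ : ℕ → ℂ → ℂ} {L : ℂ → ℂ} {z : ℂ}
    (hz : ‖z‖ < 1)
    (hφ : ∀ i : ℕ, ∀ w : ℂ, ‖w‖ < 1 →
      HasSum (fun j : ℕ => (f (i + 1) (j + 1) : ℂ) * w ^ ((i + 1) * (j + 1))) (φ i w - 1))
    (hL : ∀ w : ℂ, ‖w‖ < 1 → Tendsto (fun N => ∏ i ∈ Finset.range N, φ i w) atTop (𝓝 (L w))) :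
    HasSum (fun n => ((Nat.Partition.genFun f).coeff n : ℂ) * z ^ n) (L z) := by
  set P : ℕ → PowerSeries ℝ := fun N => ∏ i ∈ Finset.range N, genFactor f i with hP
  have hsucc : ∀ N, P (N + 1) = P N * genFactor f N := fun N => Finset.prod_range_succ _ _
  have hPs : ∀ w : ℂ, ‖w‖ < 1 → ∀ N,
      HasSum (fun n => ((P N).coeff n : ℂ) * w ^ n) (∏ i ∈ Finset.range N, φ i w) := by
    intro w hw N
    induction N with
    | zero =>
      convert hasSum_ite_eq (0 : ℕ) (1 : ℂ) using 2 with n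
      · simp only [hP, Finset.range_zero, Finset.prod_empty, PowerSeries.coeff_one]
        split_ifs with h
        · simp [h]
        · simp
      · simp
    | succ N ih =>
      rw [hsucc, Finset.prod_range_succ]
      exact hasSum_coeff_mul ih (hasSum_genFactor (hφ N w hw))
  have hpos : ∀ N n, 0 ≤ (P N).coeff n := by
    intro N
    induction N with
    | zero => intro n; simp only [hP, Finset.range_zero, Finset.prod_empty, PowerSeries.coeff_one]; split_ifs <;> norm_num
    | succ N ih =>
      intro n
      rw [hsucc, PowerSeries.coeff_mul]
      exact Finset.sum_nonneg fun p _ => mul_nonneg (ih _) (genFactor_coeff_nonneg hf _ _)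
  -- Every factor has nonnegative coefficients and constant term 1, so coefficients of the partial
  -- products increase to those of `genFun`. Convergence of the products at ‖z‖ bounds the limit
  -- series, which then serves as the dominating series.
  have hmono : ∀ n, Monotone fun N => (P N).coeff n := fun n => monotone_nat_of_le_succ fun N => by
    change (P N).coeff n ≤ (P (N + 1)).coeff n
    rw [hsucc, PowerSeries.coeff_mul]
    have : (P N).coeff n = (P N).coeff n * (genFactor f N).coeff 0 := by
      rw [genFactor_coeff_zero, mul_one]
    rw [this]
    exact Finset.single_le_sum (f := fun p : ℕ × ℕ => (P N).coeff p.1 * (genFactor f N).coeff p.2)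
      (fun p _ => mul_nonneg (hpos _ _) (genFactor_coeff_nonneg hf _ _))
      (show (n, 0) ∈ Finset.HasAntidiagonal.antidiagonal n by simp)
  have hlim : ∀ n, Tendsto (fun N => (P N).coeff n) atTop (𝓝 ((Nat.Partition.genFun f).coeff n)) := by
    intro n
    have := (Nat.Partition.hasProd_genFun f)
    rw [HasProd, PowerSeries.WithPiTopology.tendsto_iff_coeff_tendsto] at this
    exact (this n).comp tendsto_finset_range
  have hle : ∀ N n, (P N).coeff n ≤ (Nat.Partition.genFun f).coeff n := fun N n =>
    (hmono n).ge_of_tendsto (hlim n) N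
  have hr : ‖((‖z‖ : ℝ) : ℂ)‖ < 1 := by simpa using hz
  obtain ⟨K, hK⟩ := (hL _ hr).norm.bddAbove_range
  have hbound : Summable fun n => (Nat.Partition.genFun f).coeff n * ‖z‖ ^ n := by
    refine summable_of_sum_range_le (c := K) (fun n => mul_nonneg ((hpos 0 n).trans (hle 0 n))
      (pow_nonneg (norm_nonneg z) n)) fun M => ?_
    refine le_of_tendsto (tendsto_finsetSum _ fun n _ => (hlim n).mul_const (‖z‖ ^ n))
      (Eventually.of_forall fun N => ?_)
    have h1 := hPs _ hr N
    have h2 : HasSum (fun n => (P N).coeff n * ‖z‖ ^ n) (∏ i ∈ Finset.range N, φ i (‖z‖ : ℝ)).re := by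
      refine (Complex.hasSum_re h1).congr_fun fun n => ?_
      rw [← Complex.ofReal_pow, ← Complex.ofReal_mul, Complex.ofReal_re]
    refine (h2.summable.sum_le_tsum _ fun n _ => mul_nonneg (hpos N n)
      (pow_nonneg (norm_nonneg z) n)).trans ?_
    rw [h2.tsum_eq]
    exact (Complex.re_le_norm _).trans (hK ⟨N, rfl⟩)
  have hT := tendsto_tsum_of_dominated_convergence hbound
    (f := fun N n => ((P N).coeff n : ℂ) * z ^ n)
    (g := fun n => ((Nat.Partition.genFun f).coeff n : ℂ) * z ^ n) (𝓕 := atTop)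
    (fun n => ((Complex.continuous_ofReal.tendsto _).comp (hlim n)).mul_const _)
    (Eventually.of_forall fun N n => by
      rw [norm_mul, norm_pow, Complex.norm_real, Real.norm_of_nonneg (hpos N n)]
      have := hle N n
      gcongr)
  have e := tendsto_nhds_unique ((hL z hz).congr fun N => (hPs z hz N).tsum_eq.symm) hT
  rw [e]
  refine (Summable.of_norm ?_).hasSum
  refine hbound.congr fun n => ?_
  rw [norm_mul, norm_pow, Complex.norm_real, Real.norm_of_nonneg ((hpos 0 n).trans (hle 0 n))]

/-! ### Euler products of the four counting functions -/

theorem ped_eq_coeff (n : ℕ) : ((Nat.Partition.genFun fun i c : ℕ =>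
    if Even i → c ≤ 1 then (1 : ℝ) else 0).coeff n : ℝ) = ped n := by
  rw [Nat.Partition.coeff_genFun, ped, Finset.card_filter]
  push_cast
  refine Finset.sum_congr rfl fun p _ => ?_
  rw [Finsupp.prod, Finset.prod_boole]
  simp

theorem pod_eq_coeff (n : ℕ) : ((Nat.Partition.genFun fun i c : ℕ =>
    if Odd i → c ≤ 1 then (1 : ℝ) else 0).coeff n : ℝ) = pod n := by
  rw [Nat.Partition.coeff_genFun, pod, Finset.card_filter]
  push_cast
  refine Finset.sum_congr rfl fun p _ => ?_
  rw [Finsupp.prod, Finset.prod_boole]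
  simp

/-- Each part size that occurs may be overlined or not, giving weight 2 whatever its multiplicity.
-/
theorem pbar_eq_coeff (n : ℕ) :
    ((Nat.Partition.genFun fun _ _ : ℕ => (2 : ℝ)).coeff n : ℝ) = pbar n := by
  rw [Nat.Partition.coeff_genFun, pbar, overpartitions, Finset.card_sigma]
  push_cast
  refine Finset.sum_congr rfl fun p _ => ?_
  simp [Finsupp.prod]

theorem pobar_eq_coeff (n : ℕ) : ((Nat.Partition.genFun fun i _ : ℕ =>
    if Odd i then (2 : ℝ) else 0).coeff n : ℝ) = pobar n := by
  rw [Nat.Partition.coeff_genFun, pobar, overpartitions, Finset.card_filter, Finset.sum_sigma]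
  push_cast
  refine Finset.sum_congr rfl fun p _ => ?_
  rw [Finsupp.prod, Finset.prod_ite_zero]
  simp

section
variable {w : ℂ} (hw : ‖w‖ < 1)
include hw

theorem one_sub_pow_ne_zero (i : ℕ) : 1 - w ^ (i + 1) ≠ 0 :=
  sub_ne_zero.2 (pow_ne_one_of_norm_lt hw i.succ_ne_zero).symm

theorem hasSum_geometric_parts (i : ℕ) (c : ℂ) : HasSum (fun j : ℕ => c * w ^ ((i + 1) * (j + 1)))
    (c * (w ^ (i + 1) / (1 - w ^ (i + 1)))) := by
  refine HasSum.mul_left c ?_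
  have := (hasSum_geometric_of_norm_lt_one (norm_pow_lt hw i.succ_ne_zero)).mul_left (w ^ (i + 1))
  rw [← div_eq_mul_inv] at this
  refine this.congr_fun fun j => ?_
  rw [mul_comm (i + 1), add_mul, pow_add, mul_comm j, pow_mul, one_mul, mul_comm]

omit hw in
theorem hasSum_distinct_parts (i : ℕ) :
    HasSum (fun j : ℕ => (if j + 1 ≤ 1 then (1 : ℂ) else 0) * w ^ ((i + 1) * (j + 1))) (w ^ (i + 1)) := by
  convert hasSum_ite_eq (0 : ℕ) (w ^ (i + 1)) using 2 with j
  by_cases h : j = 0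
  · simp [h]
  · simp [h]

theorem tendsto_prod_even {k : ℕ} (hk : k ≠ 0) :
    Tendsto (fun N => ∏ i ∈ Finset.range N, if Even (i + 1) then 1 - (w ^ k) ^ (i + 1) else 1) atTop
      (𝓝 (euler (w ^ (2 * k)))) := by
  have hinj : Function.Injective fun n : ℕ => 2 * n + 1 := fun a b h => by simpa using h
  have h := (multipliable_poch (w ^ (2 * k)) (norm_pow_lt hw (n := 2 * k) (by omega))).hasProd
  refine HasProd.tendsto_prod_nat ((hinj.hasProd_iff fun i hi => ?_).1 ?_)
  · rw [if_neg fun h => hi ?_]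
    obtain ⟨m, hm⟩ := h
    exact ⟨m - 1, by simp only; omega⟩
  · rw [euler_eq_poch]
    refine h.congr_fun fun n => ?_
    simp only [Function.comp]
    rw [if_pos ⟨n + 1, by ring⟩]
    ring

theorem tendsto_prod_odd {k : ℕ} (hk : k ≠ 0) :
    Tendsto (fun N => ∏ i ∈ Finset.range N, if Odd (i + 1) then 1 - (w ^ k) ^ (i + 1) else 1) atTop
      (𝓝 (euler (w ^ k) / euler (w ^ (2 * k)))) := by
  have hinj : Function.Injective fun n : ℕ => 2 * n := fun a b h => by simpa using h
  have h := (multipliable_poch (w ^ k) (norm_pow_lt hw (n := 2 * k) (by omega))).hasProd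
  have e := poch_odd_mul (norm_pow_lt hw hk)
  rw [← pow_mul, mul_comm k] at e
  rw [← e, mul_div_cancel_right₀ _ (euler_pow_ne_zero hw (by omega))]
  refine HasProd.tendsto_prod_nat ((hinj.hasProd_iff fun i hi => ?_).1 ?_)
  · rw [if_neg fun h => hi ?_]
    obtain ⟨m, hm⟩ := h
    exact ⟨m, by simp only; omega⟩
  · refine h.congr_fun fun n => ?_
    simp only [Function.comp]
    rw [if_pos ⟨n, rfl⟩]
    ring

/-- The factor 1 + wⁱ of a distinct part is written (1 - w²ⁱ)/(1 - wⁱ), so it differs from the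
factor of an unrestricted part only by its numerator. The numerators for even i multiply to `euler
(w ^ 4)`. -/
theorem hasSum_ped : HasSum (fun n => (ped n : ℂ) * w ^ n) (euler (w ^ 4) / euler w) := by
  have := hasSum_genFun (f := fun i c : ℕ => if Even i → c ≤ 1 then (1 : ℝ) else 0)
    (φ := fun i w => (if Even (i + 1) then 1 - (w ^ 2) ^ (i + 1) else 1) / (1 - w ^ (i + 1)))
    (L := fun w => euler (w ^ 4) / euler w) (fun i j => by positivity) hw ?_ ?_
  · simp_rw [ped_eq_coeff] at this
    exact_mod_cast this
  · intro i w hw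
    have h1 := one_sub_pow_ne_zero hw i
    by_cases h : Even (i + 1)
    · convert hasSum_distinct_parts (w := w) i using 2 with j
      · simp [h]; split_ifs <;> simp
      · simp only [h, if_true]; field_simp; ring
    · convert hasSum_geometric_parts hw i 1 using 2 with j
      · simp [h]
      · simp only [h, if_false]; field_simp; ring
  · intro w hw
    simp_rw [Finset.prod_div_distrib]
    exact (tendsto_prod_even hw two_ne_zero).div (tendsto_euler hw) (euler_ne_zero hw)

theorem hasSum_pod :
    HasSum (fun n => (pod n : ℂ) * w ^ n) (euler (w ^ 2) / (euler w * euler (w ^ 4))) := by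
  have := hasSum_genFun (f := fun i c : ℕ => if Odd i → c ≤ 1 then (1 : ℝ) else 0)
    (φ := fun i w => (if Odd (i + 1) then 1 - (w ^ 2) ^ (i + 1) else 1) / (1 - w ^ (i + 1)))
    (L := fun w => euler (w ^ 2) / euler (w ^ 4) / euler w) (fun i j => by positivity) hw ?_ ?_
  · simp_rw [pod_eq_coeff] at this
    rw [div_div, mul_comm] at this
    exact_mod_cast this
  · intro i w hw
    have h1 := one_sub_pow_ne_zero hw i
    by_cases h : Odd (i + 1)
    · convert hasSum_distinct_parts (w := w) i using 2 with j
      · simp [h]; split_ifs <;> simp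
      · simp only [h, if_true]; field_simp; ring
    · convert hasSum_geometric_parts hw i 1 using 2 with j
      · simp [h]
      · simp only [h, if_false]; field_simp; ring
  · intro w hw
    simp_rw [Finset.prod_div_distrib]
    exact (tendsto_prod_odd hw two_ne_zero).div (tendsto_euler hw) (euler_ne_zero hw)

theorem hasSum_pbar : HasSum (fun n => (pbar n : ℂ) * w ^ n) (euler (w ^ 2) / euler w ^ 2) := by
  have := hasSum_genFun (f := fun _ _ : ℕ => (2 : ℝ))
    (φ := fun i w => (1 - (w ^ 2) ^ (i + 1)) / (1 - w ^ (i + 1)) ^ 2)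
    (L := fun w => euler (w ^ 2) / euler w ^ 2) (fun i j => by positivity) hw ?_ ?_
  · simp_rw [pbar_eq_coeff] at this
    exact_mod_cast this
  · intro i w hw
    have h1 := one_sub_pow_ne_zero hw i
    convert hasSum_geometric_parts hw i 2 using 2 with j
    · simp
    · field_simp; ring
  · intro w hw
    simp_rw [Finset.prod_div_distrib, Finset.prod_pow]
    exact (tendsto_euler (norm_pow_lt hw two_ne_zero)).div ((tendsto_euler hw).pow 2)
      (pow_ne_zero 2 (euler_ne_zero hw))

theorem hasSum_pobar :
    HasSum (fun n => (pobar n : ℂ) * w ^ n) (euler (w ^ 2) ^ 3 / (euler w ^ 2 * euler (w ^ 4))) := by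
  have := hasSum_genFun (f := fun i _ : ℕ => if Odd i then (2 : ℝ) else 0)
    (φ := fun i w => (if Odd (i + 1) then 1 - (w ^ 2) ^ (i + 1) else 1) /
      (if Odd (i + 1) then 1 - (w ^ 1) ^ (i + 1) else 1) ^ 2)
    (L := fun w => euler (w ^ 2) / euler (w ^ (2 * 2)) / (euler (w ^ 1) / euler (w ^ (2 * 1))) ^ 2)
    (fun i j => by positivity) hw ?_ ?_
  · simp_rw [pobar_eq_coeff] at this
    have h1 := euler_ne_zero hw
    have h2 := euler_pow_ne_zero hw two_ne_zero
    have h4 := euler_pow_ne_zero hw four_ne_zero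
    rw [pow_one, mul_one, show 2 * 2 = 4 from rfl, show euler (w ^ 2) / euler (w ^ 4) /
      (euler w / euler (w ^ 2)) ^ 2 = euler (w ^ 2) ^ 3 / (euler w ^ 2 * euler (w ^ 4)) by
        field_simp] at this
    exact_mod_cast this
  · intro i w hw
    have h1 := one_sub_pow_ne_zero hw i
    by_cases h : Odd (i + 1)
    · convert hasSum_geometric_parts hw i 2 using 2 with j
      · simp [h]
      · simp only [h, if_true, pow_one]; field_simp; ring
    · simp [h, hasSum_zero]
  · intro w hw
    simp_rw [Finset.prod_div_distrib, Finset.prod_pow]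
    refine (tendsto_prod_odd hw two_ne_zero).div ((tendsto_prod_odd hw one_ne_zero).pow 2) ?_
    exact pow_ne_zero 2 (div_ne_zero (euler_pow_ne_zero hw (by norm_num))
      (euler_pow_ne_zero hw (by norm_num)))

end


/-! ### Dissections of negative powers of theta functions -/

/-- The components of `(1 + y + y²)ᵏ` with respect to `1, y, y²`, as polynomials in `s = y³`. -/
def triComp : ℕ → ℂ → ℂ × ℂ × ℂ
  | 0, _ => (1, 0, 0)
  | k + 1, s => ((triComp k s).1 + s * ((triComp k s).2.1 + (triComp k s).2.2),
      (triComp k s).1 + (triComp k s).2.1 + s * (triComp k s).2.2,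
      (triComp k s).1 + (triComp k s).2.1 + (triComp k s).2.2)

theorem triComp_spec (k : ℕ) {y s : ℂ} (hy : y ^ 3 = s) :
    (1 + y + y ^ 2) ^ k
      = (triComp k s).1 + y * (triComp k s).2.1 + y ^ 2 * (triComp k s).2.2 := by
  induction k with
  | zero => simp [triComp]
  | succ k ih =>
    rw [pow_succ, ih, triComp]
    linear_combination ((triComp k s).2.1 + (triComp k s).2.2 + y * (triComp k s).2.2) * hy

/-- From (1 - y)(1 + y + y²) = 1 - y³. Applied with y equal to r times a function of r³, it is the
3-dissection of a negative power. -/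
theorem inv_one_sub_pow (k : ℕ) {y s : ℂ} (hy : y ^ 3 = s) (hs : 1 - s ≠ 0) :
    ((1 - y) ^ k)⁻¹
      = ((triComp k s).1 + y * (triComp k s).2.1 + y ^ 2 * (triComp k s).2.2) / (1 - s) ^ k := by
  have h : (1 - y) * (1 + y + y ^ 2) = 1 - s := by rw [← hy]; ring
  have h1 : 1 - y ≠ 0 := left_ne_zero_of_mul (h ▸ hs)
  rw [← triComp_spec k hy, ← h, mul_pow]
  have : 1 + y + y ^ 2 ≠ 0 := right_ne_zero_of_mul (h ▸ hs)
  field_simp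

theorem thetaPhi_ne_zero {z : ℂ} (hz : ‖z‖ < 1) : thetaPhi z ≠ 0 :=
  div_ne_zero (pow_ne_zero 2 (euler_ne_zero hz)) (euler_pow_ne_zero hz two_ne_zero)

theorem thetaPsi_ne_zero {z : ℂ} (hz : ‖z‖ < 1) : thetaPsi z ≠ 0 :=
  div_ne_zero (pow_ne_zero 2 (euler_pow_ne_zero hz two_ne_zero)) (euler_ne_zero hz)

theorem thetaA_ne_zero {z : ℂ} (hz : ‖z‖ < 1) : thetaA z ≠ 0 :=
  div_ne_zero (mul_ne_zero (euler_pow_ne_zero hz two_ne_zero)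
    (pow_ne_zero 2 (euler_pow_ne_zero hz three_ne_zero)))
    (mul_ne_zero (euler_ne_zero hz) (euler_pow_ne_zero hz (by norm_num)))

/-- The level 12 modular ratio `Ω(z) / φ(-z³)`; its cube times `z` has level 6. -/
def ratioY (z : ℂ) : ℂ := thetaOmega z / thetaPhi (z ^ 3)

/-- The ratio `ψ(-z³) / ∑ (-z)^{n(3n-1)/2}`. -/
def ratioB (z : ℂ) : ℂ := thetaPsi (-(z ^ 3)) / thetaA (-z)

section
variable {z : ℂ} (hz : ‖z‖ < 1)
include hz

theorem unitA_ne_zero : unitA z ≠ 0 := by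
  have h1 := euler_ne_zero hz
  have h2 := euler_pow_ne_zero hz (n := 2) (by norm_num)
  have h3 := euler_pow_ne_zero hz (n := 3) (by norm_num)
  have h4 := euler_pow_ne_zero hz (n := 4) (by norm_num)
  have h6 := euler_pow_ne_zero hz (n := 6) (by norm_num)
  have h12 := euler_pow_ne_zero hz (n := 12) (by norm_num)
  simp only [unitA, ne_eq, div_eq_zero_iff, mul_eq_zero, pow_eq_zero_iff, OfNat.ofNat_ne_zero,
    not_false_eq_true, h1, h2, h3, h4, h6, h12, or_self]

theorem unitC_ne_zero : unitC z ≠ 0 := by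
  have h1 := euler_ne_zero hz
  have h3 := euler_pow_ne_zero hz (n := 3) (by norm_num)
  have h4 := euler_pow_ne_zero hz (n := 4) (by norm_num)
  have h12 := euler_pow_ne_zero hz (n := 12) (by norm_num)
  simp only [unitC, ne_eq, div_eq_zero_iff, mul_eq_zero, pow_eq_zero_iff, OfNat.ofNat_ne_zero,
    not_false_eq_true, h1, h3, h4, h12, or_self]

theorem unitB_ne_zero : unitB z ≠ 0 := by
  rw [← unitA_neg hz]; exact unitA_ne_zero (by simpa using hz)

theorem unitD_ne_zero : unitD z ≠ 0 := by
  rw [← unitC_neg hz]; exact unitC_ne_zero (by simpa using hz)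

theorem thetaPsi_neg : thetaPsi (-z) = euler z * euler (z ^ 4) / euler (z ^ 2) := by
  have h1 := euler_ne_zero hz
  have h2 := euler_pow_ne_zero hz (n := 2) (by norm_num)
  have h4 := euler_pow_ne_zero hz (n := 4) (by norm_num)
  simp only [thetaPsi, euler_neg hz, Even.neg_pow (show Even 2 by decide)]
  field_simp

theorem thetaPsi_neg_cube :
    thetaPsi (-(z ^ 3)) = euler (z ^ 3) * euler (z ^ 12) / euler (z ^ 6) := by
  rw [thetaPsi_neg (norm_pow_lt hz three_ne_zero)]
  simp only [← pow_mul, Nat.reduceMul]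

theorem thetaA_neg : thetaA (-z) = euler z * euler (z ^ 4) * euler (z ^ 6) ^ 5 /
    (euler (z ^ 2) ^ 2 * euler (z ^ 3) ^ 2 * euler (z ^ 12) ^ 2) := by
  have h1 := euler_ne_zero hz
  have h2 := euler_pow_ne_zero hz (n := 2) (by norm_num)
  have h3 := euler_pow_ne_zero hz (n := 3) (by norm_num)
  have h4 := euler_pow_ne_zero hz (n := 4) (by norm_num)
  have h6 := euler_pow_ne_zero hz (n := 6) (by norm_num)
  have h12 := euler_pow_ne_zero hz (n := 12) (by norm_num)
  simp only [thetaA, euler_neg hz, euler_neg_pow_three hz, Even.neg_pow (show Even 2 by decide),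
    Even.neg_pow (show Even 6 by decide)]
  field_simp

/-- With this relation ψ(-r), and with `ratioY_sq` also φ(-r²), is dissected in the same variable
r·`ratioY (r ^ 3)` as φ(-r). Quotients of two thetas can then be dissected together. -/
theorem ratioB_eq : ratioB z = unitA z / unitB z * ratioY z := by
  have h1 := euler_ne_zero hz
  have h2 := euler_pow_ne_zero hz (n := 2) (by norm_num)
  have h3 := euler_pow_ne_zero hz (n := 3) (by norm_num)
  have h4 := euler_pow_ne_zero hz (n := 4) (by norm_num)
  have h6 := euler_pow_ne_zero hz (n := 6) (by norm_num)
  have h12 := euler_pow_ne_zero hz (n := 12) (by norm_num)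
  simp only [ratioB, ratioY, thetaPsi_neg_cube hz, thetaA_neg hz, thetaOmega, thetaPhi, unitA, unitB,
    ← pow_mul, Nat.reduceMul]
  field_simp

theorem ratioY_sq : ratioY (z ^ 2) = unitA z / unitB z * ratioY z ^ 2 := by
  have h1 := euler_ne_zero hz
  have h2 := euler_pow_ne_zero hz (n := 2) (by norm_num)
  have h3 := euler_pow_ne_zero hz (n := 3) (by norm_num)
  have h4 := euler_pow_ne_zero hz (n := 4) (by norm_num)
  have h6 := euler_pow_ne_zero hz (n := 6) (by norm_num)
  have h12 := euler_pow_ne_zero hz (n := 12) (by norm_num)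
  simp only [ratioY, thetaOmega, thetaPhi, unitA, unitB, ← pow_mul, Nat.reduceMul]
  field_simp

/-- The dissections depend on `ratioY` mainly through this cube, which is rational in x; this is
what makes the final sections rational in x. -/
theorem ratioY_cube : z * ratioY z ^ 3 = haupt z * unitB z / unitA z ^ 2 := by
  have h1 := euler_ne_zero hz
  have h2 := euler_pow_ne_zero hz (n := 2) (by norm_num)
  have h3 := euler_pow_ne_zero hz (n := 3) (by norm_num)
  have h4 := euler_pow_ne_zero hz (n := 4) (by norm_num)
  have h6 := euler_pow_ne_zero hz (n := 6) (by norm_num)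
  have h12 := euler_pow_ne_zero hz (n := 12) (by norm_num)
  simp only [ratioY, thetaOmega, thetaPhi, unitA, unitB, haupt, ← pow_mul, Nat.reduceMul]
  field_simp

theorem thetaPhi_ratio : thetaPhi z ^ 2 = unitC z / unitA z * thetaPhi (z ^ 3) ^ 2 := by
  have h1 := euler_ne_zero hz
  have h2 := euler_pow_ne_zero hz (n := 2) (by norm_num)
  have h3 := euler_pow_ne_zero hz (n := 3) (by norm_num)
  have h4 := euler_pow_ne_zero hz (n := 4) (by norm_num)
  have h6 := euler_pow_ne_zero hz (n := 6) (by norm_num)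
  have h12 := euler_pow_ne_zero hz (n := 12) (by norm_num)
  simp only [thetaPhi, unitA, unitC, ← pow_mul, Nat.reduceMul]
  field_simp

variable (hz0 : z ≠ 0)
include hz0

theorem one_sub_ratioY_cube : 1 - 8 * (z * ratioY z ^ 3) = (unitC z / unitA z) ^ 2 := by
  have := unitA_ne_zero hz
  rw [ratioY_cube hz, div_pow, ← unitA_sq_sub hz hz0]
  field_simp

theorem one_sub_ratioY_cube_ne_zero : 1 - 8 * (z * ratioY z ^ 3) ≠ 0 := by
  rw [one_sub_ratioY_cube hz hz0]
  exact pow_ne_zero 2 (div_ne_zero (unitC_ne_zero hz) (unitA_ne_zero hz))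

theorem thetaPhi_pow_four :
    thetaPhi z ^ 4 = (1 - 8 * (z * ratioY z ^ 3)) * thetaPhi (z ^ 3) ^ 4 := by
  rw [one_sub_ratioY_cube hz hz0]
  linear_combination (thetaPhi z ^ 2 + unitC z / unitA z * thetaPhi (z ^ 3) ^ 2) * thetaPhi_ratio hz

omit hz0 in
theorem ratioB_cube : z * ratioB z ^ 3 = haupt z * unitA z / unitB z ^ 2 := by
  have := unitA_ne_zero hz
  have := unitB_ne_zero hz
  rw [ratioB_eq hz, mul_pow, mul_left_comm, ratioY_cube hz]
  field_simp

theorem one_sub_ratioB_cube : 1 - z * ratioB z ^ 3 = unitC z / unitB z ^ 2 := by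
  have := unitB_ne_zero hz
  rw [ratioB_cube hz, ← unitB_sq_sub hz hz0]
  field_simp

theorem one_sub_ratioB_cube_ne_zero : 1 - z * ratioB z ^ 3 ≠ 0 := by
  rw [one_sub_ratioB_cube hz hz0]
  exact div_ne_zero (unitC_ne_zero hz) (pow_ne_zero 2 (unitB_ne_zero hz))

end

section
variable {r : ℂ} (hr : ‖r‖ < 1) (hr0 : r ≠ 0)
include hr hr0

theorem thetaPhi_eq_ratio :
    thetaPhi r = thetaPhi (r ^ 9) * (1 - 2 * (r * ratioY (r ^ 3))) := by
  have := thetaPhi_ne_zero (norm_pow_lt hr (n := 9) (by norm_num))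
  rw [thetaPhi_dissection hr hr0, ratioY, ← pow_mul]
  field_simp

theorem thetaPsi_neg_eq_ratio :
    thetaPsi (-r) = thetaA (-(r ^ 3)) * (1 - r * ratioB (r ^ 3)) := by
  have := thetaA_ne_zero (z := -(r ^ 3)) (by rw [norm_neg]; exact norm_pow_lt hr three_ne_zero)
  rw [thetaPsi_dissection (by simpa using hr) (neg_ne_zero.2 hr0), ratioB, ← pow_mul,
    Odd.neg_pow (by decide), Odd.neg_pow (by decide)]
  field_simp
  ring

theorem thetaPsi_neg_eq_ratioY : thetaPsi (-r) = thetaA (-(r ^ 3)) *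
    (1 - unitA (r ^ 3) / unitB (r ^ 3) * (r * ratioY (r ^ 3))) := by
  rw [thetaPsi_neg_eq_ratio hr hr0, ratioB_eq (norm_pow_lt hr three_ne_zero)]
  ring

theorem thetaPhi_sq_eq_ratioY : thetaPhi (r ^ 2) = thetaPhi (r ^ 18) *
    (1 - 2 * (unitA (r ^ 3) / unitB (r ^ 3)) * (r * ratioY (r ^ 3)) ^ 2) := by
  have h3 := norm_pow_lt hr three_ne_zero
  rw [thetaPhi_eq_ratio (norm_pow_lt hr two_ne_zero) (pow_ne_zero 2 hr0), ← pow_mul, ← pow_mul,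
    show 2 * 3 = 3 * 2 from rfl, pow_mul r 3 2, ratioY_sq h3]
  ring

end

/-- The coefficient of `v` in the dissection of `(1 - κ v) / (1 - 2 v)ᵏ`, where `v³ = t`. -/
def pedComp (k : ℕ) (κ t : ℂ) : ℂ :=
  (2 * (triComp k (8 * t)).2.1 - κ * (triComp k (8 * t)).1) / (1 - 8 * t) ^ k

/-- The constant coefficient in the dissection of `(1 - 2 κ v²) / (1 - 2 v)ᵏ`, where `v³ = t`. -/
def pobarComp (k : ℕ) (κ t : ℂ) : ℂ :=
  ((triComp k (8 * t)).1 - 4 * κ * t * (triComp k (8 * t)).2.1) / (1 - 8 * t) ^ k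

theorem pedComp_spec (k : ℕ) (κ : ℂ) {r y z : ℂ} (hr : r ^ 3 = z) (ht : 1 - 8 * (z * y ^ 3) ≠ 0) :
    (1 - κ * (r * y)) * ((1 - 2 * (r * y)) ^ k)⁻¹
      = ((triComp k (8 * (z * y ^ 3))).1 - 4 * κ * (z * y ^ 3) * (triComp k (8 * (z * y ^ 3))).2.2) /
          (1 - 8 * (z * y ^ 3)) ^ k
        + r * (y * pedComp k κ (z * y ^ 3))
        + r ^ 2 * (y ^ 2 * ((4 * (triComp k (8 * (z * y ^ 3))).2.2
            - 2 * κ * (triComp k (8 * (z * y ^ 3))).2.1) / (1 - 8 * (z * y ^ 3)) ^ k)) := by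
  rw [inv_one_sub_pow k (y := 2 * (r * y)) (s := 8 * (z * y ^ 3)) (by rw [← hr]; ring) ht, pedComp, ← hr]
  ring

theorem pobarComp_spec (k : ℕ) (κ : ℂ) {r y z : ℂ} (hr : r ^ 3 = z) (ht : 1 - 8 * (z * y ^ 3) ≠ 0) :
    (1 - 2 * κ * (r * y) ^ 2) * ((1 - 2 * (r * y)) ^ k)⁻¹
      = pobarComp k κ (z * y ^ 3)
        + r * (y * ((2 * (triComp k (8 * (z * y ^ 3))).2.1
            - 8 * κ * (z * y ^ 3) * (triComp k (8 * (z * y ^ 3))).2.2) / (1 - 8 * (z * y ^ 3)) ^ k))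
        + r ^ 2 * (y ^ 2 * ((4 * (triComp k (8 * (z * y ^ 3))).2.2
            - 2 * κ * (triComp k (8 * (z * y ^ 3))).1) / (1 - 8 * (z * y ^ 3)) ^ k)) := by
  rw [inv_one_sub_pow k (y := 2 * (r * y)) (s := 8 * (z * y ^ 3)) (by rw [← hr]; ring) ht, pobarComp, ← hr]
  ring


/-! ### Sections of the generating functions modulo 3 and 9 -/

section
variable {z : ℂ} (hz : ‖z‖ < 1) (hz0 : z ≠ 0)
include hz hz0

/-- With t = z·`ratioY z ^ 3` the component on the left is 1 + 16t = 3 - 2(1 - 8t), and 1 - 8t is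
the fourth power of φ(-z)/φ(-z³). This is the source of the coefficients 3 and -2. -/
theorem thetaPhi_nine : thetaPhi z / thetaPhi (z ^ 3) ^ 2 *
      ((triComp 2 (8 * (z * ratioY z ^ 3))).1 / (1 - 8 * (z * ratioY z ^ 3)) ^ 2)
    = 3 * thetaPhi (z ^ 3) ^ 6 / thetaPhi z ^ 7 - 2 * thetaPhi (z ^ 3) ^ 2 / thetaPhi z ^ 3 := by
  have h4 := thetaPhi_pow_four hz hz0
  have ht := one_sub_ratioY_cube_ne_zero hz hz0
  have hX := thetaPhi_ne_zero (norm_pow_lt hz three_ne_zero)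
  have hP := thetaPhi_ne_zero hz
  generalize z * ratioY z ^ 3 = t at *
  generalize thetaPhi (z ^ 3) = X at *
  generalize thetaPhi z = P at *
  rw [show 3 * X ^ 6 / P ^ 7 = 3 * X ^ 6 * P / (P ^ 4) ^ 2 by field_simp,
    show 2 * X ^ 2 / P ^ 3 = 2 * X ^ 2 * P / P ^ 4 by field_simp, h4]
  simp only [triComp]
  field_simp
  ring

theorem hasSum_ped_three : HasSum (fun n => (ped (3 * n + 1) : ℂ) * z ^ n)
    (thetaPsi (-(z ^ 3)) * thetaPhi (z ^ 3) / thetaPhi z ^ 2) := by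
  have h := (hasSum_of_dissection (a := fun n => (ped n : ℂ))
    (G₀ := fun z => thetaA (-z) / thetaPhi (z ^ 3) * (((triComp 1 (8 * (z * ratioY z ^ 3))).1
      - 4 * (unitA z / unitB z) * (z * ratioY z ^ 3) * (triComp 1 (8 * (z * ratioY z ^ 3))).2.2) /
          (1 - 8 * (z * ratioY z ^ 3)) ^ 1))
    (G₁ := fun z => thetaA (-z) / thetaPhi (z ^ 3) *
      (ratioY z * pedComp 1 (unitA z / unitB z) (z * ratioY z ^ 3)))
    (G₂ := fun z => thetaA (-z) / thetaPhi (z ^ 3) * (ratioY z ^ 2 *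
      ((4 * (triComp 1 (8 * (z * ratioY z ^ 3))).2.2
            - 2 * (unitA z / unitB z) * (triComp 1 (8 * (z * ratioY z ^ 3))).2.1) /
              (1 - 8 * (z * ratioY z ^ 3)) ^ 1)))
    (fun r hr hr0 => ?_) hz hz0).2.1
  · convert h using 1
    have hA := unitA_ne_zero hz
    have hB := unitB_ne_zero hz
    have hC := unitC_ne_zero hz
    have hX := thetaPhi_ne_zero (norm_pow_lt hz three_ne_zero)
    have ha : thetaA (-z) ≠ 0 := thetaA_ne_zero (by simpa using hz)
    have hb : thetaPsi (-(z ^ 3)) = ratioB z * thetaA (-z) := by rw [ratioB]; field_simp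
    -- The component of the dissection has numerator 2 - A/B; the linear relation 2(1 - x) - (1 + x)
    -- = 1 - 3x collapses it to a single unit.
    have e : 2 * unitB z - unitA z = unitC z := by
      rw [unitA_eq hz, unitB_eq hz, unitC_eq hz hz0]; ring
    rw [hb, thetaPhi_ratio hz, pedComp, one_sub_ratioY_cube hz hz0, ratioB_eq hz]
    simp only [triComp]
    field_simp
    linear_combination -ratioY z * e
  · have h3 := norm_pow_lt hr three_ne_zero
    have hX := thetaPhi_ne_zero (norm_pow_lt hr (n := 9) (by norm_num))
    have hs := pedComp_spec 1 (unitA (r ^ 3) / unitB (r ^ 3)) rfl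
      (one_sub_ratioY_cube_ne_zero h3 (pow_ne_zero 3 hr0))
    convert hasSum_ped hr using 1
    have e : euler (r ^ 4) / euler r = thetaPsi (-r) / thetaPhi r := by
      have h1 := euler_ne_zero hr
      have h2 := euler_pow_ne_zero hr (n := 2) (by norm_num)
      rw [thetaPsi_neg hr, thetaPhi]; field_simp
    rw [e, thetaPsi_neg_eq_ratioY hr hr0, thetaPhi_eq_ratio hr hr0, ← pow_mul]
    rw [pow_one, ← div_eq_mul_inv] at hs
    rw [mul_div_mul_comm, hs]
    ring

/-- Dissection of `c(r³) / φ(-r)²`. -/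
theorem hasSum_nine_of_three {a : ℕ → ℂ} {c : ℂ → ℂ}
    (ha : ∀ r : ℂ, ‖r‖ < 1 → r ≠ 0 → HasSum (fun n => a n * r ^ n) (c (r ^ 3) * thetaPhi (r ^ 3) / thetaPhi r ^ 2)) :
    HasSum (fun n => a (3 * n) * z ^ n) (c z * (3 * thetaPhi (z ^ 3) ^ 6 / thetaPhi z ^ 7
      - 2 * thetaPhi (z ^ 3) ^ 2 / thetaPhi z ^ 3)) := by
  rw [← thetaPhi_nine hz hz0]
  refine (hasSum_of_dissection (a := a)
    (G₀ := fun z => c z * (thetaPhi z / thetaPhi (z ^ 3) ^ 2 *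
      ((triComp 2 (8 * (z * ratioY z ^ 3))).1 / (1 - 8 * (z * ratioY z ^ 3)) ^ 2)))
    (G₁ := fun z => c z * (thetaPhi z / thetaPhi (z ^ 3) ^ 2 *
      (2 * ratioY z * (triComp 2 (8 * (z * ratioY z ^ 3))).2.1 / (1 - 8 * (z * ratioY z ^ 3)) ^ 2)))
    (G₂ := fun z => c z * (thetaPhi z / thetaPhi (z ^ 3) ^ 2 *
      (4 * ratioY z ^ 2 * (triComp 2 (8 * (z * ratioY z ^ 3))).2.2 / (1 - 8 * (z * ratioY z ^ 3)) ^ 2)))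
    (fun r hr hr0 => ?_) hz hz0).1
  have h3 := norm_pow_lt hr three_ne_zero
  convert ha r hr hr0 using 1
  rw [thetaPhi_eq_ratio hr hr0, mul_pow _ _ 2, div_eq_mul_inv _ (_ * _), mul_inv,
    inv_one_sub_pow 2 (y := 2 * (r * ratioY (r ^ 3))) (s := 8 * (r ^ 3 * ratioY (r ^ 3) ^ 3)) (by ring)
    (one_sub_ratioY_cube_ne_zero h3 (pow_ne_zero 3 hr0)), ← pow_mul r 3 3]
  ring

theorem hasSum_ped_nine : HasSum (fun n => (ped (9 * n + 1) : ℂ) * z ^ n)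
    (thetaPsi (-z) * (3 * thetaPhi (z ^ 3) ^ 6 / thetaPhi z ^ 7
      - 2 * thetaPhi (z ^ 3) ^ 2 / thetaPhi z ^ 3)) := by
  have := hasSum_nine_of_three hz hz0 (a := fun n => (ped (3 * n + 1) : ℂ))
    (c := fun z => thetaPsi (-z)) (fun r hr hr0 => hasSum_ped_three hr hr0)
  simpa only [← mul_assoc, Nat.reduceMul] using this

theorem hasSum_pobar_three : HasSum (fun n => (pobar (3 * n) : ℂ) * z ^ n)
    (thetaPhi (z ^ 6) * thetaPhi (z ^ 3) / thetaPhi z ^ 2) := by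
  have h := (hasSum_of_dissection (a := fun n => (pobar n : ℂ))
    (G₀ := fun z => thetaPhi (z ^ 6) / thetaPhi (z ^ 3) *
      pobarComp 1 (unitA z / unitB z) (z * ratioY z ^ 3))
    (G₁ := fun z => thetaPhi (z ^ 6) / thetaPhi (z ^ 3) *
      (ratioY z * ((2 * (triComp 1 (8 * (z * ratioY z ^ 3))).2.1
            - 8 * (unitA z / unitB z) * (z * ratioY z ^ 3) * (triComp 1 (8 * (z * ratioY z ^ 3))).2.2) /
              (1 - 8 * (z * ratioY z ^ 3)) ^ 1)))
    (G₂ := fun z => thetaPhi (z ^ 6) / thetaPhi (z ^ 3) *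
      (ratioY z ^ 2 * ((4 * (triComp 1 (8 * (z * ratioY z ^ 3))).2.2
            - 2 * (unitA z / unitB z) * (triComp 1 (8 * (z * ratioY z ^ 3))).1) /
              (1 - 8 * (z * ratioY z ^ 3)) ^ 1)))
    (fun r hr hr0 => ?_) hz hz0).1
  · convert h using 1
    have hA := unitA_ne_zero hz
    have hB := unitB_ne_zero hz
    have hC := unitC_ne_zero hz
    have hX := thetaPhi_ne_zero (norm_pow_lt hz three_ne_zero)
    -- Again the component collapses to one unit, now by (1 + x) - 4x = 1 - 3x.
    have e : unitA z - 4 * haupt z = unitC z := by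
      rw [unitA_eq hz, unitC_eq hz hz0]; ring
    rw [thetaPhi_ratio hz, pobarComp, one_sub_ratioY_cube hz hz0, ratioY_cube hz]
    simp only [triComp]
    field_simp
    linear_combination -(thetaPhi (z ^ 6) * unitA z ^ 2) * e
  · have h3 := norm_pow_lt hr three_ne_zero
    have hX := thetaPhi_ne_zero (norm_pow_lt hr (n := 9) (by norm_num))
    have hs := pobarComp_spec 1 (unitA (r ^ 3) / unitB (r ^ 3)) rfl
      (one_sub_ratioY_cube_ne_zero h3 (pow_ne_zero 3 hr0))
    convert hasSum_pobar hr using 1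
    have e : euler (r ^ 2) ^ 3 / (euler r ^ 2 * euler (r ^ 4)) = thetaPhi (r ^ 2) / thetaPhi r := by
      have h1 := euler_ne_zero hr
      have h2 := euler_pow_ne_zero hr (n := 2) (by norm_num)
      rw [thetaPhi, thetaPhi, ← pow_mul]; field_simp
    rw [e, thetaPhi_sq_eq_ratioY hr hr0, thetaPhi_eq_ratio hr hr0, ← pow_mul, ← pow_mul]
    rw [pow_one, ← div_eq_mul_inv] at hs
    rw [mul_div_mul_comm, hs]
    ring

theorem hasSum_pobar_nine : HasSum (fun n => (pobar (9 * n) : ℂ) * z ^ n)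
    (thetaPhi (z ^ 2) * (3 * thetaPhi (z ^ 3) ^ 6 / thetaPhi z ^ 7
      - 2 * thetaPhi (z ^ 3) ^ 2 / thetaPhi z ^ 3)) := by
  have := hasSum_nine_of_three hz hz0 (a := fun n => (pobar (3 * n) : ℂ))
    (c := fun z => thetaPhi (z ^ 2)) (fun r hr hr0 => by
      simpa only [← pow_mul, Nat.reduceMul] using hasSum_pobar_three hr hr0)
  simpa only [← mul_assoc, Nat.reduceMul] using this

theorem hasSum_pbar_three : HasSum (fun n => (pbar (3 * n) : ℂ) * z ^ n)
    (thetaPhi (z ^ 3) ^ 3 / thetaPhi z ^ 4) := by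
  have h := (hasSum_of_dissection (a := fun n => (pbar n : ℂ))
    (G₀ := fun z => (thetaPhi (z ^ 3))⁻¹ / (1 - 8 * (z * ratioY z ^ 3)))
    (G₁ := fun z => (thetaPhi (z ^ 3))⁻¹ * (2 * ratioY z) / (1 - 8 * (z * ratioY z ^ 3)))
    (G₂ := fun z => (thetaPhi (z ^ 3))⁻¹ * (4 * ratioY z ^ 2) / (1 - 8 * (z * ratioY z ^ 3)))
    (fun r hr hr0 => ?_) hz hz0).1
  · convert h using 1
    have hX := thetaPhi_ne_zero (norm_pow_lt hz three_ne_zero)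
    have ht := one_sub_ratioY_cube_ne_zero hz hz0
    rw [thetaPhi_pow_four hz hz0]
    field_simp
  · have h3 := norm_pow_lt hr three_ne_zero
    convert hasSum_pbar hr using 1
    have e : euler (r ^ 2) / euler r ^ 2 = (thetaPhi r)⁻¹ := by rw [thetaPhi, inv_div]
    have hs := inv_one_sub_pow 1 (y := 2 * (r * ratioY (r ^ 3))) (s := 8 * (r ^ 3 * ratioY (r ^ 3) ^ 3))
      (by ring) (one_sub_ratioY_cube_ne_zero h3 (pow_ne_zero 3 hr0))
    rw [pow_one] at hs
    rw [e, thetaPhi_eq_ratio hr hr0, mul_inv, hs, ← pow_mul]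
    simp only [triComp]
    ring

theorem hasSum_pbar_nine : HasSum (fun n => (pbar (9 * n) : ℂ) * z ^ n)
    (27 * thetaPhi (z ^ 3) ^ 12 / thetaPhi z ^ 13 - 36 * thetaPhi (z ^ 3) ^ 8 / thetaPhi z ^ 9
      + 10 * thetaPhi (z ^ 3) ^ 4 / thetaPhi z ^ 5) := by
  have h := (hasSum_of_dissection (a := fun n => (pbar (3 * n) : ℂ))
    (G₀ := fun z => thetaPhi z ^ 3 / thetaPhi (z ^ 3) ^ 4 *
      ((triComp 4 (8 * (z * ratioY z ^ 3))).1 / (1 - 8 * (z * ratioY z ^ 3)) ^ 4))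
    (G₁ := fun z => thetaPhi z ^ 3 / thetaPhi (z ^ 3) ^ 4 *
      (2 * ratioY z * (triComp 4 (8 * (z * ratioY z ^ 3))).2.1 / (1 - 8 * (z * ratioY z ^ 3)) ^ 4))
    (G₂ := fun z => thetaPhi z ^ 3 / thetaPhi (z ^ 3) ^ 4 *
      (4 * ratioY z ^ 2 * (triComp 4 (8 * (z * ratioY z ^ 3))).2.2 / (1 - 8 * (z * ratioY z ^ 3)) ^ 4))
    (fun r hr hr0 => ?_) hz hz0).1
  · simp only [← mul_assoc, Nat.reduceMul] at h
    convert h using 1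
    have h4 := thetaPhi_pow_four hz hz0
    have ht := one_sub_ratioY_cube_ne_zero hz hz0
    have hX := thetaPhi_ne_zero (norm_pow_lt hz three_ne_zero)
    have hP := thetaPhi_ne_zero hz
    simp only [mul_assoc] at h4 ht ⊢
    generalize z * ratioY z ^ 3 = t at *
    generalize thetaPhi (z ^ 3) = X at *
    generalize thetaPhi z = P at *
    have e1 : P ^ 13 = (P ^ 4) ^ 4 / P ^ 3 := by field_simp
    have e2 : P ^ 9 = (P ^ 4) ^ 3 / P ^ 3 := by field_simp
    have e3 : P ^ 5 = (P ^ 4) ^ 2 / P ^ 3 := by field_simp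
    rw [e1, e2, e3, h4]
    simp only [triComp]
    field_simp
    ring
  · have h3 := norm_pow_lt hr three_ne_zero
    convert hasSum_pbar_three hr hr0 using 1
    rw [thetaPhi_eq_ratio hr hr0, mul_pow _ _ 4, div_eq_mul_inv _ (_ * _), mul_inv,
      inv_one_sub_pow 4 (y := 2 * (r * ratioY (r ^ 3))) (s := 8 * (r ^ 3 * ratioY (r ^ 3) ^ 3)) (by ring)
      (one_sub_ratioY_cube_ne_zero h3 (pow_ne_zero 3 hr0)), ← pow_mul r 3 3]
    ring

/-- The cubic identity `thetaPsi_cube` at -z, solved for the fourth power; it lets all negative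
powers of ψ(-z) be compared over a common denominator. -/
theorem thetaPsi_neg_pow_four : thetaPsi (-z) ^ 4 =
    thetaPsi (-(z ^ 3)) * thetaA (-z) ^ 3 * (1 - z * ratioB z ^ 3) := by
  have hz3 : ‖-(z ^ 3)‖ < 1 := by rw [norm_neg]; exact norm_pow_lt hz three_ne_zero
  have hz1 : ‖-z‖ < 1 := by simpa using hz
  have h := thetaPsi_cube hz1 (neg_ne_zero.2 hz0)
  have ha : thetaA (-z) ≠ 0 := thetaA_ne_zero hz1
  rw [Odd.neg_pow (by decide), eq_div_iff (thetaPsi_ne_zero hz3)] at h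
  rw [ratioB, ← h]
  field_simp
  ring

theorem hasSum_pod_three : HasSum (fun n => (pod (3 * n + 2) : ℂ) * z ^ n)
    (thetaPsi (-(z ^ 3)) ^ 3 / thetaPsi (-z) ^ 4) := by
  have h := (hasSum_of_dissection (a := fun n => (pod n : ℂ))
    (G₀ := fun z => (thetaA (-z))⁻¹ / (1 - z * ratioB z ^ 3))
    (G₁ := fun z => (thetaA (-z))⁻¹ * ratioB z / (1 - z * ratioB z ^ 3))
    (G₂ := fun z => (thetaA (-z))⁻¹ * ratioB z ^ 2 / (1 - z * ratioB z ^ 3))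
    (fun r hr hr0 => ?_) hz hz0).2.2
  · convert h using 1
    have ha : thetaA (-z) ≠ 0 := thetaA_ne_zero (by simpa using hz)
    have hb : thetaPsi (-(z ^ 3)) ≠ 0 :=
      thetaPsi_ne_zero (by rw [norm_neg]; exact norm_pow_lt hz three_ne_zero)
    have ht := one_sub_ratioB_cube_ne_zero hz hz0
    rw [thetaPsi_neg_pow_four hz hz0]
    generalize 1 - z * ratioB z ^ 3 = m at *
    rw [ratioB]
    field_simp
  · have h3 := norm_pow_lt hr three_ne_zero
    convert hasSum_pod hr using 1
    have e : euler (r ^ 2) / (euler r * euler (r ^ 4)) = (thetaPsi (-r))⁻¹ := by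
      rw [thetaPsi_neg hr, inv_div]
    have hs := inv_one_sub_pow 1 (y := r * ratioB (r ^ 3)) (s := r ^ 3 * ratioB (r ^ 3) ^ 3)
      (by ring) (one_sub_ratioB_cube_ne_zero h3 (pow_ne_zero 3 hr0))
    rw [pow_one] at hs
    rw [e, thetaPsi_neg_eq_ratio hr hr0, mul_inv, hs]
    simp only [triComp]
    ring

theorem hasSum_pod_nine : HasSum (fun n => (pod (9 * n + 8) : ℂ) * z ^ n)
    (10 * thetaPsi (-(z ^ 3)) ^ 4 / thetaPsi (-z) ^ 5
      + 36 * z * thetaPsi (-(z ^ 3)) ^ 8 / thetaPsi (-z) ^ 9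
      + 27 * z ^ 2 * thetaPsi (-(z ^ 3)) ^ 12 / thetaPsi (-z) ^ 13) := by
  have h := (hasSum_of_dissection (a := fun n => (pod (3 * n + 2) : ℂ))
    (G₀ := fun z => thetaPsi (-z) ^ 3 / thetaA (-z) ^ 4 *
      ((triComp 4 (z * ratioB z ^ 3)).1 / (1 - z * ratioB z ^ 3) ^ 4))
    (G₁ := fun z => thetaPsi (-z) ^ 3 / thetaA (-z) ^ 4 *
      (ratioB z * (triComp 4 (z * ratioB z ^ 3)).2.1 / (1 - z * ratioB z ^ 3) ^ 4))
    (G₂ := fun z => thetaPsi (-z) ^ 3 / thetaA (-z) ^ 4 *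
      (ratioB z ^ 2 * (triComp 4 (z * ratioB z ^ 3)).2.2 / (1 - z * ratioB z ^ 3) ^ 4))
    (fun r hr hr0 => ?_) hz hz0).2.2
  · have h' := h.congr_fun (g := fun n => (pod (9 * n + 8) : ℂ) * z ^ n) fun n => by
      rw [show 3 * (3 * n + 2) + 2 = 9 * n + 8 by ring]
    convert h' using 1
    · have ha : thetaA (-z) ≠ 0 := thetaA_ne_zero (by simpa using hz)
      have hP : thetaPsi (-z) ≠ 0 := thetaPsi_ne_zero (by simpa using hz)
      have hb' : thetaPsi (-(z ^ 3)) ≠ 0 :=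
        thetaPsi_ne_zero (by rw [norm_neg]; exact norm_pow_lt hz three_ne_zero)
      have hb : thetaPsi (-(z ^ 3)) = ratioB z * thetaA (-z) := by rw [ratioB]; field_simp
      have hβ : ratioB z ≠ 0 := div_ne_zero hb' ha
      have ht := one_sub_ratioB_cube_ne_zero hz hz0
      have h4 := thetaPsi_neg_pow_four hz hz0
      rw [hb] at h4 ⊢
      generalize thetaPsi (-z) = P at *
      generalize thetaA (-z) = a at *
      generalize ratioB z = y at *
      have e1 : P ^ 13 = (P ^ 4) ^ 4 / P ^ 3 := by field_simp
      have e2 : P ^ 9 = (P ^ 4) ^ 3 / P ^ 3 := by field_simp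
      have e3 : P ^ 5 = (P ^ 4) ^ 2 / P ^ 3 := by field_simp
      rw [e1, e2, e3, h4]
      simp only [triComp]
      field_simp
      ring
  · have h3 := norm_pow_lt hr three_ne_zero
    convert hasSum_pod_three hr hr0 using 1
    rw [thetaPsi_neg_eq_ratio hr hr0, mul_pow _ _ 4, div_eq_mul_inv _ (_ * _), mul_inv,
      inv_one_sub_pow 4 (y := r * ratioB (r ^ 3)) (s := r ^ 3 * ratioB (r ^ 3) ^ 3) (by ring)
      (one_sub_ratioB_cube_ne_zero h3 (pow_ne_zero 3 hr0))]
    ring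

end


/-! ### The functions `L` in terms of sections -/

/-- The generating function of `ped(n) + ped(9n+1)`. -/
def pedSeries (r : ℂ) : ℂ := thetaPsi (-r) / thetaPhi r + thetaPsi (-r) *
  (3 * thetaPhi (r ^ 3) ^ 6 / thetaPhi r ^ 7 - 2 * thetaPhi (r ^ 3) ^ 2 / thetaPhi r ^ 3)

/-- The generating function of `pobar(n) - pobar(9n)`. -/
def pobarSeries (r : ℂ) : ℂ := thetaPhi (r ^ 2) / thetaPhi r - thetaPhi (r ^ 2) *
  (3 * thetaPhi (r ^ 3) ^ 6 / thetaPhi r ^ 7 - 2 * thetaPhi (r ^ 3) ^ 2 / thetaPhi r ^ 3)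

/-- The generating function of `pod(n) + pod(9n-1)`. -/
def podSeries (r : ℂ) : ℂ := (thetaPsi (-r))⁻¹ + r * (10 * thetaPsi (-(r ^ 3)) ^ 4 / thetaPsi (-r) ^ 5
  + 36 * r * thetaPsi (-(r ^ 3)) ^ 8 / thetaPsi (-r) ^ 9
  + 27 * r ^ 2 * thetaPsi (-(r ^ 3)) ^ 12 / thetaPsi (-r) ^ 13)

/-- The generating function of `pbar(n) - pbar(9n)`. -/
def pbarSeries (r : ℂ) : ℂ := (thetaPhi r)⁻¹ -
  (27 * thetaPhi (r ^ 3) ^ 12 / thetaPhi r ^ 13 - 36 * thetaPhi (r ^ 3) ^ 8 / thetaPhi r ^ 9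
      + 10 * thetaPhi (r ^ 3) ^ 4 / thetaPhi r ^ 5)

/-- The generating function of `ped(3n+1) + ped(27n+10)`. -/
def pedSection (z : ℂ) : ℂ := thetaA (-z) / thetaPhi (z ^ 3) * ratioY z *
  (pedComp 1 (unitA z / unitB z) (z * ratioY z ^ 3)
    + 3 * (thetaPhi z / thetaPhi (z ^ 3)) ^ 6 * pedComp 7 (unitA z / unitB z) (z * ratioY z ^ 3)
    - 2 * (thetaPhi z / thetaPhi (z ^ 3)) ^ 2 * pedComp 3 (unitA z / unitB z) (z * ratioY z ^ 3))

/-- The generating function of `pobar(3n) - pobar(27n)`. -/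
def pobarSection (z : ℂ) : ℂ := thetaPhi (z ^ 6) / thetaPhi (z ^ 3) *
  (pobarComp 1 (unitA z / unitB z) (z * ratioY z ^ 3)
    - 3 * (thetaPhi z / thetaPhi (z ^ 3)) ^ 6 * pobarComp 7 (unitA z / unitB z) (z * ratioY z ^ 3)
    + 2 * (thetaPhi z / thetaPhi (z ^ 3)) ^ 2 * pobarComp 3 (unitA z / unitB z) (z * ratioY z ^ 3))

/-- The generating function of `pod(3n+2) + pod(27n+17)`. -/
def podSection (z : ℂ) : ℂ := (thetaA (-z))⁻¹ *
  (ratioB z ^ 2 * (triComp 1 (z * ratioB z ^ 3)).2.2 / (1 - z * ratioB z ^ 3) ^ 1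
    + 10 * (thetaPsi (-z) / thetaA (-z)) ^ 4 *
      (ratioB z * (triComp 5 (z * ratioB z ^ 3)).2.1) / (1 - z * ratioB z ^ 3) ^ 5
    + 36 * (thetaPsi (-z) / thetaA (-z)) ^ 8 *
      (triComp 9 (z * ratioB z ^ 3)).1 / (1 - z * ratioB z ^ 3) ^ 9
    + 27 * (thetaPsi (-z) / thetaA (-z)) ^ 12 *
      (z * ratioB z ^ 2 * (triComp 13 (z * ratioB z ^ 3)).2.2) / (1 - z * ratioB z ^ 3) ^ 13)

/-- The generating function of `pbar(3n) - pbar(27n)`. -/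
def pbarSection (z : ℂ) : ℂ := (thetaPhi (z ^ 3))⁻¹ *
  ((triComp 1 (8 * (z * ratioY z ^ 3))).1 / (1 - 8 * (z * ratioY z ^ 3)) ^ 1
    - (27 * (thetaPhi z / thetaPhi (z ^ 3)) ^ 12 *
        (triComp 13 (8 * (z * ratioY z ^ 3))).1 / (1 - 8 * (z * ratioY z ^ 3)) ^ 13
      - 36 * (thetaPhi z / thetaPhi (z ^ 3)) ^ 8 *
        (triComp 9 (8 * (z * ratioY z ^ 3))).1 / (1 - 8 * (z * ratioY z ^ 3)) ^ 9
      + 10 * (thetaPhi z / thetaPhi (z ^ 3)) ^ 4 *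
        (triComp 5 (8 * (z * ratioY z ^ 3))).1 / (1 - 8 * (z * ratioY z ^ 3)) ^ 5))

/-- The powers of φ(-r³) are functions of r³, so only ψ(-r)/φ(-r)ᵏ for k = 1, 3, 7 has to be
dissected, and this is done uniformly in k. Only the middle component matters; the others stay
existential. -/
theorem pedSeries_dissection : ∃ G₀ G₂ : ℂ → ℂ, ∀ r : ℂ, ‖r‖ < 1 → r ≠ 0 →
    pedSeries r = G₀ (r ^ 3) + r * pedSection (r ^ 3) + r ^ 2 * G₂ (r ^ 3) := by
  have key : ∃ g₀ g₂ : ℕ → ℂ → ℂ, ∀ k : ℕ, ∀ r : ℂ, ‖r‖ < 1 → r ≠ 0 → thetaPsi (-r) * (thetaPhi r ^ k)⁻¹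
      = thetaA (-(r ^ 3)) * ((thetaPhi (r ^ 9)) ^ k)⁻¹ * (g₀ k (r ^ 3) + r * (ratioY (r ^ 3) *
        pedComp k (unitA (r ^ 3) / unitB (r ^ 3)) (r ^ 3 * ratioY (r ^ 3) ^ 3)) + r ^ 2 * g₂ k (r ^ 3)) := by
    refine ⟨fun k z => ((triComp k (8 * (z * ratioY z ^ 3))).1 - 4 * (unitA z / unitB z) * (z * ratioY z ^ 3) *
        (triComp k (8 * (z * ratioY z ^ 3))).2.2) / (1 - 8 * (z * ratioY z ^ 3)) ^ k,
      fun k z => ratioY z ^ 2 * ((4 * (triComp k (8 * (z * ratioY z ^ 3))).2.2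
        - 2 * (unitA z / unitB z) * (triComp k (8 * (z * ratioY z ^ 3))).2.1) /
          (1 - 8 * (z * ratioY z ^ 3)) ^ k), fun k r hr hr0 => ?_⟩
    · rw [thetaPsi_neg_eq_ratioY hr hr0, thetaPhi_eq_ratio hr hr0, mul_pow _ _ k, mul_inv, mul_mul_mul_comm,
        pedComp_spec k (unitA (r ^ 3) / unitB (r ^ 3)) rfl
        (one_sub_ratioY_cube_ne_zero (norm_pow_lt hr three_ne_zero) (pow_ne_zero 3 hr0))]
  obtain ⟨g₀, g₂, hg⟩ := key
  refine ⟨fun z => thetaA (-z) / thetaPhi (z ^ 3) * (g₀ 1 z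
    + 3 * (thetaPhi z / thetaPhi (z ^ 3)) ^ 6 * g₀ 7 z - 2 * (thetaPhi z / thetaPhi (z ^ 3)) ^ 2 * g₀ 3 z),
    fun z => thetaA (-z) / thetaPhi (z ^ 3) * (g₂ 1 z
    + 3 * (thetaPhi z / thetaPhi (z ^ 3)) ^ 6 * g₂ 7 z - 2 * (thetaPhi z / thetaPhi (z ^ 3)) ^ 2 * g₂ 3 z),
    fun r hr hr0 => ?_⟩
  have h1 := hg 1 r hr hr0
  have h3 := hg 3 r hr hr0
  have h7 := hg 7 r hr hr0
  simp only [pedSection, pedSeries, ← pow_mul, Nat.reduceMul] at *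
  linear_combination h1 + 3 * thetaPhi (r ^ 3) ^ 6 * h7 - 2 * thetaPhi (r ^ 3) ^ 2 * h3

theorem pobarSeries_dissection : ∃ G₁ G₂ : ℂ → ℂ, ∀ r : ℂ, ‖r‖ < 1 → r ≠ 0 →
    pobarSeries r = pobarSection (r ^ 3) + r * G₁ (r ^ 3) + r ^ 2 * G₂ (r ^ 3) := by
  have key : ∃ g₁ g₂ : ℕ → ℂ → ℂ, ∀ k : ℕ, ∀ r : ℂ, ‖r‖ < 1 → r ≠ 0 →
      thetaPhi (r ^ 2) * (thetaPhi r ^ k)⁻¹ = thetaPhi (r ^ 18) * ((thetaPhi (r ^ 9)) ^ k)⁻¹ *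
        (pobarComp k (unitA (r ^ 3) / unitB (r ^ 3)) (r ^ 3 * ratioY (r ^ 3) ^ 3)
          + r * g₁ k (r ^ 3) + r ^ 2 * g₂ k (r ^ 3)) := by
    refine ⟨fun k z => ratioY z * ((2 * (triComp k (8 * (z * ratioY z ^ 3))).2.1
        - 8 * (unitA z / unitB z) * (z * ratioY z ^ 3) * (triComp k (8 * (z * ratioY z ^ 3))).2.2) /
          (1 - 8 * (z * ratioY z ^ 3)) ^ k),
      fun k z => ratioY z ^ 2 * ((4 * (triComp k (8 * (z * ratioY z ^ 3))).2.2
        - 2 * (unitA z / unitB z) * (triComp k (8 * (z * ratioY z ^ 3))).1) /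
          (1 - 8 * (z * ratioY z ^ 3)) ^ k), fun k r hr hr0 => ?_⟩
    · rw [thetaPhi_sq_eq_ratioY hr hr0, thetaPhi_eq_ratio hr hr0, mul_pow _ _ k, mul_inv, mul_mul_mul_comm,
        pobarComp_spec k (unitA (r ^ 3) / unitB (r ^ 3)) rfl
        (one_sub_ratioY_cube_ne_zero (norm_pow_lt hr three_ne_zero) (pow_ne_zero 3 hr0))]
  obtain ⟨g₁, g₂, hg⟩ := key
  refine ⟨fun z => thetaPhi (z ^ 6) / thetaPhi (z ^ 3) * (g₁ 1 z
    - 3 * (thetaPhi z / thetaPhi (z ^ 3)) ^ 6 * g₁ 7 z + 2 * (thetaPhi z / thetaPhi (z ^ 3)) ^ 2 * g₁ 3 z),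
    fun z => thetaPhi (z ^ 6) / thetaPhi (z ^ 3) * (g₂ 1 z
    - 3 * (thetaPhi z / thetaPhi (z ^ 3)) ^ 6 * g₂ 7 z + 2 * (thetaPhi z / thetaPhi (z ^ 3)) ^ 2 * g₂ 3 z),
    fun r hr hr0 => ?_⟩
  have h1 := hg 1 r hr hr0
  have h3 := hg 3 r hr hr0
  have h7 := hg 7 r hr hr0
  simp only [pobarSection, pobarSeries, ← pow_mul, Nat.reduceMul] at *
  linear_combination h1 - 3 * thetaPhi (r ^ 3) ^ 6 * h7 + 2 * thetaPhi (r ^ 3) ^ 2 * h3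

theorem pbarSeries_dissection : ∃ G₁ G₂ : ℂ → ℂ, ∀ r : ℂ, ‖r‖ < 1 → r ≠ 0 →
    pbarSeries r = pbarSection (r ^ 3) + r * G₁ (r ^ 3) + r ^ 2 * G₂ (r ^ 3) := by
  have key : ∃ g₁ g₂ : ℕ → ℂ → ℂ, ∀ k : ℕ, ∀ r : ℂ, ‖r‖ < 1 → r ≠ 0 →
      (thetaPhi r ^ k)⁻¹ = ((thetaPhi (r ^ 9)) ^ k)⁻¹ *
        ((triComp k (8 * (r ^ 3 * ratioY (r ^ 3) ^ 3))).1 / (1 - 8 * (r ^ 3 * ratioY (r ^ 3) ^ 3)) ^ k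
          + r * g₁ k (r ^ 3) + r ^ 2 * g₂ k (r ^ 3)) := by
    refine ⟨fun k z => 2 * ratioY z * (triComp k (8 * (z * ratioY z ^ 3))).2.1 / (1 - 8 * (z * ratioY z ^ 3)) ^ k,
      fun k z => 4 * ratioY z ^ 2 * (triComp k (8 * (z * ratioY z ^ 3))).2.2 / (1 - 8 * (z * ratioY z ^ 3)) ^ k,
      fun k r hr hr0 => ?_⟩
    rw [thetaPhi_eq_ratio hr hr0, mul_pow _ _ k, mul_inv,
      inv_one_sub_pow k (y := 2 * (r * ratioY (r ^ 3))) (s := 8 * (r ^ 3 * ratioY (r ^ 3) ^ 3)) (by ring)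
        (one_sub_ratioY_cube_ne_zero (norm_pow_lt hr three_ne_zero) (pow_ne_zero 3 hr0))]
    ring
  obtain ⟨g₁, g₂, hg⟩ := key
  refine ⟨fun z => (thetaPhi (z ^ 3))⁻¹ * (g₁ 1 z - (27 * (thetaPhi z / thetaPhi (z ^ 3)) ^ 12 * g₁ 13 z
      - 36 * (thetaPhi z / thetaPhi (z ^ 3)) ^ 8 * g₁ 9 z + 10 * (thetaPhi z / thetaPhi (z ^ 3)) ^ 4 * g₁ 5 z)),
    fun z => (thetaPhi (z ^ 3))⁻¹ * (g₂ 1 z - (27 * (thetaPhi z / thetaPhi (z ^ 3)) ^ 12 * g₂ 13 z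
      - 36 * (thetaPhi z / thetaPhi (z ^ 3)) ^ 8 * g₂ 9 z + 10 * (thetaPhi z / thetaPhi (z ^ 3)) ^ 4 * g₂ 5 z)),
    fun r hr hr0 => ?_⟩
  have h1 := hg 1 r hr hr0
  have h5 := hg 5 r hr hr0
  have h9 := hg 9 r hr hr0
  have h13 := hg 13 r hr hr0
  simp only [pbarSection, pbarSeries, ← pow_mul, Nat.reduceMul]
  generalize (triComp 1 (8 * (r ^ 3 * ratioY (r ^ 3) ^ 3))).1 / (1 - 8 * (r ^ 3 * ratioY (r ^ 3) ^ 3)) ^ 1 = c1 at *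
  simp only [mul_div_assoc]
  generalize (triComp 5 (8 * (r ^ 3 * ratioY (r ^ 3) ^ 3))).1 / (1 - 8 * (r ^ 3 * ratioY (r ^ 3) ^ 3)) ^ 5 = c5 at *
  generalize (triComp 9 (8 * (r ^ 3 * ratioY (r ^ 3) ^ 3))).1 / (1 - 8 * (r ^ 3 * ratioY (r ^ 3) ^ 3)) ^ 9 = c9 at *
  generalize (triComp 13 (8 * (r ^ 3 * ratioY (r ^ 3) ^ 3))).1 / (1 - 8 * (r ^ 3 * ratioY (r ^ 3) ^ 3)) ^ 13 = c13 at *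
  linear_combination h1 - 27 * thetaPhi (r ^ 3) ^ 12 * h13 + 36 * thetaPhi (r ^ 3) ^ 8 * h9
    - 10 * thetaPhi (r ^ 3) ^ 4 * h5

/-- The prefactors 1, r, r², r³ of ψ(-r)⁻¹, ψ(-r)⁻⁵, ψ(-r)⁻⁹, ψ(-r)⁻¹³ rotate the components: the
class 2 modulo 3 receives their third, second, first and third components respectively. -/
theorem podSeries_dissection : ∃ G₀ G₁ : ℂ → ℂ, ∀ r : ℂ, ‖r‖ < 1 → r ≠ 0 →
    podSeries r = G₀ (r ^ 3) + r * G₁ (r ^ 3) + r ^ 2 * podSection (r ^ 3) := by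
  have key : ∃ c : ℕ → ℂ → ℂ × ℂ × ℂ, (∀ k z, c k z = ((triComp k (z * ratioB z ^ 3)).1 / (1 - z * ratioB z ^ 3) ^ k,
      ratioB z * (triComp k (z * ratioB z ^ 3)).2.1 / (1 - z * ratioB z ^ 3) ^ k,
      ratioB z ^ 2 * (triComp k (z * ratioB z ^ 3)).2.2 / (1 - z * ratioB z ^ 3) ^ k)) ∧
      ∀ k : ℕ, ∀ r : ℂ, ‖r‖ < 1 → r ≠ 0 →
      (thetaPsi (-r) ^ k)⁻¹ = (thetaA (-(r ^ 3)) ^ k)⁻¹ *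
        ((c k (r ^ 3)).1 + r * (c k (r ^ 3)).2.1 + r ^ 2 * (c k (r ^ 3)).2.2) := by
    refine ⟨_, fun k z => rfl, fun k r hr hr0 => ?_⟩
    rw [thetaPsi_neg_eq_ratio hr hr0, mul_pow _ _ k, mul_inv,
      inv_one_sub_pow k (y := r * ratioB (r ^ 3)) (s := r ^ 3 * ratioB (r ^ 3) ^ 3) (by ring)
        (one_sub_ratioB_cube_ne_zero (norm_pow_lt hr three_ne_zero) (pow_ne_zero 3 hr0))]
    ring
  obtain ⟨c, hc, hg⟩ := key
  refine ⟨fun z => (thetaA (-z))⁻¹ * ((c 1 z).1 + 10 * (thetaPsi (-z) / thetaA (-z)) ^ 4 * (z * (c 5 z).2.2)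
      + 36 * (thetaPsi (-z) / thetaA (-z)) ^ 8 * (z * (c 9 z).2.1) + 27 * (thetaPsi (-z) / thetaA (-z)) ^ 12 * (z * (c 13 z).1)),
    fun z => (thetaA (-z))⁻¹ * ((c 1 z).2.1 + 10 * (thetaPsi (-z) / thetaA (-z)) ^ 4 * ((c 5 z).1)
      + 36 * (thetaPsi (-z) / thetaA (-z)) ^ 8 * (z * (c 9 z).2.2) + 27 * (thetaPsi (-z) / thetaA (-z)) ^ 12 * (z * (c 13 z).2.1)),
    fun r hr hr0 => ?_⟩
  have hP : podSection (r ^ 3) = (thetaA (-(r ^ 3)))⁻¹ * ((c 1 (r ^ 3)).2.2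
      + 10 * (thetaPsi (-(r ^ 3)) / thetaA (-(r ^ 3))) ^ 4 * (c 5 (r ^ 3)).2.1
      + 36 * (thetaPsi (-(r ^ 3)) / thetaA (-(r ^ 3))) ^ 8 * (c 9 (r ^ 3)).1
      + 27 * (thetaPsi (-(r ^ 3)) / thetaA (-(r ^ 3))) ^ 12 * (r ^ 3 * (c 13 (r ^ 3)).2.2)) := by
    simp only [hc, podSection]; ring
  have h1 := hg 1 r hr hr0
  have h5 := hg 5 r hr hr0
  have h9 := hg 9 r hr hr0
  have h13 := hg 13 r hr hr0
  rw [hP, podSeries]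
  linear_combination h1 + 10 * r * thetaPsi (-(r ^ 3)) ^ 4 * h5 + 36 * r ^ 2 * thetaPsi (-(r ^ 3)) ^ 8 * h9
    + 27 * r ^ 3 * thetaPsi (-(r ^ 3)) ^ 12 * h13

section
variable {z : ℂ} (hz : ‖z‖ < 1) (hz0 : z ≠ 0)
include hz

theorem ped_gen : euler (z ^ 4) / euler z = thetaPsi (-z) / thetaPhi z := by
  have h1 := euler_ne_zero hz
  have h2 := euler_pow_ne_zero hz (n := 2) (by norm_num)
  rw [thetaPsi_neg hz, thetaPhi]; field_simp

theorem pobar_gen : euler (z ^ 2) ^ 3 / (euler z ^ 2 * euler (z ^ 4)) = thetaPhi (z ^ 2) / thetaPhi z := by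
  have h1 := euler_ne_zero hz
  have h2 := euler_pow_ne_zero hz (n := 2) (by norm_num)
  rw [thetaPhi, thetaPhi, ← pow_mul]; field_simp

include hz0

theorem hasSum_pedSection : HasSum (fun n =>
    ((ped (3 * n + 1) : ℂ) + (ped (27 * n + 10) : ℂ)) * z ^ n) (pedSection z) := by
  obtain ⟨G₀, G₂, hG⟩ := pedSeries_dissection
  refine ((hasSum_of_dissection (a := fun n => (ped n : ℂ) + (ped (9 * n + 1) : ℂ))
    (G₀ := G₀) (G₁ := pedSection) (G₂ := G₂) (fun r hr hr0 => ?_) hz hz0).2.1).congr_fun fun n => ?_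
  · rw [← hG r hr hr0, pedSeries, ← ped_gen hr]
    refine ((hasSum_ped hr).add (hasSum_ped_nine hr hr0)).congr_fun fun n => add_mul _ _ _
  · rw [show 9 * (3 * n + 1) + 1 = 27 * n + 10 by ring]

theorem hasSum_pobarSection : HasSum (fun n =>
    ((pobar (3 * n) : ℂ) - (pobar (27 * n) : ℂ)) * z ^ n) (pobarSection z) := by
  obtain ⟨G₁, G₂, hG⟩ := pobarSeries_dissection
  refine ((hasSum_of_dissection (a := fun n => (pobar n : ℂ) - (pobar (9 * n) : ℂ))
    (G₀ := pobarSection) (G₁ := G₁) (G₂ := G₂) (fun r hr hr0 => ?_) hz hz0).1).congr_fun fun n => ?_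
  · rw [← hG r hr hr0, pobarSeries, ← pobar_gen hr]
    refine ((hasSum_pobar hr).sub (hasSum_pobar_nine hr hr0)).congr_fun fun n => sub_mul _ _ _
  · rw [show 9 * (3 * n) = 27 * n by ring]

theorem hasSum_pbarSection : HasSum (fun n =>
    ((pbar (3 * n) : ℂ) - (pbar (27 * n) : ℂ)) * z ^ n) (pbarSection z) := by
  obtain ⟨G₁, G₂, hG⟩ := pbarSeries_dissection
  refine ((hasSum_of_dissection (a := fun n => (pbar n : ℂ) - (pbar (9 * n) : ℂ))
    (G₀ := pbarSection) (G₁ := G₁) (G₂ := G₂) (fun r hr hr0 => ?_) hz hz0).1).congr_fun fun n => ?_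
  · rw [← hG r hr hr0, pbarSeries, thetaPhi, inv_div]
    refine ((hasSum_pbar hr).sub (hasSum_pbar_nine hr hr0)).congr_fun fun n => sub_mul _ _ _
  · rw [show 9 * (3 * n) = 27 * n by ring]

theorem hasSum_podSection : HasSum (fun n =>
    ((pod (3 * n + 2) : ℂ) + (pod (27 * n + 17) : ℂ)) * z ^ n) (podSection z) := by
  obtain ⟨G₀, G₁, hG⟩ := podSeries_dissection
  -- At n = 0 the second term has to be zero, whereas truncated subtraction would give `pod 0`. The
  -- class 3n + 2 never meets this case.
  refine ((hasSum_of_dissection (a := fun n => (pod n : ℂ) + if n = 0 then 0 else (pod (9 * n - 1) : ℂ))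
    (G₀ := G₀) (G₁ := G₁) (G₂ := podSection) (fun r hr hr0 => ?_) hz hz0).2.2).congr_fun fun n => ?_
  · rw [← hG r hr hr0, podSeries, thetaPsi_neg hr, inv_div, ← thetaPsi_neg hr]
    have h2 : HasSum (fun n => (if n = 0 then 0 else (pod (9 * n - 1) : ℂ)) * r ^ n)
        (r * (10 * thetaPsi (-(r ^ 3)) ^ 4 / thetaPsi (-r) ^ 5
          + 36 * r * thetaPsi (-(r ^ 3)) ^ 8 / thetaPsi (-r) ^ 9
          + 27 * r ^ 2 * thetaPsi (-(r ^ 3)) ^ 12 / thetaPsi (-r) ^ 13)) := by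
      refine (hasSum_nat_add_iff' 1).1 ?_
      simp only [Finset.range_one, Finset.sum_singleton, if_true, zero_mul, sub_zero]
      refine ((hasSum_pod_nine hr hr0).mul_left r).congr_fun fun n => ?_
      rw [if_neg n.succ_ne_zero, show 9 * (n + 1) - 1 = 9 * n + 8 by omega]
      ring
    refine ((hasSum_pod hr).add h2).congr_fun fun n => add_mul _ _ _
  · simp only [show 3 * n + 2 ≠ 0 by omega, if_false]
    rw [show 9 * (3 * n + 2) - 1 = 27 * n + 17 by omega]

end


/-! ### Eta quotients and the functions `L` in terms of the nome -/

theorem q_pow_eq (τ : ℍ) : Complex.exp (2 * Real.pi * Complex.I * τ / 24) ^ 24 = q τ := by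
  rw [q, ← Complex.exp_nat_mul]; congr 1; push_cast; ring

theorem f_eq (r : ℕ) (τ : ℍ) : f r τ = euler (q τ ^ r) := by
  simp only [f, euler, ← pow_mul]

theorem e_eq (d : ℕ) (τ : ℍ) :
    e d τ = Complex.exp (2 * Real.pi * Complex.I * τ / 24) ^ d * euler (q τ ^ d) := by
  rw [e, ModularForm.eta, euler]
  congr 1
  · rw [Function.Periodic.qParam, ← Complex.exp_nat_mul]; congr 1; push_cast; ring
  · refine tprod_congr fun n => ?_
    have h : q τ ^ d = Complex.exp (2 * Real.pi * Complex.I * (d * τ)) := by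
      rw [q, ← Complex.exp_nat_mul]; congr 1; ring
    rw [ModularForm.eta_q_eq_pow, h]

@[fun_prop]
theorem differentiableAt_euler_comp {g : ℂ → ℂ} {z : ℂ} (hg : DifferentiableAt ℂ g z)
    (h : ‖g z‖ < 1) : DifferentiableAt ℂ (fun y => euler (g y)) z :=
  DifferentiableAt.comp z (differentiableOn_euler.differentiableAt
    (Metric.isOpen_ball.mem_nhds (by simpa using h))) hg

/-! ### The brackets of the four P as generating functions -/

section
variable {z : ℂ} (hz : ‖z‖ < 1)
include hz

theorem three_cube_sub : 24 * (z * ratioY z ^ 3) * thetaPhi (z ^ 3) ^ 4 = 3 * thetaPhi (z ^ 3) ^ 4 - 3 * thetaPhi z ^ 4 := by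
  rcases eq_or_ne z 0 with rfl | hz0
  · simp [thetaPhi, euler_zero]
  · rw [thetaPhi_pow_four hz hz0]; ring

/-- With X = φ(-z³) and P = φ(-z), the relation 3X⁴ = 3P⁴ + 24tX⁴ of `three_cube_sub` turns 3X⁶/P⁷ -
2X²/P³ into X²/P³ + 24tX⁶/P⁷. The terms are then single eta quotients. -/
theorem pedSeries_eq : pedSeries z = euler (z ^ 4) / euler z
    + (euler (z ^ 2) ^ 2 * euler (z ^ 3) ^ 4 * euler (z ^ 4)) / (euler z ^ 5 * euler (z ^ 6) ^ 2)
    + 24 * z * ((euler (z ^ 2) ^ 3 * euler (z ^ 3) ^ 3 * euler (z ^ 4) * euler (z ^ 6) ^ 3) /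
        euler z ^ 10) := by
  have h1 := euler_ne_zero hz
  have h2 := euler_pow_ne_zero hz (n := 2) (by norm_num)
  have h3 := euler_pow_ne_zero hz (n := 3) (by norm_num)
  have h4 := euler_pow_ne_zero hz (n := 4) (by norm_num)
  have h6 := euler_pow_ne_zero hz (n := 6) (by norm_num)
  have hP := thetaPhi_ne_zero hz
  have e : 3 * thetaPhi (z ^ 3) ^ 6 / thetaPhi z ^ 7 - 2 * thetaPhi (z ^ 3) ^ 2 / thetaPhi z ^ 3
      = thetaPhi (z ^ 3) ^ 2 / thetaPhi z ^ 3
        + 24 * (z * ratioY z ^ 3) * thetaPhi (z ^ 3) ^ 6 / thetaPhi z ^ 7 := by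
    field_simp
    linear_combination -thetaPhi (z ^ 3) ^ 2 * three_cube_sub hz
  rw [pedSeries, e, thetaPsi_neg hz]
  simp only [ratioY, thetaOmega, thetaPhi, ← pow_mul, Nat.reduceMul]
  field_simp
  ring

theorem pobarSeries_eq : pobarSeries z = euler (z ^ 2) ^ 3 / (euler z ^ 2 * euler (z ^ 4))
    - (euler (z ^ 2) ^ 5 * euler (z ^ 3) ^ 4) / (euler z ^ 6 * euler (z ^ 4) * euler (z ^ 6) ^ 2)
    - 24 * z * ((euler (z ^ 2) ^ 6 * euler (z ^ 3) ^ 3 * euler (z ^ 6) ^ 3) /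
        (euler z ^ 11 * euler (z ^ 4))) := by
  have h1 := euler_ne_zero hz
  have h2 := euler_pow_ne_zero hz (n := 2) (by norm_num)
  have h3 := euler_pow_ne_zero hz (n := 3) (by norm_num)
  have h4 := euler_pow_ne_zero hz (n := 4) (by norm_num)
  have h6 := euler_pow_ne_zero hz (n := 6) (by norm_num)
  have hP := thetaPhi_ne_zero hz
  have e : 3 * thetaPhi (z ^ 3) ^ 6 / thetaPhi z ^ 7 - 2 * thetaPhi (z ^ 3) ^ 2 / thetaPhi z ^ 3
      = thetaPhi (z ^ 3) ^ 2 / thetaPhi z ^ 3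
        + 24 * (z * ratioY z ^ 3) * thetaPhi (z ^ 3) ^ 6 / thetaPhi z ^ 7 := by
    field_simp
    linear_combination -thetaPhi (z ^ 3) ^ 2 * three_cube_sub hz
  rw [pobarSeries, e]
  simp only [ratioY, thetaOmega, thetaPhi, ← pow_mul, Nat.reduceMul]
  field_simp
  ring

/-- The coefficients come from 27 - 36s + 10s² = 1 + 128t + 640t² with s = 1 - 8t. -/
theorem pbarSeries_eq : pbarSeries z = euler (z ^ 2) / euler z ^ 2
    - (euler (z ^ 2) ^ 13 * euler (z ^ 3) ^ 24) / (euler z ^ 26 * euler (z ^ 6) ^ 12)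
    - 128 * z * ((euler (z ^ 2) ^ 10 * euler (z ^ 3) ^ 15) / (euler z ^ 23 * euler (z ^ 6) ^ 3))
    - 640 * z ^ 2 * ((euler (z ^ 2) ^ 7 * euler (z ^ 3) ^ 6 * euler (z ^ 6) ^ 6) / euler z ^ 20) := by
  have h1 := euler_ne_zero hz
  have h2 := euler_pow_ne_zero hz (n := 2) (by norm_num)
  have h3 := euler_pow_ne_zero hz (n := 3) (by norm_num)
  have h6 := euler_pow_ne_zero hz (n := 6) (by norm_num)
  have hP := thetaPhi_ne_zero hz
  have e : 27 * thetaPhi (z ^ 3) ^ 12 / thetaPhi z ^ 13 - 36 * thetaPhi (z ^ 3) ^ 8 / thetaPhi z ^ 9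
        + 10 * thetaPhi (z ^ 3) ^ 4 / thetaPhi z ^ 5
      = thetaPhi (z ^ 3) ^ 12 / thetaPhi z ^ 13 *
        (1 + 128 * (z * ratioY z ^ 3) + 640 * (z * ratioY z ^ 3) ^ 2) := by
    have := three_cube_sub hz
    generalize z * ratioY z ^ 3 = t at *
    generalize thetaPhi (z ^ 3) = X at *
    generalize thetaPhi z = P at *
    field_simp
    linear_combination (10 * X ^ 4 * (P ^ 4 + X ^ 4 * (1 - 8 * t)) - 36 * X ^ 8) / 3 * this
  rw [pbarSeries, e]
  simp only [ratioY, thetaOmega, thetaPhi, ← pow_mul, Nat.reduceMul]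
  field_simp
  ring

/-- The coefficients come from 10(1 - t)² + 36t(1 - t) + 27t² = 10 + 16t + t² with t = z·`ratioB z ^
3`. -/
theorem podSeries_eq : podSeries z = euler (z ^ 2) / (euler z * euler (z ^ 4))
    + 10 * z * ((euler (z ^ 2) * euler (z ^ 6) ^ 24) /
        (euler z ^ 7 * euler (z ^ 3) ^ 6 * euler (z ^ 4) ^ 7 * euler (z ^ 12) ^ 6))
    + 16 * z ^ 2 * ((euler (z ^ 2) ^ 7 * euler (z ^ 3) ^ 3 * euler (z ^ 6) ^ 6 * euler (z ^ 12) ^ 3) /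
        (euler z ^ 10 * euler (z ^ 4) ^ 10))
    + z ^ 3 * ((euler (z ^ 2) ^ 13 * euler (z ^ 3) ^ 12 * euler (z ^ 12) ^ 12) /
        (euler z ^ 13 * euler (z ^ 4) ^ 13 * euler (z ^ 6) ^ 12)) := by
  rcases eq_or_ne z 0 with rfl | hz0
  · simp [podSeries, thetaPsi, euler_zero]
  have h1 := euler_ne_zero hz
  have h2 := euler_pow_ne_zero hz (n := 2) (by norm_num)
  have h3 := euler_pow_ne_zero hz (n := 3) (by norm_num)
  have h4 := euler_pow_ne_zero hz (n := 4) (by norm_num)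
  have h6 := euler_pow_ne_zero hz (n := 6) (by norm_num)
  have h12 := euler_pow_ne_zero hz (n := 12) (by norm_num)
  have ha : thetaA (-z) ≠ 0 := thetaA_ne_zero (by simpa using hz)
  have hP : thetaPsi (-z) ≠ 0 := thetaPsi_ne_zero (by simpa using hz)
  have hb : thetaPsi (-(z ^ 3)) = ratioB z * thetaA (-z) := by rw [ratioB]; field_simp
  have e : 10 * thetaPsi (-(z ^ 3)) ^ 4 / thetaPsi (-z) ^ 5
      + 36 * z * thetaPsi (-(z ^ 3)) ^ 8 / thetaPsi (-z) ^ 9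
      + 27 * z ^ 2 * thetaPsi (-(z ^ 3)) ^ 12 / thetaPsi (-z) ^ 13
      = thetaA (-z) ^ 6 * thetaPsi (-(z ^ 3)) ^ 6 / thetaPsi (-z) ^ 13 *
        (10 + 16 * (z * thetaPsi (-(z ^ 3)) ^ 3 / thetaA (-z) ^ 3)
          + (z * thetaPsi (-(z ^ 3)) ^ 3 / thetaA (-z) ^ 3) ^ 2) := by
    have h4 := thetaPsi_neg_pow_four hz hz0
    rw [hb] at h4 ⊢
    generalize thetaPsi (-z) = P at *
    generalize thetaA (-z) = a at *
    generalize ratioB z = y at *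
    field_simp
    linear_combination y ^ 4 * (10 * (P ^ 4 + y * a * a ^ 3 * (1 - z * y ^ 3)) + 36 * y ^ 4 * a ^ 4 * z) * h4
  rw [podSeries, e, thetaPsi_neg_cube hz, thetaPsi_neg hz, thetaA_neg hz]
  field_simp
  ring

end


/-- One 24th root of the nome serves all the eta factors simultaneously, so fractional powers of q
in eta quotients become integral powers of ε and can be cancelled algebraically. -/
theorem exists_eta_eq (τ : ℍ) : ∃ ε : ℂ, ε ≠ 0 ∧ ε ^ 24 = q τ ∧
    ∀ d : ℕ, e d τ = ε ^ d * euler (q τ ^ d) :=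
  ⟨_, Complex.exp_ne_zero _, q_pow_eq τ, fun d => e_eq d τ⟩

theorem differentiableAt_thetaPhi_comp {g : ℂ → ℂ} {z : ℂ} (hg : DifferentiableAt ℂ g z)
    (h : ‖g z‖ < 1) : DifferentiableAt ℂ (fun y => thetaPhi (g y)) z := by
  have h2 := norm_pow_lt h two_ne_zero
  have := euler_ne_zero h2
  unfold thetaPhi
  fun_prop (disch := assumption)

theorem differentiableAt_thetaPsi_comp {g : ℂ → ℂ} {z : ℂ} (hg : DifferentiableAt ℂ g z)
    (h : ‖g z‖ < 1) : DifferentiableAt ℂ (fun y => thetaPsi (g y)) z := by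
  have h2 := norm_pow_lt h two_ne_zero
  have := euler_ne_zero h
  unfold thetaPsi
  fun_prop (disch := assumption)

section
variable {z : ℂ} (hz : ‖z‖ < 1)
include hz

theorem differentiableAt_euler_pow {n : ℕ} (hn : n ≠ 0) :
    DifferentiableAt ℂ (fun y => euler (y ^ n)) z :=
  differentiableAt_euler_comp (by fun_prop) (norm_pow_lt hz hn)

theorem differentiableAt_euler_cube_pow {n : ℕ} (hn : n ≠ 0) :
    DifferentiableAt ℂ (fun y => euler ((y ^ 3) ^ n)) z :=
  differentiableAt_euler_comp (by fun_prop) (norm_pow_lt (norm_pow_lt hz three_ne_zero) hn)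

theorem differentiableAt_pedSeries : DifferentiableAt ℂ pedSeries z := by
  have h3 := norm_pow_lt hz three_ne_zero
  have hn : ‖-z‖ < 1 := by simpa using hz
  have := thetaPhi_ne_zero hz
  have d1 := differentiableAt_thetaPhi_comp (g := fun y => y) (by fun_prop) hz
  have d3 := differentiableAt_thetaPhi_comp (g := fun y => y ^ 3) (by fun_prop) h3
  have d2 := differentiableAt_thetaPsi_comp (g := fun y => -y) (by fun_prop) hn
  exact (d2.div d1 this).add (d2.mul ((((d3.pow 6).const_mul 3).div (d1.pow 7) (pow_ne_zero 7 this)).sub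
    (((d3.pow 2).const_mul 2).div (d1.pow 3) (pow_ne_zero 3 this))))

theorem differentiableAt_pobarSeries : DifferentiableAt ℂ pobarSeries z := by
  have h3 := norm_pow_lt hz three_ne_zero
  have := thetaPhi_ne_zero hz
  have d1 := differentiableAt_thetaPhi_comp (g := fun y => y) (by fun_prop) hz
  have d3 := differentiableAt_thetaPhi_comp (g := fun y => y ^ 3) (by fun_prop) h3
  have d2 := differentiableAt_thetaPhi_comp (g := fun y => y ^ 2) (by fun_prop) (norm_pow_lt hz two_ne_zero)
  exact (d2.div d1 this).sub (d2.mul ((((d3.pow 6).const_mul 3).div (d1.pow 7) (pow_ne_zero 7 this)).sub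
    (((d3.pow 2).const_mul 2).div (d1.pow 3) (pow_ne_zero 3 this))))

theorem differentiableAt_pbarSeries : DifferentiableAt ℂ pbarSeries z := by
  have h3 := norm_pow_lt hz three_ne_zero
  have := thetaPhi_ne_zero hz
  have d1 := differentiableAt_thetaPhi_comp (g := fun y => y) (by fun_prop) hz
  have d3 := differentiableAt_thetaPhi_comp (g := fun y => y ^ 3) (by fun_prop) h3
  exact (d1.inv this).sub (((((d3.pow 12).const_mul 27).div (d1.pow 13) (pow_ne_zero 13 this)).sub
    (((d3.pow 8).const_mul 36).div (d1.pow 9) (pow_ne_zero 9 this))).add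
    (((d3.pow 4).const_mul 10).div (d1.pow 5) (pow_ne_zero 5 this)))

theorem differentiableAt_podSeries : DifferentiableAt ℂ podSeries z := by
  have h3 : ‖-(z ^ 3)‖ < 1 := by rw [norm_neg]; exact norm_pow_lt hz three_ne_zero
  have hn : ‖-z‖ < 1 := by simpa using hz
  have := thetaPsi_ne_zero hn
  have d1 := differentiableAt_thetaPsi_comp (g := fun y => -y) (by fun_prop) hn
  have d3 := differentiableAt_thetaPsi_comp (g := fun y => -(y ^ 3)) (by fun_prop) h3
  exact (d1.inv this).add (differentiableAt_fun_id.mul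
    (((((d3.pow 4).const_mul 10).div (d1.pow 5) (pow_ne_zero 5 this)).add
    (((differentiableAt_fun_id.const_mul 36).mul (d3.pow 8)).div (d1.pow 9) (pow_ne_zero 9 this))).add
    ((((differentiableAt_fun_id.pow 2).const_mul 27).mul (d3.pow 12)).div (d1.pow 13) (pow_ne_zero 13 this))))

end

/-! ### Applying U₃ to the four P -/

theorem Lped_eq (τ : ℍ) : Lped τ = euler (q τ ^ 3) ^ 2 * euler (q τ ^ 4) ^ 3 /
      (euler (q τ) ^ 3 * euler (q τ ^ 12) ^ 2) * pedSection (q τ) := by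
  obtain ⟨G₀, G₂, hG⟩ := pedSeries_dissection
  rw [Lped, U_three_eq (G := fun z => euler (z ^ 3) ^ 2 * euler (z ^ 4) ^ 3 /
      (euler z ^ 3 * euler (z ^ 12) ^ 2))
    -- The powers of q in the eta factors combine to q⁻¹ = q²/q³. The factor r² carries the class 1
    -- modulo 3 of `pedSeries` to the class 0 kept by U₃.
    (H := fun r => r ^ 2 * pedSeries r)
    (H₀ := fun z => z * pedSection z) (H₁ := fun z => z * G₂ z) (H₂ := fun z => G₀ z) ?_ (fun τ => ?_)
    (fun r hr hr0 => by simp only [hG r hr hr0]; ring)]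
  · have := q_ne_zero τ
    field_simp
  · intro z hz
    rw [Metric.mem_ball, dist_zero_right] at hz
    have d3 := differentiableAt_euler_cube_pow hz (n := 3) (by norm_num)
    have n3 := euler_pow_ne_zero (norm_pow_lt hz three_ne_zero) (n := 3) (by norm_num)
    have d4 := differentiableAt_euler_cube_pow hz (n := 4) (by norm_num)
    have n4 := euler_pow_ne_zero (norm_pow_lt hz three_ne_zero) (n := 4) (by norm_num)
    have d12 := differentiableAt_euler_cube_pow hz (n := 12) (by norm_num)
    have n12 := euler_pow_ne_zero (norm_pow_lt hz three_ne_zero) (n := 12) (by norm_num)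
    have d1 := differentiableAt_euler_pow hz (n := 3) (by norm_num)
    have n1 := euler_pow_ne_zero hz (n := 3) (by norm_num)
    exact ((((d3.pow 2).mul (d4.pow 3)).div ((d1.pow 3).mul (d12.pow 2))
      (mul_ne_zero (pow_ne_zero 3 n1) (pow_ne_zero 2 n12))).mul ((differentiableAt_fun_id.pow 2).mul (differentiableAt_pedSeries hz))).differentiableWithinAt
  · obtain ⟨ε, hε, hq, he⟩ := exists_eta_eq τ
    have hz := norm_q_lt_one τ
    have h1 := euler_ne_zero hz
    have h2 := euler_pow_ne_zero hz (n := 2) (by norm_num)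
    have h3 := euler_pow_ne_zero hz (n := 3) (by norm_num)
    have h4 := euler_pow_ne_zero hz (n := 4) (by norm_num)
    have h6 := euler_pow_ne_zero hz (n := 6) (by norm_num)
    have h9 := euler_pow_ne_zero hz (n := 9) (by norm_num)
    have h12 := euler_pow_ne_zero hz (n := 12) (by norm_num)
    have h36 := euler_pow_ne_zero hz (n := 36) (by norm_num)
    simp only [pedSeries_eq hz, Pped, he, ← pow_mul, Nat.reduceMul, pow_one]
    generalize q τ = u at *
    generalize euler u = a1 at *
    generalize euler (u ^ 2) = a2 at *
    generalize euler (u ^ 3) = a3 at *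
    generalize euler (u ^ 4) = a4 at *
    generalize euler (u ^ 6) = a6 at *
    generalize euler (u ^ 9) = a9 at *
    generalize euler (u ^ 12) = a12 at *
    generalize euler (u ^ 36) = a36 at *
    subst hq
    field_simp

theorem Lpod_eq (τ : ℍ) : Lpod τ = euler (q τ ^ 2) ^ 4 * euler (q τ ^ 4) ^ 5 * euler (q τ ^ 12) ^ 2 /
      (euler (q τ) * euler (q τ ^ 3) ^ 4 * euler (q τ ^ 6) ^ 5) * (q τ * podSection (q τ)) := by
  obtain ⟨G₀, G₁, hG⟩ := podSeries_dissection
  rw [Lpod, U_three_eq (G := fun z => euler (z ^ 2) ^ 4 * euler (z ^ 4) ^ 5 * euler (z ^ 12) ^ 2 /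
      (euler z * euler (z ^ 3) ^ 4 * euler (z ^ 6) ^ 5))
    -- Here the eta factors contribute q = q⁴/q³, and r⁴ carries the class 2 to the class 0.
    (H := fun r => r ^ 4 * podSeries r)
    (H₀ := fun z => z ^ 2 * podSection z) (H₁ := fun z => z * G₀ z) (H₂ := fun z => z * G₁ z) ?_ (fun τ => ?_)
    (fun r hr hr0 => by simp only [hG r hr hr0]; ring)]
  · have := q_ne_zero τ
    field_simp
  · intro z hz
    rw [Metric.mem_ball, dist_zero_right] at hz
    have d2 := differentiableAt_euler_cube_pow hz (n := 2) (by norm_num)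
    have n2 := euler_pow_ne_zero (norm_pow_lt hz three_ne_zero) (n := 2) (by norm_num)
    have d4 := differentiableAt_euler_cube_pow hz (n := 4) (by norm_num)
    have n4 := euler_pow_ne_zero (norm_pow_lt hz three_ne_zero) (n := 4) (by norm_num)
    have d12 := differentiableAt_euler_cube_pow hz (n := 12) (by norm_num)
    have n12 := euler_pow_ne_zero (norm_pow_lt hz three_ne_zero) (n := 12) (by norm_num)
    have d3 := differentiableAt_euler_cube_pow hz (n := 3) (by norm_num)
    have n3 := euler_pow_ne_zero (norm_pow_lt hz three_ne_zero) (n := 3) (by norm_num)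
    have d6 := differentiableAt_euler_cube_pow hz (n := 6) (by norm_num)
    have n6 := euler_pow_ne_zero (norm_pow_lt hz three_ne_zero) (n := 6) (by norm_num)
    have d1 := differentiableAt_euler_pow hz (n := 3) (by norm_num)
    have n1 := euler_pow_ne_zero hz (n := 3) (by norm_num)
    exact (((((d2.pow 4).mul (d4.pow 5)).mul (d12.pow 2)).div ((d1.mul (d3.pow 4)).mul (d6.pow 5))
      (mul_ne_zero (mul_ne_zero n1 (pow_ne_zero 4 n3)) (pow_ne_zero 5 n6))).mul ((differentiableAt_fun_id.pow 4).mul (differentiableAt_podSeries hz))).differentiableWithinAt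
  · obtain ⟨ε, hε, hq, he⟩ := exists_eta_eq τ
    have hz := norm_q_lt_one τ
    have h1 := euler_ne_zero hz
    have h2 := euler_pow_ne_zero hz (n := 2) (by norm_num)
    have h3 := euler_pow_ne_zero hz (n := 3) (by norm_num)
    have h4 := euler_pow_ne_zero hz (n := 4) (by norm_num)
    have h6 := euler_pow_ne_zero hz (n := 6) (by norm_num)
    have h9 := euler_pow_ne_zero hz (n := 9) (by norm_num)
    have h12 := euler_pow_ne_zero hz (n := 12) (by norm_num)
    have h18 := euler_pow_ne_zero hz (n := 18) (by norm_num)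
    have h36 := euler_pow_ne_zero hz (n := 36) (by norm_num)
    simp only [podSeries_eq hz, Ppod, he, ← pow_mul, Nat.reduceMul, pow_one]
    generalize q τ = u at *
    generalize euler u = a1 at *
    generalize euler (u ^ 2) = a2 at *
    generalize euler (u ^ 3) = a3 at *
    generalize euler (u ^ 4) = a4 at *
    generalize euler (u ^ 6) = a6 at *
    generalize euler (u ^ 9) = a9 at *
    generalize euler (u ^ 12) = a12 at *
    generalize euler (u ^ 18) = a18 at *
    generalize euler (u ^ 36) = a36 at *
    subst hq
    field_simp

theorem Lpobar_eq (τ : ℍ) : Lpobar τ = euler (q τ ^ 2) ^ 9 * euler (q τ ^ 3) ^ 4 * euler (q τ ^ 12) ^ 2 /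
      (euler (q τ) ^ 6 * euler (q τ ^ 4) ^ 3 * euler (q τ ^ 6) ^ 6) * pobarSection (q τ) := by
  obtain ⟨G₁, G₂, hG⟩ := pobarSeries_dissection
  rw [Lpobar, U_three_eq (G := fun z => euler (z ^ 2) ^ 9 * euler (z ^ 3) ^ 4 * euler (z ^ 12) ^ 2 /
      (euler z ^ 6 * euler (z ^ 4) ^ 3 * euler (z ^ 6) ^ 6))
    (H := fun r => r ^ 3 * pobarSeries r)
    (H₀ := fun z => z * pobarSection z) (H₁ := fun z => z * G₁ z) (H₂ := fun z => z * G₂ z) ?_ (fun τ => ?_)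
    (fun r hr hr0 => by simp only [hG r hr hr0]; ring)]
  · have := q_ne_zero τ
    field_simp
  · intro z hz
    rw [Metric.mem_ball, dist_zero_right] at hz
    have d2 := differentiableAt_euler_cube_pow hz (n := 2) (by norm_num)
    have n2 := euler_pow_ne_zero (norm_pow_lt hz three_ne_zero) (n := 2) (by norm_num)
    have d3 := differentiableAt_euler_cube_pow hz (n := 3) (by norm_num)
    have n3 := euler_pow_ne_zero (norm_pow_lt hz three_ne_zero) (n := 3) (by norm_num)
    have d12 := differentiableAt_euler_cube_pow hz (n := 12) (by norm_num)
    have n12 := euler_pow_ne_zero (norm_pow_lt hz three_ne_zero) (n := 12) (by norm_num)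
    have d4 := differentiableAt_euler_cube_pow hz (n := 4) (by norm_num)
    have n4 := euler_pow_ne_zero (norm_pow_lt hz three_ne_zero) (n := 4) (by norm_num)
    have d6 := differentiableAt_euler_cube_pow hz (n := 6) (by norm_num)
    have n6 := euler_pow_ne_zero (norm_pow_lt hz three_ne_zero) (n := 6) (by norm_num)
    have d1 := differentiableAt_euler_pow hz (n := 3) (by norm_num)
    have n1 := euler_pow_ne_zero hz (n := 3) (by norm_num)
    exact (((((d2.pow 9).mul (d3.pow 4)).mul (d12.pow 2)).div (((d1.pow 6).mul (d4.pow 3)).mul (d6.pow 6))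
      (mul_ne_zero (mul_ne_zero (pow_ne_zero 6 n1) (pow_ne_zero 3 n4)) (pow_ne_zero 6 n6))).mul ((differentiableAt_fun_id.pow 3).mul (differentiableAt_pobarSeries hz))).differentiableWithinAt
  · obtain ⟨ε, hε, hq, he⟩ := exists_eta_eq τ
    have hz := norm_q_lt_one τ
    have h1 := euler_ne_zero hz
    have h2 := euler_pow_ne_zero hz (n := 2) (by norm_num)
    have h3 := euler_pow_ne_zero hz (n := 3) (by norm_num)
    have h4 := euler_pow_ne_zero hz (n := 4) (by norm_num)
    have h6 := euler_pow_ne_zero hz (n := 6) (by norm_num)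
    have h9 := euler_pow_ne_zero hz (n := 9) (by norm_num)
    have h12 := euler_pow_ne_zero hz (n := 12) (by norm_num)
    have h18 := euler_pow_ne_zero hz (n := 18) (by norm_num)
    have h36 := euler_pow_ne_zero hz (n := 36) (by norm_num)
    simp only [pobarSeries_eq hz, Ppobar, he, ← pow_mul, Nat.reduceMul, pow_one]
    generalize q τ = u at *
    generalize euler u = a1 at *
    generalize euler (u ^ 2) = a2 at *
    generalize euler (u ^ 3) = a3 at *
    generalize euler (u ^ 4) = a4 at *
    generalize euler (u ^ 6) = a6 at *
    generalize euler (u ^ 9) = a9 at *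
    generalize euler (u ^ 12) = a12 at *
    generalize euler (u ^ 18) = a18 at *
    generalize euler (u ^ 36) = a36 at *
    subst hq
    field_simp

theorem Lpbar_eq (τ : ℍ) : Lpbar τ = euler (q τ ^ 2) ^ 19 * euler (q τ ^ 6) /
      (euler (q τ) ^ 6 * euler (q τ ^ 3) ^ 6 * euler (q τ ^ 4) ^ 5 * euler (q τ ^ 12) ^ 2) * (pbarSection (q τ ^ 2) / q τ) := by
  obtain ⟨G₁, G₂, hG⟩ := pbarSeries_dissection
  rw [Lpbar, U_three_eq (G := fun z => euler (z ^ 2) ^ 19 * euler (z ^ 6) /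
      (euler z ^ 6 * euler (z ^ 3) ^ 6 * euler (z ^ 4) ^ 5 * euler (z ^ 12) ^ 2))
    -- The eta factors contribute exactly q⁻³. Replacing r by r² interchanges the classes 1 and 2
    -- and keeps the class 0.
    (H := fun r => pbarSeries (r ^ 2))
    (H₀ := fun z => pbarSection (z ^ 2)) (H₁ := fun z => z * G₂ (z ^ 2)) (H₂ := fun z => G₁ (z ^ 2)) ?_ (fun τ => ?_)
    (fun r hr hr0 => by simp only [hG (r ^ 2) (norm_pow_lt hr two_ne_zero) (pow_ne_zero 2 hr0)]; ring_nf)]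
  · have := q_ne_zero τ
    field_simp
  · intro z hz
    rw [Metric.mem_ball, dist_zero_right] at hz
    have d2 := differentiableAt_euler_cube_pow hz (n := 2) (by norm_num)
    have n2 := euler_pow_ne_zero (norm_pow_lt hz three_ne_zero) (n := 2) (by norm_num)
    have d6 := differentiableAt_euler_cube_pow hz (n := 6) (by norm_num)
    have n6 := euler_pow_ne_zero (norm_pow_lt hz three_ne_zero) (n := 6) (by norm_num)
    have d3 := differentiableAt_euler_cube_pow hz (n := 3) (by norm_num)
    have n3 := euler_pow_ne_zero (norm_pow_lt hz three_ne_zero) (n := 3) (by norm_num)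
    have d4 := differentiableAt_euler_cube_pow hz (n := 4) (by norm_num)
    have n4 := euler_pow_ne_zero (norm_pow_lt hz three_ne_zero) (n := 4) (by norm_num)
    have d12 := differentiableAt_euler_cube_pow hz (n := 12) (by norm_num)
    have n12 := euler_pow_ne_zero (norm_pow_lt hz three_ne_zero) (n := 12) (by norm_num)
    have d1 := differentiableAt_euler_pow hz (n := 3) (by norm_num)
    have n1 := euler_pow_ne_zero hz (n := 3) (by norm_num)
    exact ((((d2.pow 19).mul d6).div ((((d1.pow 6).mul (d3.pow 6)).mul (d4.pow 5)).mul (d12.pow 2))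
      (mul_ne_zero (mul_ne_zero (mul_ne_zero (pow_ne_zero 6 n1) (pow_ne_zero 6 n3)) (pow_ne_zero 5 n4)) (pow_ne_zero 2 n12))).mul (DifferentiableAt.comp z (differentiableAt_pbarSeries (norm_pow_lt hz two_ne_zero)) (differentiableAt_fun_id.pow 2))).differentiableWithinAt
  · obtain ⟨ε, hε, hq, he⟩ := exists_eta_eq τ
    have hz := norm_q_lt_one τ
    have h1 := euler_ne_zero hz
    have h2 := euler_pow_ne_zero hz (n := 2) (by norm_num)
    have h3 := euler_pow_ne_zero hz (n := 3) (by norm_num)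
    have h4 := euler_pow_ne_zero hz (n := 4) (by norm_num)
    have h6 := euler_pow_ne_zero hz (n := 6) (by norm_num)
    have h9 := euler_pow_ne_zero hz (n := 9) (by norm_num)
    have h12 := euler_pow_ne_zero hz (n := 12) (by norm_num)
    have h18 := euler_pow_ne_zero hz (n := 18) (by norm_num)
    have h36 := euler_pow_ne_zero hz (n := 36) (by norm_num)
    simp only [pbarSeries_eq (z := q τ ^ 2) (norm_pow_lt hz two_ne_zero), Ppbar, he, ← pow_mul, Nat.reduceMul]
    generalize q τ = u at *
    generalize euler u = a1 at *
    generalize euler (u ^ 2) = a2 at *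
    generalize euler (u ^ 3) = a3 at *
    generalize euler (u ^ 4) = a4 at *
    generalize euler (u ^ 6) = a6 at *
    generalize euler (u ^ 9) = a9 at *
    generalize euler (u ^ 12) = a12 at *
    generalize euler (u ^ 18) = a18 at *
    generalize euler (u ^ 36) = a36 at *
    subst hq
    field_simp


/-! ### The functions `L` as rational functions of `haupt` -/

/-- Multiplication in ℂ[y]/(y³ - s). It yields the closed forms up to k = 13 without unfolding the
recursion step by step. -/
theorem triComp_add (m n : ℕ) (s : ℂ) : triComp (m + n) s =
    ((triComp m s).1 * (triComp n s).1
      + s * ((triComp m s).2.1 * (triComp n s).2.2 + (triComp m s).2.2 * (triComp n s).2.1),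
    (triComp m s).1 * (triComp n s).2.1 + (triComp m s).2.1 * (triComp n s).1
      + s * ((triComp m s).2.2 * (triComp n s).2.2),
    (triComp m s).1 * (triComp n s).2.2 + (triComp m s).2.2 * (triComp n s).1
      + (triComp m s).2.1 * (triComp n s).2.1) := by
  induction n with
  | zero => simp [triComp]
  | succ n ih =>
    rw [← Nat.add_assoc, triComp, ih, triComp]
    ext <;> simp only <;> ring

theorem triComp_one (s : ℂ) : triComp 1 s = (1, 1, 1) := by simp [triComp]

theorem triComp_two (s : ℂ) : triComp 2 s =
    (1 + 2 * s,
    2 + s,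
    3) := by
  refine (triComp_add 1 1 s).trans ?_
  rw [triComp_one]
  ext <;> simp only <;> ring

theorem triComp_three (s : ℂ) : triComp 3 s =
    (1 + 7 * s + s ^ 2,
    3 + 6 * s,
    6 + 3 * s) := by
  refine (triComp_add 2 1 s).trans ?_
  rw [triComp_two, triComp_one]
  ext <;> simp only <;> ring

theorem triComp_four (s : ℂ) : triComp 4 s =
    (1 + 16 * s + 10 * s ^ 2,
    4 + 19 * s + 4 * s ^ 2,
    10 + 16 * s + s ^ 2) := by
  refine (triComp_add 2 2 s).trans ?_
  rw [triComp_two]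
  ext <;> simp only <;> ring

theorem triComp_five (s : ℂ) : triComp 5 s =
    (1 + 30 * s + 45 * s ^ 2 + 5 * s ^ 3,
    5 + 45 * s + 30 * s ^ 2 + s ^ 3,
    15 + 51 * s + 15 * s ^ 2) := by
  refine (triComp_add 4 1 s).trans ?_
  rw [triComp_four, triComp_one]
  ext <;> simp only <;> ring

theorem triComp_seven (s : ℂ) : triComp 7 s =
    (1 + 77 * s + 357 * s ^ 2 + 266 * s ^ 3 + 28 * s ^ 4,
    7 + 161 * s + 393 * s ^ 2 + 161 * s ^ 3 + 7 * s ^ 4,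
    28 + 266 * s + 357 * s ^ 2 + 77 * s ^ 3 + s ^ 4) := by
  refine (triComp_add 4 3 s).trans ?_
  rw [triComp_four, triComp_three]
  ext <;> simp only <;> ring

theorem triComp_nine (s : ℂ) : triComp 9 s =
    (1 + 156 * s + 1554 * s ^ 2 + 3139 * s ^ 3 + 1554 * s ^ 4 + 156 * s ^ 5 + s ^ 6,
    9 + 414 * s + 2304 * s ^ 2 + 2907 * s ^ 3 + 882 * s ^ 4 + 45 * s ^ 5,
    45 + 882 * s + 2907 * s ^ 2 + 2304 * s ^ 3 + 414 * s ^ 4 + 9 * s ^ 5) := by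
  refine (triComp_add 5 4 s).trans ?_
  rw [triComp_five, triComp_four]
  ext <;> simp only <;> ring

theorem triComp_thirteen (s : ℂ) : triComp 13 s =
    (1 + 442 * s + 12727 * s ^ 2 + 87802 * s ^ 3 + 201643 * s ^ 4 + 171106 * s ^ 5 + 52624 * s ^ 6 + 5005 * s ^ 7 + 91 * s ^ 8,
    13 + 1651 * s + 27742 * s ^ 2 + 129844 * s ^ 3 + 212941 * s ^ 4 + 129844 * s ^ 5 + 27742 * s ^ 6 + 1651 * s ^ 7 + 13 * s ^ 8,
    91 + 5005 * s + 52624 * s ^ 2 + 171106 * s ^ 3 + 201643 * s ^ 4 + 87802 * s ^ 5 + 12727 * s ^ 6 + 442 * s ^ 7 + s ^ 8) := by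
  refine (triComp_add 9 4 s).trans ?_
  rw [triComp_nine, triComp_four]
  ext <;> simp only <;> ring

/-- The rational function expressing `Lped` in `haupt`. -/
def ratPed (x : ℂ) : ℂ := (1 + x) * (1 - x) *
  (30 + 6360 * x + 135648 * x ^ 2 + 644760 * x ^ 3 + 589356 * x ^ 4 - 1020600 * x ^ 5 - 454896 * x ^ 6 + 285768 * x ^ 7 + 39366 * x ^ 8) / (1 - 3 * x) ^ 11

/-- The rational function expressing `Lpobar` in `haupt`. -/
def ratPobar (x : ℂ) : ℂ := x * (1 + x) * (1 + 3 * x) *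
  (-1764 - 71952 * x - 526464 * x ^ 2 - 592272 * x ^ 3 + 1354968 * x ^ 4 + 898128 * x ^ 5 - 1236384 * x ^ 6 + 151632 * x ^ 7 + 8748 * x ^ 8) / (1 - 3 * x) ^ 11

/-- The rational function expressing `Lpod` in `haupt`. -/
def ratPod (x : ℂ) : ℂ := x * (1 - x) * (1 + 3 * x) *
  (87 + 6714 * x + 77787 * x ^ 2 + 234900 * x ^ 3 + 160947 * x ^ 4 + 56133 * x ^ 5 - 96228 * x ^ 6 - 109350 * x ^ 7 + 2204496 * x ^ 8 - 5904900 * x ^ 9 + 5609655 * x ^ 10 + 8503056 * x ^ 11 - 28166373 * x ^ 12 + 23914845 * x ^ 13 + 9565938 * x ^ 14 - 28697814 * x ^ 15 + 14348907 * x ^ 16) /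
    ((1 + x) ^ 2 * (1 - 3 * x) ^ 10)

/-- The rational function expressing `Lpbar` in `haupt`. -/
def ratPbar (x : ℂ) : ℂ := x * (1 - x) *
  (-53400 - 18976896 * x ^ 2 - 1099793376 * x ^ 4 - 15796788480 * x ^ 6 - 51154069968 * x ^ 8 + 21730032000 * x ^ 10 + 54368540064 * x ^ 12 - 19591041024 * x ^ 14 - 114791256 * x ^ 16) /
    ((1 + x) ^ 2 * (1 - 3 * x) ^ 10 * (1 + 3 * x) ^ 7)

/-- The substitution permutes the linear forms x, 1 ± x, 1 ± 3x and 1 projectively, as the cusps are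
permuted, so the denominator becomes a product of such forms again. What remains is a polynomial
identity. -/
theorem ratPed_transform {x : ℂ} (hC : 1 - 3 * x ≠ 0) (hD : 1 + 3 * x ≠ 0) :
    ratPed ((1 - x) / (1 + 3 * x)) = 1 / 2 * ratPobar x := by
  have e1 : 1 + (1 - x) / (1 + 3 * x) = 2 * (1 + x) / (1 + 3 * x) := by
    rw [eq_div_iff hD, add_mul, div_mul_cancel₀ _ hD]; ring
  have e2 : 1 - (1 - x) / (1 + 3 * x) = 4 * x / (1 + 3 * x) := by
    rw [eq_div_iff hD, sub_mul, div_mul_cancel₀ _ hD]; ring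
  have e3 : 1 - 3 * ((1 - x) / (1 + 3 * x)) = -2 * (1 - 3 * x) / (1 + 3 * x) := by
    rw [eq_div_iff hD, sub_mul, mul_assoc, div_mul_cancel₀ _ hD]; ring
  rw [ratPed, ratPobar, e1, e2, e3]
  -- Naming the linear denominators keeps their high powers factored while fractions are cleared.
  obtain ⟨C, hC'⟩ : ∃ C, C = 1 - 3 * x := ⟨_, rfl⟩
  obtain ⟨D, hD'⟩ : ∃ D, D = 1 + 3 * x := ⟨_, rfl⟩
  rw [← hC'] at hC ⊢
  rw [← hD'] at hD ⊢
  field_simp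
  rw [hD']
  ring

theorem ratPod_transform {x : ℂ} (hA : 1 + x ≠ 0) (hC : 1 - 3 * x ≠ 0) (hD : 1 + 3 * x ≠ 0) :
    ratPod ((1 - x) / (1 + 3 * x)) = -(1 / 8) * ratPbar x := by
  have e1 : 1 + (1 - x) / (1 + 3 * x) = 2 * (1 + x) / (1 + 3 * x) := by
    rw [eq_div_iff hD, add_mul, div_mul_cancel₀ _ hD]; ring
  have e2 : 1 - (1 - x) / (1 + 3 * x) = 4 * x / (1 + 3 * x) := by
    rw [eq_div_iff hD, sub_mul, div_mul_cancel₀ _ hD]; ring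
  have e3 : 1 - 3 * ((1 - x) / (1 + 3 * x)) = -2 * (1 - 3 * x) / (1 + 3 * x) := by
    rw [eq_div_iff hD, sub_mul, mul_assoc, div_mul_cancel₀ _ hD]; ring
  have e4 : 1 + 3 * ((1 - x) / (1 + 3 * x)) = 4 / (1 + 3 * x) := by
    rw [eq_div_iff hD, add_mul, mul_assoc, div_mul_cancel₀ _ hD]; ring
  rw [ratPod, ratPbar, e1, e2, e3, e4]
  obtain ⟨A, hA'⟩ : ∃ A, A = 1 + x := ⟨_, rfl⟩
  obtain ⟨B, hB'⟩ : ∃ B, B = 1 - x := ⟨_, rfl⟩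
  obtain ⟨C, hC'⟩ : ∃ C, C = 1 - 3 * x := ⟨_, rfl⟩
  obtain ⟨D, hD'⟩ : ∃ D, D = 1 + 3 * x := ⟨_, rfl⟩
  rw [← hA'] at hA ⊢
  rw [← hB'] 
  rw [← hC'] at hC ⊢
  rw [← hD'] at hD ⊢
  clear e1 e2 e3 e4
  field_simp
  rw [hB', hD']
  ring

section
variable {z : ℂ} (hz : ‖z‖ < 1)
include hz

theorem thetaPhi_quotient_sq : (thetaPhi z / thetaPhi (z ^ 3)) ^ 2 = unitC z / unitA z := by
  have := thetaPhi_ne_zero (norm_pow_lt hz three_ne_zero)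
  rw [div_pow, thetaPhi_ratio hz]
  field_simp

variable (hz0 : z ≠ 0)
include hz0

theorem pedSection_eq : euler (z ^ 3) ^ 2 * euler (z ^ 4) ^ 3 / (euler z ^ 3 * euler (z ^ 12) ^ 2) *
    pedSection z = ratPed (haupt z) := by
  -- The prefactor of L, multiplied by the common theta factor of the section, is a monomial in the
  -- units. This is what makes L itself a function of x.
  have hm : euler (z ^ 3) ^ 2 * euler (z ^ 4) ^ 3 / (euler z ^ 3 * euler (z ^ 12) ^ 2) *
      (thetaA (-z) / thetaPhi (z ^ 3) * ratioY z) = unitB z / (unitA z * unitC z) := by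
    have h1 := euler_ne_zero hz
    have h2 := euler_pow_ne_zero hz (n := 2) (by norm_num)
    have h3 := euler_pow_ne_zero hz (n := 3) (by norm_num)
    have h4 := euler_pow_ne_zero hz (n := 4) (by norm_num)
    have h6 := euler_pow_ne_zero hz (n := 6) (by norm_num)
    have h12 := euler_pow_ne_zero hz (n := 12) (by norm_num)
    rw [thetaA_neg hz]
    simp only [ratioY, thetaOmega, thetaPhi, unitA, unitB, unitC, ← pow_mul, Nat.reduceMul]
    field_simp
  have hA := unitA_ne_zero hz
  have hB := unitB_ne_zero hz
  have hC := unitC_ne_zero hz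
  have h6 : (thetaPhi z / thetaPhi (z ^ 3)) ^ 6 = (unitC z / unitA z) ^ 3 := by
    rw [← thetaPhi_quotient_sq hz]; ring
  rw [pedSection, ← mul_assoc, hm, h6, thetaPhi_quotient_sq hz]
  simp only [pedComp, one_sub_ratioY_cube hz hz0, triComp_one, triComp_three, triComp_seven]
  rw [ratioY_cube hz, ratPed, ← unitA_eq hz, ← unitB_eq hz, ← unitC_eq hz hz0]
  field_simp
  rw [unitA_eq hz, unitB_eq hz, unitC_eq hz hz0]
  ring

theorem pobarSection_eq : euler (z ^ 2) ^ 9 * euler (z ^ 3) ^ 4 * euler (z ^ 12) ^ 2 /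
      (euler z ^ 6 * euler (z ^ 4) ^ 3 * euler (z ^ 6) ^ 6) *
    pobarSection z = ratPobar (haupt z) := by
  have hm : euler (z ^ 2) ^ 9 * euler (z ^ 3) ^ 4 * euler (z ^ 12) ^ 2 /
      (euler z ^ 6 * euler (z ^ 4) ^ 3 * euler (z ^ 6) ^ 6) *
      (thetaPhi (z ^ 6) / thetaPhi (z ^ 3)) = unitD z / unitC z := by
    have h1 := euler_ne_zero hz
    have h2 := euler_pow_ne_zero hz (n := 2) (by norm_num)
    have h3 := euler_pow_ne_zero hz (n := 3) (by norm_num)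
    have h4 := euler_pow_ne_zero hz (n := 4) (by norm_num)
    have h6 := euler_pow_ne_zero hz (n := 6) (by norm_num)
    have h12 := euler_pow_ne_zero hz (n := 12) (by norm_num)
    simp only [thetaPhi, unitD, unitC, ← pow_mul, Nat.reduceMul]
    field_simp
  have hA := unitA_ne_zero hz
  have hB := unitB_ne_zero hz
  have hC := unitC_ne_zero hz
  have h6 : (thetaPhi z / thetaPhi (z ^ 3)) ^ 6 = (unitC z / unitA z) ^ 3 := by
    rw [← thetaPhi_quotient_sq hz]; ring
  rw [pobarSection, ← mul_assoc, hm, h6, thetaPhi_quotient_sq hz]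
  simp only [pobarComp, one_sub_ratioY_cube hz hz0, triComp_one, triComp_three, triComp_seven]
  rw [ratioY_cube hz, ratPobar, ← unitA_eq hz, ← unitC_eq hz hz0, ← unitD_eq hz hz0]
  field_simp
  rw [unitA_eq hz, unitB_eq hz, unitC_eq hz hz0]
  ring

theorem podSection_eq : euler (z ^ 2) ^ 4 * euler (z ^ 4) ^ 5 * euler (z ^ 12) ^ 2 /
      (euler z * euler (z ^ 3) ^ 4 * euler (z ^ 6) ^ 5) *
    (z * podSection z) = ratPod (haupt z) := by
  have hm : euler (z ^ 2) ^ 4 * euler (z ^ 4) ^ 5 * euler (z ^ 12) ^ 2 /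
      (euler z * euler (z ^ 3) ^ 4 * euler (z ^ 6) ^ 5) * (z * ratioB z ^ 2 * (thetaA (-z))⁻¹)
        = haupt z * unitD z / (unitA z ^ 2 * unitB z ^ 3) := by
    have h1 := euler_ne_zero hz
    have h2 := euler_pow_ne_zero hz (n := 2) (by norm_num)
    have h3 := euler_pow_ne_zero hz (n := 3) (by norm_num)
    have h4 := euler_pow_ne_zero hz (n := 4) (by norm_num)
    have h6 := euler_pow_ne_zero hz (n := 6) (by norm_num)
    have h12 := euler_pow_ne_zero hz (n := 12) (by norm_num)
    rw [ratioB, thetaA_neg hz, thetaPsi_neg_cube hz]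
    simp only [haupt, unitA, unitB, unitD]
    field_simp
  have hA := unitA_ne_zero hz
  have hB := unitB_ne_zero hz
  have hC := unitC_ne_zero hz
  have ha : thetaA (-z) ≠ 0 := thetaA_ne_zero (by simpa using hz)
  have h4 : (thetaPsi (-z) / thetaA (-z)) ^ 4 = ratioB z * (unitC z / unitB z ^ 2) := by
    rw [div_pow, thetaPsi_neg_pow_four hz hz0, one_sub_ratioB_cube hz hz0, ratioB]
    field_simp
  have h8 : (thetaPsi (-z) / thetaA (-z)) ^ 8 = (ratioB z * (unitC z / unitB z ^ 2)) ^ 2 := by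
    rw [← h4]; ring
  have h12 : (thetaPsi (-z) / thetaA (-z)) ^ 12 = (ratioB z * (unitC z / unitB z ^ 2)) ^ 3 := by
    rw [← h4]; ring
  have hs := ratioB_cube hz
  have e : z * podSection z = z * ratioB z ^ 2 * (thetaA (-z))⁻¹ *
      ((triComp 1 (z * ratioB z ^ 3)).2.2 / (unitC z / unitB z ^ 2) ^ 1
        + 10 * (unitC z / unitB z ^ 2) * (triComp 5 (z * ratioB z ^ 3)).2.1 /
            (unitC z / unitB z ^ 2) ^ 5
        + 36 * (unitC z / unitB z ^ 2) ^ 2 * (triComp 9 (z * ratioB z ^ 3)).1 /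
            (unitC z / unitB z ^ 2) ^ 9
        + 27 * (unitC z / unitB z ^ 2) ^ 3 * (z * ratioB z ^ 3 *
            (triComp 13 (z * ratioB z ^ 3)).2.2) / (unitC z / unitB z ^ 2) ^ 13) := by
    rw [podSection, h4, h8, h12, one_sub_ratioB_cube hz hz0]
    ring
  rw [e, ← mul_assoc, hm, hs, triComp_one, triComp_five, triComp_nine, triComp_thirteen, ratPod,
    ← unitA_eq hz, ← unitB_eq hz, ← unitC_eq hz hz0, ← unitD_eq hz hz0]
  clear e h4 h8 h12 hs hm
  simp only
  field_simp
  rw [unitA_eq hz, unitB_eq hz, unitC_eq hz hz0]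
  ring

theorem pbarSection_eq : euler (z ^ 2) ^ 19 * euler (z ^ 6) /
      (euler z ^ 6 * euler (z ^ 3) ^ 6 * euler (z ^ 4) ^ 5 * euler (z ^ 12) ^ 2) *
    (pbarSection (z ^ 2) / z) = ratPbar (haupt z) := by
  have hz2 := norm_pow_lt hz two_ne_zero
  have hz02 := pow_ne_zero 2 hz0
  have hA := unitA_ne_zero hz
  have hB := unitB_ne_zero hz
  have hC := unitC_ne_zero hz
  have hD := unitD_ne_zero hz
  have hT : z ^ 2 * ratioY (z ^ 2) ^ 3 = haupt z ^ 2 / (unitA z * unitB z) := by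
    rw [ratioY_sq hz, show z ^ 2 * (unitA z / unitB z * ratioY z ^ 2) ^ 3
      = (unitA z / unitB z) ^ 3 * (z * ratioY z ^ 3) ^ 2 by ring, ratioY_cube hz]
    field_simp
  -- This monomial has a pole at x = 0. It cancels because the section vanishes there: 1 - (27 - 36
  -- + 10) = 0.
  have hm : euler (z ^ 2) ^ 19 * euler (z ^ 6) /
      (euler z ^ 6 * euler (z ^ 3) ^ 6 * euler (z ^ 4) ^ 5 * euler (z ^ 12) ^ 2) *
        ((thetaPhi ((z ^ 2) ^ 3))⁻¹ / z) = unitD z ^ 3 / (haupt z * unitA z ^ 3) := by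
    have h1 := euler_ne_zero hz
    have h2 := euler_pow_ne_zero hz (n := 2) (by norm_num)
    have h3 := euler_pow_ne_zero hz (n := 3) (by norm_num)
    have h4 := euler_pow_ne_zero hz (n := 4) (by norm_num)
    have h6 := euler_pow_ne_zero hz (n := 6) (by norm_num)
    have h12 := euler_pow_ne_zero hz (n := 12) (by norm_num)
    simp only [thetaPhi, haupt, unitA, unitD, ← pow_mul, Nat.reduceMul]
    field_simp
  have h4 : (thetaPhi (z ^ 2) / thetaPhi ((z ^ 2) ^ 3)) ^ 4 = 1 - 8 * (z ^ 2 * ratioY (z ^ 2) ^ 3) := by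
    have := thetaPhi_ne_zero (norm_pow_lt hz2 three_ne_zero)
    rw [div_pow, thetaPhi_pow_four hz2 hz02, mul_div_assoc, div_self (pow_ne_zero 4 this), mul_one]
  have h8 : (thetaPhi (z ^ 2) / thetaPhi ((z ^ 2) ^ 3)) ^ 8 = (1 - 8 * (z ^ 2 * ratioY (z ^ 2) ^ 3)) ^ 2 := by
    rw [← h4]; ring
  have h12 : (thetaPhi (z ^ 2) / thetaPhi ((z ^ 2) ^ 3)) ^ 12
      = (1 - 8 * (z ^ 2 * ratioY (z ^ 2) ^ 3)) ^ 3 := by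
    rw [← h4]; ring
  have hn : 1 - 8 * (z ^ 2 * ratioY (z ^ 2) ^ 3) = unitC z * unitD z / (unitA z * unitB z) := by
    rw [hT, eq_div_iff (mul_ne_zero hA hB), unitA_eq hz, unitB_eq hz, unitC_eq hz hz0, unitD_eq hz hz0]
    rw [unitA_eq hz, ] at hA
    rw [unitB_eq hz] at hB
    field_simp
    ring
  have hx : haupt z ≠ 0 := mul_ne_zero hz0 (div_ne_zero
    (mul_ne_zero (pow_ne_zero 2 (euler_pow_ne_zero hz two_ne_zero))
      (pow_ne_zero 4 (euler_pow_ne_zero hz (n := 12) (by norm_num))))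
    (mul_ne_zero (pow_ne_zero 4 (euler_pow_ne_zero hz (n := 4) (by norm_num)))
      (pow_ne_zero 2 (euler_pow_ne_zero hz (n := 6) (by norm_num)))))
  rw [pbarSection, mul_div_right_comm (_⁻¹), ← mul_assoc, hm, h4, h8, h12, hn, hT, triComp_one, triComp_five,
    triComp_nine, triComp_thirteen, ratPbar, ← unitA_eq hz, ← unitB_eq hz, ← unitC_eq hz hz0,
    ← unitD_eq hz hz0]
  clear h4 h8 h12 hn hT hm
  simp only
  field_simp
  rw [unitA_eq hz, unitB_eq hz, unitC_eq hz hz0, unitD_eq hz hz0]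
  ring

end

theorem Lped_eq_ratPed (τ : ℍ) : Lped τ = ratPed (haupt (q τ)) := by
  rw [Lped_eq, pedSection_eq (norm_q_lt_one τ) (q_ne_zero τ)]

theorem Lpobar_eq_ratPobar (τ : ℍ) : Lpobar τ = ratPobar (haupt (q τ)) := by
  rw [Lpobar_eq, pobarSection_eq (norm_q_lt_one τ) (q_ne_zero τ)]

theorem Lpod_eq_ratPod (τ : ℍ) : Lpod τ = ratPod (haupt (q τ)) := by
  rw [Lpod_eq, podSection_eq (norm_q_lt_one τ) (q_ne_zero τ)]

theorem Lpbar_eq_ratPbar (τ : ℍ) : Lpbar τ = ratPbar (haupt (q τ)) := by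
  rw [Lpbar_eq, pbarSection_eq (norm_q_lt_one τ) (q_ne_zero τ)]


/-! ### Modularity of `haupt` -/

/-- The square of `q^{1/8} ψ(q)`, as an eta quotient. -/
def etaPsi (w : ℂ) : ℂ := ModularForm.eta (2 * w) ^ 4 / ModularForm.eta w ^ 2

/-- The square of `φ(-e^{πiw})`, as an eta quotient. -/
def etaPhiNeg (w : ℂ) : ℂ := ModularForm.eta (w / 2) ^ 4 / ModularForm.eta w ^ 2

/-- The square of `φ(e^{πiw})`, as an eta quotient. -/
def etaPhi (w : ℂ) : ℂ := ModularForm.eta w ^ 10 /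
  (ModularForm.eta (w / 2) ^ 4 * ModularForm.eta (2 * w) ^ 4)

theorem csqrt_sq {z : ℂ} (hz : z ≠ 0) : Complex.sqrt z ^ 2 = z := by
  rw [sqrt_eq_exp hz, ← Complex.exp_nat_mul]
  push_cast
  rw [mul_div_cancel₀ _ two_ne_zero, Complex.exp_log hz]

/-- Squaring removes the choice of square root from the inversion formula; the eta quotients below
involve only even powers of η. -/
theorem eta_neg_inv_sq {w : ℂ} (hw : 0 < w.im) :
    ModularForm.eta (-1 / w) ^ 2 = -Complex.I * w * ModularForm.eta w ^ 2 := by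
  have h := ModularForm.eta_comp_eq_csqrt_I_inv hw
  have h' : ModularForm.eta (-1 / w) = (Complex.sqrt Complex.I)⁻¹ * (Complex.sqrt w * ModularForm.eta w) := by
    simpa using h
  have hw0 : w ≠ 0 := by rintro rfl; simp at hw
  rw [h', mul_pow, mul_pow, inv_pow, csqrt_sq hw0, csqrt_sq Complex.I_ne_zero, Complex.inv_I, mul_assoc]

theorem im_neg_inv {w : ℂ} (hw : 0 < w.im) : 0 < (-1 / w).im := by
  have h0 : 0 < Complex.normSq w := Complex.normSq_pos.2 (by rintro rfl; simp at hw)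
  rw [neg_div, one_div, Complex.neg_im, Complex.inv_im, neg_div, neg_neg]
  positivity

theorem etaPsi_neg_inv {w : ℂ} (hw : 0 < w.im) :
    etaPsi (-1 / w) = -(Complex.I / 4) * w * etaPhiNeg w := by
  have hw0 : w ≠ 0 := by rintro rfl; simp at hw
  have h2 : 0 < (w / 2).im := by simpa using hw
  have e : ModularForm.eta (2 * (-1 / w)) ^ 4 = (-Complex.I * (w / 2) * ModularForm.eta (w / 2) ^ 2) ^ 2 := by
    rw [← eta_neg_inv_sq h2, ← pow_mul, show 2 * (-1 / w) = -1 / (w / 2) by field_simp]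
  have hη := ModularForm.eta_ne_zero hw
  rw [etaPsi, etaPhiNeg, e, eta_neg_inv_sq hw]
  have := Complex.I_ne_zero
  field_simp
  ring

theorem etaPhi_neg_inv {w : ℂ} (hw : 0 < w.im) :
    etaPhi (-1 / w) = -Complex.I * w * etaPhi w := by
  have hw0 : w ≠ 0 := by rintro rfl; simp at hw
  have h2 : 0 < (w / 2).im := by simpa using hw
  have h2' : 0 < (2 * w).im := by simpa using hw
  have e : ModularForm.eta (2 * (-1 / w)) ^ 4 = (-Complex.I * (w / 2) * ModularForm.eta (w / 2) ^ 2) ^ 2 := by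
    rw [← eta_neg_inv_sq h2, ← pow_mul, show 2 * (-1 / w) = -1 / (w / 2) by field_simp]
  have e' : ModularForm.eta (-1 / w / 2) ^ 4 = (-Complex.I * (2 * w) * ModularForm.eta (2 * w) ^ 2) ^ 2 := by
    rw [← eta_neg_inv_sq h2', ← pow_mul, show -1 / w / 2 = -1 / (2 * w) by field_simp]
  have e1 : ModularForm.eta (-1 / w) ^ 10 = (-Complex.I * w * ModularForm.eta w ^ 2) ^ 5 := by
    rw [← eta_neg_inv_sq hw, ← pow_mul]
  have hη := ModularForm.eta_ne_zero hw
  have hη2 := ModularForm.eta_ne_zero h2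
  have hη2' := ModularForm.eta_ne_zero h2'
  rw [etaPhi, etaPhi, e, e', e1]
  have := Complex.I_ne_zero
  field_simp

/-- The nome `e^{πiw}` of `w / 2`. -/
def halfNome (w : ℂ) : ℂ := Complex.exp (Real.pi * Complex.I * w)

theorem eta_eq_euler (z : ℂ) : ModularForm.eta z =
    Complex.exp (2 * Real.pi * Complex.I * z / 24) * euler (Complex.exp (2 * Real.pi * Complex.I * z)) := by
  rw [ModularForm.eta, euler]
  congr 1
  exact tprod_congr fun n => by rw [ModularForm.eta_q_eq_pow]

theorem norm_halfNome_lt_one {w : ℂ} (hw : 0 < w.im) : ‖halfNome w‖ < 1 := by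
  rw [halfNome, Complex.norm_exp]
  simp [mul_assoc, Real.pi_pos, hw]

theorem halfNome_add_one (w : ℂ) : halfNome (w + 1) = -halfNome w := by
  rw [halfNome, mul_add, Complex.exp_add, mul_one, Complex.exp_pi_mul_I, halfNome]; ring

theorem halfNome_sub_one (w : ℂ) : halfNome (w - 1) = -halfNome w := by
  have := halfNome_add_one (w - 1)
  rw [sub_add_cancel] at this
  rw [this, neg_neg]

theorem exists_eta_eq_halfNome (w : ℂ) : ∃ ε : ℂ, ε ≠ 0 ∧ ε ^ 24 = halfNome w ∧
    ModularForm.eta (w / 2) = ε * euler (halfNome w) ∧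
    ModularForm.eta w = ε ^ 2 * euler (halfNome w ^ 2) ∧
    ModularForm.eta (2 * w) = ε ^ 4 * euler (halfNome w ^ 4) := by
  refine ⟨Complex.exp (Real.pi * Complex.I * w / 24), Complex.exp_ne_zero _, ?_, ?_, ?_, ?_⟩
  · rw [halfNome, ← Complex.exp_nat_mul]; congr 1; push_cast; ring
  · rw [eta_eq_euler, halfNome]
    congr 1 <;> ring_nf
  · rw [eta_eq_euler, halfNome, ← Complex.exp_nat_mul, ← Complex.exp_nat_mul]
    congr 3 <;> (push_cast; ring)
  · rw [eta_eq_euler, halfNome, ← Complex.exp_nat_mul, ← Complex.exp_nat_mul]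
    congr 3 <;> (push_cast; ring)

theorem etaPhiNeg_eq {w : ℂ} (hw : 0 < w.im) : etaPhiNeg w = thetaPhi (halfNome w) ^ 2 := by
  obtain ⟨ε, hε, h, e1, e2, e4⟩ := exists_eta_eq_halfNome w
  have hz := norm_halfNome_lt_one hw
  have h1 := euler_ne_zero hz
  have h2 := euler_pow_ne_zero hz (n := 2) (by norm_num)
  rw [etaPhiNeg, e1, e2, thetaPhi]
  field_simp

theorem etaPhi_eq {w : ℂ} (hw : 0 < w.im) : etaPhi w = thetaPhi (-halfNome w) ^ 2 := by
  obtain ⟨ε, hε, h, e1, e2, e4⟩ := exists_eta_eq_halfNome w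
  have hz := norm_halfNome_lt_one hw
  have h1 := euler_ne_zero hz
  have h2 := euler_pow_ne_zero hz (n := 2) (by norm_num)
  have h4 := euler_pow_ne_zero hz (n := 4) (by norm_num)
  rw [etaPhi, e1, e2, e4, thetaPhi, euler_neg hz, Even.neg_pow (by decide)]
  field_simp

theorem etaPhiNeg_sub_one {w : ℂ} (hw : 0 < w.im) : etaPhiNeg (w - 1) = etaPhi w := by
  rw [etaPhiNeg_eq (by simpa using hw), etaPhi_eq hw, halfNome_sub_one]

theorem etaPhiNeg_sub_two {w : ℂ} (hw : 0 < w.im) : etaPhiNeg (w - 2) = etaPhiNeg w := by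
  rw [show w - 2 = w - 1 - 1 by ring, etaPhiNeg_eq (by simpa using hw), etaPhiNeg_eq hw,
    halfNome_sub_one, halfNome_sub_one, neg_neg]

theorem eta_add_one (z : ℂ) :
    ModularForm.eta (z + 1) = Complex.exp (2 * Real.pi * Complex.I / 24) * ModularForm.eta z := by
  rw [eta_eq_euler, eta_eq_euler, mul_add, mul_one, Complex.exp_add, Complex.exp_two_pi_mul_I, mul_one,
    add_div, Complex.exp_add]
  ring

/-- The leading power of the nome is 1/4, so translation by 2 contributes e^(πi). -/
theorem etaPsi_add_two (w : ℂ) : etaPsi (w + 2) = -etaPsi w := by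
  have h : Complex.exp (2 * Real.pi * Complex.I / 24) ^ 12 = -1 := by
    rw [← Complex.exp_nat_mul, ← Complex.exp_pi_mul_I]; congr 1; push_cast; ring
  have h0 := Complex.exp_ne_zero (2 * Real.pi * Complex.I / 24)
  rw [etaPsi, etaPsi, show 2 * (w + 2) = 2 * w + 1 + 1 + 1 + 1 by ring, show w + 2 = w + 1 + 1 by ring]
  simp only [eta_add_one]
  generalize Complex.exp (2 * Real.pi * Complex.I / 24) = ε at *
  rcases eq_or_ne (ModularForm.eta w) 0 with h1 | h1
  · simp [h1]
  field_simp
  linear_combination ModularForm.eta (2 * w) ^ 4 * h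

theorem etaPsi_add_two_mul (w : ℂ) (k : ℤ) : etaPsi (w + 2 * k) = (-1) ^ k * etaPsi w := by
  induction k with
  | zero => simp
  | succ i ih =>
    have := etaPsi_add_two (w + 2 * (i : ℤ))
    rw [ih, show w + 2 * ((i : ℤ) : ℂ) + 2 = w + 2 * ((i + 1 : ℤ) : ℂ) by push_cast; ring] at this
    rw [this, zpow_add₀ (by norm_num)]; simp
  | pred i ih =>
    have := etaPsi_add_two (w + 2 * ((-i - 1 : ℤ) : ℂ))
    rw [show w + 2 * ((-i - 1 : ℤ) : ℂ) + 2 = w + 2 * ((-i : ℤ) : ℂ) by push_cast; ring, ih] at this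
    rw [← neg_eq_iff_eq_neg.2 this, zpow_sub₀ (by norm_num), zpow_one]; ring

/-- The map is translation by -2 conjugated by w ↦ -1/w. Inversion takes `etaPsi` to `etaPhiNeg`,
which is invariant under that translation. -/
theorem etaPsi_div {w : ℂ} (hw : 0 < w.im) : etaPsi (w / (2 * w + 1)) = (2 * w + 1) * etaPsi w := by
  have hw0 : w ≠ 0 := by rintro rfl; simp at hw
  have hu := im_neg_inv hw
  have hu2 : 0 < (-1 / w - 2).im := by simpa using hu
  have h1 := etaPsi_neg_inv hu
  have h2 := etaPsi_neg_inv hu2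
  rw [etaPhiNeg_sub_two hu] at h2
  have e1 : -1 / (-1 / w) = w := by field_simp
  have e2 : -1 / (-1 / w - 2) = w / (2 * w + 1) := by
    rw [show -1 / w - 2 = -((2 * w + 1) / w) by field_simp; ring, div_neg, neg_div, neg_neg, one_div_div]
  rw [e1] at h1
  rw [e2] at h2
  rw [h1, h2]
  field_simp
  ring

theorem im_div_of_det {a b c d : ℤ} (h : a * d - b * c = 1) {w : ℂ} (hw : 0 < w.im) :
    (c : ℂ) * w + d ≠ 0 ∧ 0 < ((a * w + b) / (c * w + d)).im := by
  have h0 : (c : ℂ) * w + d ≠ 0 := by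
    intro h0
    have hi := congr_arg Complex.im h0
    simp only [Complex.add_im, Complex.mul_im, Complex.intCast_re, Complex.intCast_im, zero_mul,
      add_zero, Complex.zero_im, mul_eq_zero, hw.ne', or_false] at hi
    have hc : c = 0 := by exact_mod_cast hi
    rw [hc] at h0
    have hd : d = 0 := by simpa using h0
    rw [hc, hd] at h
    simp at h
  refine ⟨h0, ?_⟩
  have hn : 0 < Complex.normSq (c * w + d) := Complex.normSq_pos.2 h0
  have h' : (a : ℝ) * d - b * c = 1 := by exact_mod_cast h
  rw [Complex.div_im, ← sub_div]
  refine div_pos ?_ hn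
  simp only [Complex.add_im, Complex.add_re, Complex.mul_im, Complex.mul_re, Complex.intCast_re,
    Complex.intCast_im, zero_mul, add_zero, sub_zero]
  have : a * w.im * (c * w.re + d) - (a * w.re + b) * (c * w.im) = (a * d - b * c : ℝ) * w.im := by ring
  rw [this, h', one_mul]
  exact hw

/-- Euclidean algorithm on the first column, by induction on |a| + |c|: since a is odd and c even,
|a| ≠ |c|, and adding ±2 times the smaller entry to the larger shrinks it. These moves are
translations by ±2 and their lower triangular analogues, covered by `etaPsi_add_two_mul` and
`etaPsi_div`. The algorithm ends at c = 0, a = d = ±1. -/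
theorem etaPsi_moebius {a b c d : ℤ} (h : a * d - b * c = 1) (hb : Even b) (hc : Even c) {w : ℂ} (hw : 0 < w.im) :
    etaPsi ((a * w + b) / (c * w + d)) = Complex.I ^ (b + d - 1) * (c * w + d) * etaPsi w := by
  obtain ⟨n, hn⟩ : ∃ n : ℕ, a.natAbs + c.natAbs ≤ n := ⟨_, le_rfl⟩
  induction n generalizing a b c d with
  | zero =>
    have ha : a = 0 := by omega
    have hc : c = 0 := by omega
    simp [ha, hc] at h
  | succ n ih =>
    have hI := Complex.I_ne_zero
    have hI2 : Complex.I ^ (2 : ℤ) = -1 := by rw [← Complex.I_sq]; exact zpow_natCast _ 2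
    have hao : Odd a := by
      by_contra ha
      rw [Int.not_odd_iff_even] at ha
      have : Even (1 : ℤ) := h ▸ (ha.mul_right d).sub (hc.mul_left b)
      exact absurd this (by decide)
    have hdo : Odd d := by
      by_contra ha
      rw [Int.not_odd_iff_even] at ha
      have : Even (1 : ℤ) := h ▸ (ha.mul_left a).sub (hc.mul_left b)
      exact absurd this (by decide)
    obtain ⟨h0, him⟩ := im_div_of_det h hw
    rcases eq_or_ne c 0 with rfl | hc0
    · have had : a * d = 1 := by simpa using h
      obtain ⟨k, rfl⟩ := hb
      rcases Int.eq_one_or_neg_one_of_mul_eq_one' had with ⟨rfl, rfl⟩ | ⟨rfl, rfl⟩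
      · have e := etaPsi_add_two_mul w k
        rw [show k + k + 1 - 1 = 2 * k by ring, zpow_mul, hI2]
        push_cast
        rw [show (1 * w + (k + k)) / (0 * w + 1 : ℂ) = w + 2 * k by ring, e]
        ring
      · have e := etaPsi_add_two_mul w (-k)
        rw [show k + k + -1 - 1 = 2 * (k - 1) by ring, zpow_mul, hI2, zpow_sub₀ (by norm_num)]
        push_cast at e ⊢
        rw [show (-1 * w + (k + k)) / (0 * w + -1 : ℂ) = w + 2 * -k by ring, e, zpow_neg, ← inv_zpow]
        norm_num
        ring
    rcases lt_or_ge c.natAbs a.natAbs with hlt | hge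
    · obtain ⟨ε, hε, hε'⟩ : ∃ ε : ℤ, (ε = 1 ∨ ε = -1) ∧ (a - 2 * ε * c).natAbs < a.natAbs := by
        rcases le_total 0 a with h1 | h1 <;> rcases le_total 0 c with h2 | h2
        · exact ⟨1, by simp, by omega⟩
        · exact ⟨-1, by simp, by omega⟩
        · exact ⟨-1, by simp, by omega⟩
        · exact ⟨1, by simp, by omega⟩
      have := ih (a := a - 2 * ε * c) (b := b - 2 * ε * d) (c := c) (d := d) (by linear_combination h)
        (hb.sub ⟨ε * d, by ring⟩) hc (by omega)
      have e := etaPsi_add_two_mul ((↑(a - 2 * ε * c) * w + ↑(b - 2 * ε * d)) / (c * w + d)) ε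
      rw [this, show (↑(a - 2 * ε * c) * w + ↑(b - 2 * ε * d)) / (c * w + d) + 2 * (ε : ℂ)
        = (a * w + b) / (c * w + d) by push_cast; field_simp; ring] at e
      rw [e, show b + d - 1 = (b - 2 * ε * d + d - 1) + 2 * (ε * d) by ring, zpow_add₀ hI, zpow_mul, hI2]
      have : (-1 : ℂ) ^ (ε * d) = (-1) ^ ε := by
        rcases hε with rfl | rfl
        · rw [one_mul, zpow_one, hdo.neg_one_zpow]
        · rw [neg_one_mul, (hdo.neg).neg_one_zpow, (show Odd (-1 : ℤ) by decide).neg_one_zpow]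
      rw [this]
      ring
    · have hne : c.natAbs ≠ a.natAbs := by
        intro hne
        obtain ⟨k, hk⟩ := hao
        obtain ⟨l, hl⟩ := hc
        omega
      have ha0 : a ≠ 0 := by rintro rfl; exact absurd hao (by decide)
      obtain ⟨ε, hε, hε'⟩ : ∃ ε : ℤ, (ε = 1 ∨ ε = -1) ∧ (c - 2 * ε * a).natAbs < c.natAbs := by
        rcases le_total 0 a with h1 | h1 <;> rcases le_total 0 c with h2 | h2
        · exact ⟨1, by simp, by omega⟩
        · exact ⟨-1, by simp, by omega⟩
        · exact ⟨-1, by simp, by omega⟩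
        · exact ⟨1, by simp, by omega⟩
      have hdet : a * (d - 2 * ε * b) - b * (c - 2 * ε * a) = 1 := by linear_combination h
      have := ih (a := a) (b := b) (c := c - 2 * ε * a) (d := d - 2 * ε * b) hdet
        hb (hc.sub ⟨ε * a, by ring⟩) (by omega)
      obtain ⟨h0', him'⟩ := im_div_of_det hdet hw
      -- The exponent changes by a multiple of 4 because b is even.
      have hbI : Complex.I ^ (b + (d - 2 * ε * b) - 1) = Complex.I ^ (b + d - 1) := by
        obtain ⟨k, rfl⟩ := hb
        have h4 : Complex.I ^ (4 : ℤ) = 1 := by rw [← Complex.I_pow_four]; exact zpow_natCast _ 4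
        rw [show k + k + (d - 2 * ε * (k + k)) - 1 = k + k + d - 1 + 4 * (-ε * k) by ring, zpow_add₀ hI,
          zpow_mul, h4, one_zpow, mul_one]
      rw [hbI] at this
      -- `etaPsi_div` only covers the step +2. For ε = 1 it leads from the reduced point to the
      -- original one; for ε = -1 it leads from the original to the reduced, and the factor is
      -- cancelled.
      rcases hε with rfl | rfl
      · have e := etaPsi_div him'
        rw [this] at e
        have hE : (c : ℂ) * w + d = ↑(c - 2 * 1 * a) * w + ↑(d - 2 * 1 * b) + 2 * (a * w + b) := by
          push_cast; ring
        rw [hE] at h0 ⊢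
        generalize (↑(c - 2 * 1 * a) : ℂ) * w + ↑(d - 2 * 1 * b) = E at *
        generalize (a : ℂ) * w + b = N at *
        rw [show N / (E + 2 * N) = N / E / (2 * (N / E) + 1) by
          rw [add_comm E]; field_simp, e]
        field_simp
        ring
      · have e := etaPsi_div him
        have hE : (↑(c - 2 * -1 * a) : ℂ) * w + ↑(d - 2 * -1 * b) = c * w + d + 2 * (a * w + b) := by
          push_cast; ring
        rw [hE] at this h0'
        generalize (c : ℂ) * w + d = E at *
        generalize (a : ℂ) * w + b = N at *
        rw [show N / E / (2 * (N / E) + 1) = N / (E + 2 * N) by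
          rw [add_comm E]; field_simp, this] at e
        have h2 : 2 * (N / E) + 1 ≠ 0 := by
          rw [show 2 * (N / E) + 1 = (E + 2 * N) / E by field_simp; ring]
          exact div_ne_zero h0' h0
        refine mul_left_cancel₀ h2 (e.symm.trans ?_)
        field_simp
        ring

/-- `haupt` as an eta quotient on the upper half-plane. -/
theorem haupt_q_eq (τ : ℍ) : haupt (q τ) = etaPsi (6 * τ) / etaPsi (2 * τ) := by
  have e6 := e_eq 6 τ
  have e12 := e_eq 12 τ
  have e2 := e_eq 2 τ
  have e4 := e_eq 4 τ
  have h2 := euler_pow_ne_zero (norm_q_lt_one τ) (n := 2) (by norm_num)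
  have h4 := euler_pow_ne_zero (norm_q_lt_one τ) (n := 4) (by norm_num)
  have h6 := euler_pow_ne_zero (norm_q_lt_one τ) (n := 6) (by norm_num)
  simp only [e, Nat.cast_ofNat] at e2 e4 e6 e12
  rw [etaPsi, etaPsi, ← mul_assoc, ← mul_assoc, show (2 : ℂ) * 6 = 12 by norm_num,
    show (2 : ℂ) * 2 = 4 by norm_num, e2, e4, e6, e12, haupt]
  have hq := q_pow_eq τ
  have hε := Complex.exp_ne_zero (2 * Real.pi * Complex.I * τ / 24)
  generalize q τ = u at *
  generalize euler (u ^ 2) = a2 at *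
  generalize euler (u ^ 4) = a4 at *
  generalize euler (u ^ 6) = a6 at *
  generalize euler (u ^ 12) = a12 at *
  subst hq
  field_simp

theorem haupt_q_smul {g : SL(2, ℤ)} (hg : g ∈ CongruenceSubgroup.Gamma0 12) (τ : ℍ) :
    haupt (q (g • τ)) = haupt (q τ) := by
  obtain ⟨k, hk⟩ : (12 : ℤ) ∣ g 1 0 :=
    (ZMod.intCast_zmod_eq_zero_iff_dvd _ 12).1 (CongruenceSubgroup.Gamma0_mem.1 hg)
  have hdet : g 0 0 * g 1 1 - g 0 1 * g 1 0 = 1 := by rw [← Matrix.det_fin_two, g.det_coe]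
  rw [hk] at hdet
  rw [haupt_q_eq, haupt_q_eq, UpperHalfPlane.coe_specialLinearGroup_apply]
  simp only [algebraMap_int_eq, eq_intCast, Complex.ofReal_intCast, hk]
  generalize g 0 0 = a at *
  generalize g 0 1 = b at *
  generalize g 1 1 = d at *
  have h0 : ((12 * k : ℤ) : ℂ) * τ + d ≠ 0 := (im_div_of_det hdet τ.im_pos).1
  -- Conjugating by multiplication by 6 and by 2 moves powers of 2 and 3 from c = 12k to b, so both
  -- matrices have even off-diagonal entries. The weight factors coincide, and the characters agree
  -- because 6b and 2b differ by 4b.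
  have e6 := etaPsi_moebius (a := a) (b := 6 * b) (c := 2 * k) (d := d) (by linear_combination hdet)
    ⟨3 * b, by ring⟩ ⟨k, by ring⟩ (w := 6 * τ) (by simpa using τ.im_pos)
  have e2 := etaPsi_moebius (a := a) (b := 2 * b) (c := 6 * k) (d := d) (by linear_combination hdet)
    ⟨b, by ring⟩ ⟨3 * k, by ring⟩ (w := 2 * τ) (by simpa using τ.im_pos)
  push_cast at e6 e2 h0 ⊢
  rw [show (2 * k * (6 * τ) + d : ℂ) = 12 * k * τ + d by ring,
    show (a * (6 * τ) + 6 * b : ℂ) = 6 * (a * τ + b) by ring, mul_div_assoc] at e6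
  rw [show (6 * k * (2 * τ) + d : ℂ) = 12 * k * τ + d by ring,
    show (a * (2 * τ) + 2 * b : ℂ) = 2 * (a * τ + b) by ring, mul_div_assoc] at e2
  have hI : Complex.I ^ (6 * b + d - 1) = Complex.I ^ (2 * b + d - 1) := by
    have h4 : Complex.I ^ (4 : ℤ) = 1 := by rw [← Complex.I_pow_four]; exact zpow_natCast _ 4
    rw [show 6 * b + d - 1 = 2 * b + d - 1 + 4 * b by ring, zpow_add₀ Complex.I_ne_zero, zpow_mul, h4,
      one_zpow, mul_one]
  rw [e6, e2, hI, mul_div_mul_left _ _ (mul_ne_zero (zpow_ne_zero _ Complex.I_ne_zero) h0)]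

/-! ### The substitution τ ↦ τ/(6τ + 1) and the matrix γ -/

/-- As in `etaPsi_div`, but the conjugated translation is now odd, and it exchanges φ(-e^(πiw)) with
φ(e^(πiw)). -/
theorem etaPsi_div_odd {n : ℂ} (hn : n = 1 ∨ n = 3) {w : ℂ} (hw : 0 < w.im) :
    etaPsi (w / (n * w + 1)) = (n * w + 1) / 4 * etaPhi w := by
  have hw0 : w ≠ 0 := by rintro rfl; simp at hw
  have hu := im_neg_inv hw
  have hni : n.im = 0 := by rcases hn with rfl | rfl <;> simp
  have hun : 0 < (-1 / w - n).im := by simpa [hni] using hu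
  have h := etaPsi_neg_inv hun
  have hΘ : etaPhiNeg (-1 / w - n) = -Complex.I * w * etaPhi w := by
    rw [← etaPhi_neg_inv hw]
    rcases hn with rfl | rfl
    · exact etaPhiNeg_sub_one hu
    · rw [show -1 / w - 3 = -1 / w - 1 - 2 by ring, etaPhiNeg_sub_two (by simpa using hu),
        etaPhiNeg_sub_one hu]
  have e : -1 / w - n = -((n * w + 1) / w) := by field_simp; ring
  rw [hΘ, e, div_neg, neg_div, neg_neg, one_div_div] at h
  rw [h]
  field_simp
  linear_combination (-(n * w + 1) * etaPhi w) * Complex.I_sq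

/-- In x = `etaPsi (6σ) / etaPsi (2σ)` the two arguments are w/(w + 1) with w = 6τ and w/(3w + 1)
with w = 2τ. The factors (6τ + 1)/4 cancel, leaving φ(q³)²/φ(q)², which is B/D by `thetaPhi_ratio`
at -q. -/
theorem haupt_q_div {τ σ : ℍ} (h : (σ : ℂ) = τ / (6 * τ + 1)) :
    haupt (q σ) = (1 - haupt (q τ)) / (1 + 3 * haupt (q τ)) := by
  have hz := norm_q_lt_one τ
  have hn : ‖-q τ‖ < 1 := by simpa using hz
  have h6 : 0 < (6 * (τ : ℂ)).im := by simpa using τ.im_pos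
  have h2 : 0 < (2 * (τ : ℂ)).im := by simpa using τ.im_pos
  have e6 := etaPsi_div_odd (Or.inl rfl) h6
  have e2 := etaPsi_div_odd (Or.inr rfl) h2
  have hne : (6 * (τ : ℂ) + 1) ≠ 0 := by
    simpa using (im_div_of_det (a := 1) (b := 0) (c := 6) (d := 1) (by norm_num) τ.im_pos).1
  have n6 : halfNome (6 * τ) = q τ ^ 3 := by
    rw [halfNome, q, ← Complex.exp_nat_mul]; congr 1; push_cast; ring
  have n2 : halfNome (2 * τ) = q τ := by
    rw [halfNome, q]; congr 1; ring
  have hA := unitB_ne_zero hz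
  have hD := unitD_ne_zero hz
  have hX : thetaPhi ((-q τ) ^ 3) ≠ 0 := thetaPhi_ne_zero (norm_pow_lt hn three_ne_zero)
  rw [haupt_q_eq, h, ← mul_div_assoc, ← mul_div_assoc]
  rw [one_mul, etaPhi_eq h6, n6] at e6
  rw [show (3 : ℂ) * (2 * τ) = 6 * τ by ring, etaPhi_eq h2, n2, thetaPhi_ratio hn, unitC_neg hz,
    unitA_neg hz] at e2
  rw [e6, e2, ← unitB_eq hz, ← unitD_eq hz (q_ne_zero τ), Odd.neg_pow (by decide)]
  rw [Odd.neg_pow (by decide)] at hX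
  field_simp

theorem gamma_eq : ((gamma : GL (Fin 2) ℝ) : Matrix (Fin 2) (Fin 2) ℝ) = !![46, 28; 36, 22] := by
  have hν : ((nu : GL (Fin 2) ℝ) : Matrix (Fin 2) (Fin 2) ℝ) = !![1, 1 / 2; 0, 1] := rfl
  have hW : ((W : GL (Fin 2) ℝ) : Matrix (Fin 2) (Fin 2) ℝ) = !![28, 3; 36, 4] := rfl
  rw [gamma, Units.val_mul, Units.val_mul, hν, hW, Matrix.mul_fin_two, Matrix.mul_fin_two]
  norm_num

theorem coe_gamma_smul (τ : ℍ) : ((gamma • τ : ℍ) : ℂ) = (46 * τ + 28) / (36 * τ + 22) := by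
  have hdet : 0 < gamma.det.val := by
    rw [Matrix.GeneralLinearGroup.val_det_apply, gamma_eq, Matrix.det_fin_two_of]; norm_num
  rw [UpperHalfPlane.coe_smul_of_det_pos hdet, UpperHalfPlane.num, UpperHalfPlane.denom, gamma_eq]
  simp

/-- The matrix `γ` acts as an element of `Γ₀(12)` times the matrix of `τ ↦ τ / (6τ + 1)`. -/
theorem haupt_q_gamma (τ : ℍ) :
    haupt (q (gamma • τ)) = (1 - haupt (q τ)) / (1 + 3 * haupt (q τ)) := by
  let V : SL(2, ℤ) := ⟨!![1, 0; 6, 1], by simp [Matrix.det_fin_two_of]⟩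
  -- The product of G and V has rows (23, 14) and (18, 11), which is γ/2.
  let G : SL(2, ℤ) := ⟨!![-61, 14; -48, 11], by simp [Matrix.det_fin_two_of]⟩
  have hV : ((V • τ : ℍ) : ℂ) = τ / (6 * τ + 1) := by
    rw [UpperHalfPlane.coe_specialLinearGroup_apply]; simp [V]
  have hG : G ∈ CongruenceSubgroup.Gamma0 12 := by
    rw [CongruenceSubgroup.Gamma0_mem]
    simp only [G]
    decide
  have h : gamma • τ = G • V • τ := by
    refine UpperHalfPlane.ext ?_
    have h1 : 6 * (τ : ℂ) + 1 ≠ 0 := by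
      simpa using (im_div_of_det (a := 1) (b := 0) (c := 6) (d := 1) (by norm_num) τ.im_pos).1
    rw [coe_gamma_smul, UpperHalfPlane.coe_specialLinearGroup_apply, hV]
    simp only [G, algebraMap_int_eq, Matrix.of_apply, Matrix.cons_val', Matrix.cons_val_zero,
      Matrix.cons_val_one, Matrix.cons_val_fin_one, eq_intCast, Int.cast_neg, Int.cast_ofNat,
      Complex.ofReal_neg, Complex.ofReal_ofNat]
    rw [show 36 * (τ : ℂ) + 22 = 2 * (18 * τ + 11) by ring,
      show -48 * ((τ : ℂ) / (6 * τ + 1)) + 11 = (18 * τ + 11) / (6 * τ + 1) by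
        rw [eq_div_iff h1, add_mul, mul_assoc, div_mul_cancel₀ _ h1]; ring,
      show -61 * ((τ : ℂ) / (6 * τ + 1)) + 14 = (23 * τ + 14) / (6 * τ + 1) by
        rw [eq_div_iff h1, add_mul, mul_assoc, div_mul_cancel₀ _ h1]; ring,
      div_div_div_cancel_right₀ h1, show 46 * (τ : ℂ) + 28 = 2 * (23 * τ + 14) by ring,
      mul_div_mul_left _ _ two_ne_zero]
  rw [h, haupt_q_smul hG, haupt_q_div hV]


/-! ### Growth at the cusps -/

/-- `h` grows at most exponentially in `im τ`, uniformly for `im τ ≥ 1`. -/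
def ModerateGrowth {E : Type*} [Norm E] (h : ℍ → E) : Prop :=
  ∃ (K : ℕ) (C : ℝ), ∀ τ : ℍ, 1 ≤ τ.im → ‖h τ‖ ≤ C * Real.exp (K * τ.im)

namespace ModerateGrowth

theorem const {E : Type*} [Norm E] (c : E) : ModerateGrowth fun _ => c :=
  ⟨0, ‖c‖, fun τ _ => by simp⟩

section
variable {𝕜 : Type*} [NormedField 𝕜] {h k : ℍ → 𝕜}

theorem mul (hh : ModerateGrowth h) (hk : ModerateGrowth k) : ModerateGrowth fun τ => h τ * k τ := by
  obtain ⟨K, C, hC⟩ := hh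
  obtain ⟨L, D, hD⟩ := hk
  refine ⟨K + L, C * D, fun τ hτ => ?_⟩
  rw [norm_mul, Nat.cast_add, add_mul, Real.exp_add, mul_mul_mul_comm]
  exact mul_le_mul (hC τ hτ) (hD τ hτ) (norm_nonneg _) ((norm_nonneg _).trans (hC τ hτ))

theorem pow (hh : ModerateGrowth h) (n : ℕ) : ModerateGrowth fun τ => h τ ^ n := by
  induction n with
  | zero => simpa using const (1 : 𝕜)
  | succ n ih => simpa only [pow_succ] using ih.mul hh

theorem add (hh : ModerateGrowth h) (hk : ModerateGrowth k) : ModerateGrowth fun τ => h τ + k τ := by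
  obtain ⟨K, C, hC⟩ := hh
  obtain ⟨L, D, hD⟩ := hk
  refine ⟨K + L, |C| + |D|, fun τ hτ => (norm_add_le _ _).trans ?_⟩
  have h1 : Real.exp (K * τ.im) ≤ Real.exp ((K + L : ℕ) * τ.im) := by
    gcongr
    exact Nat.le_add_right _ _
  have h2 : Real.exp (L * τ.im) ≤ Real.exp ((K + L : ℕ) * τ.im) := by
    gcongr
    exact Nat.le_add_left _ _
  rw [add_mul]
  refine add_le_add ((hC τ hτ).trans ?_) ((hD τ hτ).trans ?_)
  · exact mul_le_mul (le_abs_self C) h1 (Real.exp_pos _).le (abs_nonneg C)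
  · exact mul_le_mul (le_abs_self D) h2 (Real.exp_pos _).le (abs_nonneg D)

theorem sub (hh : ModerateGrowth h) (hk : ModerateGrowth k) : ModerateGrowth fun τ => h τ - k τ := by
  simpa only [sub_eq_add_neg, neg_one_mul] using hh.add ((const (-1 : 𝕜)).mul hk)

/-- Uses t ≤ 1 + tⁿ for t ≥ 0. It lets eta quotients be estimated through their 48th powers, that is
through |Δ|². -/
theorem of_norm_pow {n : ℕ} (hn : n ≠ 0) (hh : ModerateGrowth fun τ => ‖h τ‖ ^ n) : ModerateGrowth h := by
  obtain ⟨K, C, hC⟩ := hh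
  refine ⟨K, 1 + C, fun τ hτ => ?_⟩
  have h1 := hC τ hτ
  rw [Real.norm_of_nonneg (by positivity)] at h1
  have h2 : 1 ≤ Real.exp (K * τ.im) := Real.one_le_exp (mul_nonneg (Nat.cast_nonneg _) τ.im_pos.le)
  have h3 : ‖h τ‖ ≤ 1 + ‖h τ‖ ^ n := by
    rcases le_total ‖h τ‖ 1 with h4 | h4
    · exact h4.trans (le_add_of_nonneg_right (by positivity))
    · exact (le_self_pow₀ h4 hn).trans (le_add_of_nonneg_left zero_le_one)
  rw [add_mul, one_mul]
  exact h3.trans (add_le_add h2 h1)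

end

theorem exists_isBoundedAtImInfty {h : ℍ → ℂ} (hh : ModerateGrowth h) :
    ∃ m : ℕ, UpperHalfPlane.IsBoundedAtImInfty fun τ : ℍ => q τ ^ m * h τ := by
  obtain ⟨K, C, hC⟩ := hh
  refine ⟨K, UpperHalfPlane.isBoundedAtImInfty_iff.2 ⟨C, 1, fun τ hτ => ?_⟩⟩
  have h1 := hC τ hτ
  rw [norm_mul, norm_pow, norm_q, ← Real.exp_nat_mul]
  calc _ ≤ Real.exp (-(K * τ.im)) * (C * Real.exp (K * τ.im)) := by
        refine mul_le_mul (Real.exp_le_exp.2 ?_) h1 (norm_nonneg _) (Real.exp_pos _).le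
        have : (K : ℝ) * τ.im ≤ K * τ.im * (2 * Real.pi) :=
          le_mul_of_one_le_right (mul_nonneg (Nat.cast_nonneg _) τ.im_pos.le) (by nlinarith [Real.pi_gt_three])
        linarith
    _ = C := by rw [mul_left_comm, ← Real.exp_add]; simp

end ModerateGrowth

theorem exists_euler_bounds {r : ℝ} (hr : r < 1) : ∃ c C : ℝ, 0 < c ∧ 0 < C ∧
    ∀ z : ℂ, ‖z‖ ≤ r → c ≤ ‖euler z‖ ∧ ‖euler z‖ ≤ C := by
  rcases lt_or_ge r 0 with h0 | h0
  · exact ⟨1, 1, one_pos, one_pos, fun z hz => absurd ((norm_nonneg z).trans hz) (not_le.2 h0)⟩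
  have hc : ContinuousOn (fun z => ‖euler z‖) (Metric.closedBall 0 r) :=
    (differentiableOn_euler.continuousOn.mono (Metric.closedBall_subset_ball hr)).norm
  have hne : (Metric.closedBall (0 : ℂ) r).Nonempty := ⟨0, by simpa using h0⟩
  obtain ⟨a, ha, ha'⟩ := (isCompact_closedBall (0 : ℂ) r).exists_isMinOn hne hc
  obtain ⟨b, hb, hb'⟩ := (isCompact_closedBall (0 : ℂ) r).exists_isMaxOn hne hc
  have h1 : ∀ z ∈ Metric.closedBall (0 : ℂ) r, 0 < ‖euler z‖ := fun z hz =>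
    norm_pos_iff.2 (euler_ne_zero (lt_of_le_of_lt (by simpa using hz) hr))
  exact ⟨_, _, h1 a ha, h1 b hb, fun z hz => ⟨ha' (by simpa using hz), hb' (by simpa using hz)⟩⟩

/-! ### Bounds for the discriminant and for η at the cusps -/

/-- The invariant function `|Δ|² im¹²`. -/
def discNorm (w : ℍ) : ℝ := ‖ModularForm.discriminant w‖ ^ 2 * w.im ^ 12

theorem discNorm_smul (γ : SL(2, ℤ)) (w : ℍ) : discNorm (γ • w) = discNorm w := by
  have hd : ∀ w : ℍ, discNorm w
      = ‖UpperHalfPlane.petersson 12 CuspForm.discriminant CuspForm.discriminant w‖ := fun w => by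
    rw [UpperHalfPlane.petersson, norm_mul, norm_mul, RCLike.norm_conj, discNorm, sq, norm_zpow,
      Complex.norm_real, Real.norm_of_nonneg w.im_pos.le]
    rfl
  rw [hd, hd]
  exact SlashInvariantFormClass.norm_petersson_smul (k := 12) (τ := w) (g := (γ : GL (Fin 2) ℝ))
    (f := CuspForm.discriminant) (f' := CuspForm.discriminant) (Γ := 𝒮ℒ) ⟨γ, rfl⟩

theorem discriminant_eq (w : ℍ) : ModularForm.discriminant w = q w * euler (q w) ^ 24 := by
  rw [ModularForm.discriminant, eta_eq_euler, mul_pow, q_pow_eq, q]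

/-- By invariance w may be moved to the fundamental domain. There im ≥ 1/2, the nome lies in a fixed
compact disc, and the Euler product is bounded above and away from 0. Only the factor e^(-4πy)y¹²
remains: it is bounded above, and a bound Y for the heights in the orbit bounds it below. -/
theorem exists_discNorm_bounds : ∃ c C : ℝ, 0 < c ∧ 0 < C ∧ ∀ (w : ℍ) (Y : ℝ),
    (∀ γ : SL(2, ℤ), (γ • w).im ≤ Y) → c * Real.exp (-(4 * Real.pi * Y)) ≤ discNorm w ∧ discNorm w ≤ C := by
  obtain ⟨c, C, hc, hC, h⟩ := exists_euler_bounds (r := Real.exp (-Real.pi)) (by simp [Real.pi_pos])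
  refine ⟨(c ^ 24) ^ 2 * (1 / 2) ^ 12, (C ^ 24) ^ 2 * Nat.factorial 12, by positivity, by positivity,
    fun w Y hY => ?_⟩
  obtain ⟨γ, hγ⟩ := ModularGroup.exists_smul_mem_fd w
  have h1 : 1 / 2 ≤ (γ • w).im := by
    have := ModularGroup.three_le_four_mul_im_sq_of_mem_fd hγ
    have := (γ • w).im_pos
    nlinarith
  have h2 := hY γ
  rw [← discNorm_smul γ w]
  generalize γ • w = u at *
  obtain ⟨h3, h4⟩ := h (q u) (by
    rw [norm_q]; exact Real.exp_le_exp.2 (by nlinarith [Real.pi_pos]))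
  have e : discNorm u = (‖euler (q u)‖ ^ 24) ^ 2 * (Real.exp (-(4 * Real.pi * u.im)) * u.im ^ 12) := by
    rw [discNorm, discriminant_eq, norm_mul, norm_pow, norm_q, mul_pow, ← Real.exp_nat_mul,
      show ((2 : ℕ) : ℝ) * (-2 * Real.pi * u.im) = -(4 * Real.pi * u.im) by push_cast; ring]
    ring
  have hu := u.im_pos
  rw [e]
  constructor
  · calc _ = (c ^ 24) ^ 2 * (Real.exp (-(4 * Real.pi * Y)) * (1 / 2) ^ 12) := by ring
      _ ≤ _ := by gcongr
  · refine mul_le_mul (by gcongr) ?_ (by positivity) (by positivity)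
    have h5 := Real.pow_div_factorial_le_exp u.im hu.le 12
    rw [div_le_iff₀ (by positivity)] at h5
    have h6 : Real.exp (-(4 * Real.pi * u.im)) ≤ Real.exp (-u.im) := 
      Real.exp_le_exp.2 (by nlinarith [Real.pi_gt_three])
    calc _ ≤ Real.exp (-u.im) * (Real.exp u.im * (Nat.factorial 12 : ℝ)) := by gcongr
      _ = _ := by rw [← mul_assoc, ← Real.exp_add]; simp

theorem one_le_normSq {a b : ℤ} {τ : ℍ} (hτ : 1 ≤ τ.im) (h : (a : ℂ) * τ + b ≠ 0) :
    1 ≤ Complex.normSq (a * τ + b) := by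
  have e : Complex.normSq (a * τ + b) = (a * τ.re + b) ^ 2 + (a * τ.im) ^ 2 := by
    simp [Complex.normSq_apply, sq]
  rw [e]
  rcases eq_or_ne a 0 with rfl | ha
  · have hb : b ≠ 0 := by rintro rfl; simp at h
    have hp : (0 : ℤ) < b ^ 2 := by positivity
    have : (1 : ℝ) ≤ (b : ℝ) ^ 2 := by exact_mod_cast hp
    simpa using this
  · have hp : (0 : ℤ) < a ^ 2 := by positivity
    have : (1 : ℝ) ≤ (a : ℝ) ^ 2 := by exact_mod_cast hp
    nlinarith [sq_nonneg (a * τ.re + b), one_le_pow₀ hτ (n := 2)]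

/-- The two automorphy factors multiply to aτ + b with integers a, b not both zero, and
`one_le_normSq` bounds this below by 1 for im τ ≥ 1. This supplies the height bound required by
`exists_discNorm_bounds` at dg(τ). -/
theorem im_smul_le {d : ℕ} {g : SL(2, ℤ)} {τ w : ℍ} (hτ : 1 ≤ τ.im) (hw : (w : ℂ) = d * (g • τ : ℍ))
    (γ : SL(2, ℤ)) : (γ • w).im ≤ d * τ.im := by
  have him : w.im = d * (τ.im / Complex.normSq (UpperHalfPlane.denom g τ)) := by
    rw [← ModularGroup.im_smul_eq_div_normSq, ← UpperHalfPlane.coe_im, hw]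
    simp
  have h0 : UpperHalfPlane.denom γ w ≠ 0 := UpperHalfPlane.denom_ne_zero _ _
  have h1 : UpperHalfPlane.denom g τ ≠ 0 := UpperHalfPlane.denom_ne_zero _ _
  have e : UpperHalfPlane.denom g τ * UpperHalfPlane.denom γ w
      = ((γ 1 0 * d * g 0 0 + γ 1 1 * g 1 0 : ℤ) : ℂ) * τ + ((γ 1 0 * d * g 0 1 + γ 1 1 * g 1 1 : ℤ) : ℂ) := by
    rw [ModularGroup.denom_apply, ModularGroup.denom_apply] at *
    rw [hw, UpperHalfPlane.coe_specialLinearGroup_apply]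
    simp only [algebraMap_int_eq, eq_intCast, Complex.ofReal_intCast]
    push_cast
    field_simp
    ring
  have h2 := one_le_normSq hτ (e ▸ mul_ne_zero h1 h0)
  rw [← e, map_mul] at h2
  rw [ModularGroup.im_smul_eq_div_normSq, him, ← mul_div_assoc, div_div]
  exact div_le_self (by have := τ.im_pos; positivity) h2

/-- The growth of `η(dτ)` at a cusp, normalised to have weight `0`. -/
def etaNorm (g : SL(2, ℤ)) (d : ℕ) (τ : ℍ) : ℝ := ‖e d (g • τ)‖ ^ 48 * (g • τ).im ^ 12

theorem etaNorm_bounds (g : SL(2, ℤ)) {d : ℕ} (hd : d ≠ 0) : ∃ c C : ℝ, 0 < c ∧ 0 < C ∧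
    ∀ τ : ℍ, 1 ≤ τ.im → c * Real.exp (-(4 * Real.pi * (d * τ.im))) ≤ etaNorm g d τ ∧ etaNorm g d τ ≤ C := by
  obtain ⟨c, C, hc, hC, h⟩ := exists_discNorm_bounds
  have hd' : (0 : ℝ) < d := Nat.cast_pos.2 (Nat.pos_of_ne_zero hd)
  refine ⟨c / d ^ 12, C / d ^ 12, by positivity, by positivity, fun τ hτ => ?_⟩
  obtain ⟨w, hw⟩ : ∃ w : ℍ, (w : ℂ) = d * (g • τ : ℍ) :=
    ⟨⟨d * (g • τ : ℍ), by simpa [hd'] using (g • τ).im_pos⟩, rfl⟩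
  have he : etaNorm g d τ = discNorm w / d ^ 12 := by
    have him : w.im = d * (g • τ).im := by rw [← UpperHalfPlane.coe_im, hw]; simp
    rw [etaNorm, discNorm, e, ← hw, ModularForm.discriminant, him, norm_pow, ← pow_mul]
    field_simp
  obtain ⟨h1, h2⟩ := h w (d * τ.im) (im_smul_le hτ hw)
  rw [he, div_mul_eq_mul_div]
  exact ⟨by gcongr, by gcongr⟩

theorem moderateGrowth_etaNorm (g : SL(2, ℤ)) {d : ℕ} (hd : d ≠ 0) : ModerateGrowth (etaNorm g d) := by
  obtain ⟨c, C, hc, hC, h⟩ := etaNorm_bounds g hd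
  refine ⟨0, C, fun τ hτ => ?_⟩
  have := h τ hτ
  rw [Real.norm_of_nonneg ((by positivity : (0 : ℝ) ≤ _).trans this.1)]
  simpa using this.2

theorem moderateGrowth_etaNorm_inv (g : SL(2, ℤ)) {d : ℕ} (hd : d ≠ 0) :
    ModerateGrowth fun τ => (etaNorm g d τ)⁻¹ := by
  obtain ⟨c, C, hc, hC, h⟩ := etaNorm_bounds g hd
  -- 16 is an integral upper bound for 4π.
  refine ⟨16 * d, c⁻¹, fun τ hτ => ?_⟩
  have h1 := (h τ hτ).1
  have h0 : 0 < c * Real.exp (-(4 * Real.pi * (d * τ.im))) := by positivity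
  rw [norm_inv, Real.norm_of_nonneg (h0.le.trans h1)]
  refine (inv_anti₀ h0 h1).trans ?_
  rw [mul_inv, Real.exp_neg, inv_inv]
  refine mul_le_mul_of_nonneg_left (Real.exp_le_exp.2 ?_) (by positivity)
  push_cast
  have : 0 ≤ d * τ.im := mul_nonneg (Nat.cast_nonneg _) τ.im_pos.le
  nlinarith [Real.pi_le_four]


/-! ### Growth of the Hauptmodul and of the inverse units -/

theorem e_ne_zero {d : ℕ} (hd : d ≠ 0) (τ : ℍ) : e d τ ≠ 0 := by
  rw [e_eq]
  exact mul_ne_zero (pow_ne_zero _ (Complex.exp_ne_zero _)) (euler_pow_ne_zero (norm_q_lt_one τ) hd)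

theorem haupt_q_eq_eta (τ : ℍ) :
    haupt (q τ) = e 2 τ ^ 2 * e 12 τ ^ 4 / (e 4 τ ^ 4 * e 6 τ ^ 2) := by
  obtain ⟨ε, hε, h, he⟩ := exists_eta_eq τ
  simp only [he, haupt]
  generalize q τ = z at *
  subst h
  field_simp

theorem unitA_q_eq_eta (τ : ℍ) :
    unitA (q τ) = e 3 τ ^ 3 * e 2 τ ^ 2 * e 12 τ / (e 1 τ * e 4 τ ^ 3 * e 6 τ ^ 2) := by
  obtain ⟨ε, hε, h, he⟩ := exists_eta_eq τ
  simp only [he, unitA, pow_one]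
  field_simp

theorem unitC_q_eq_eta (τ : ℍ) :
    unitC (q τ) = e 1 τ ^ 3 * e 12 τ / (e 3 τ * e 4 τ ^ 3) := by
  obtain ⟨ε, hε, h, he⟩ := exists_eta_eq τ
  simp only [he, unitC, pow_one]
  field_simp

theorem unitD_q_eq_eta (τ : ℍ) :
    unitD (q τ) = e 2 τ ^ 9 * e 3 τ * e 12 τ ^ 2 / (e 1 τ ^ 3 * e 4 τ ^ 6 * e 6 τ ^ 3) := by
  obtain ⟨ε, hε, h, he⟩ := exists_eta_eq τ
  simp only [he, unitD, pow_one]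
  field_simp

section
variable (g : SL(2, ℤ))

/-- Numerator and denominator contain equally many eta factors, so the powers of im(gτ) in the
`etaNorm` cancel and the 48th power of the norm is a product of `etaNorm` and their inverses. The
same holds for the inverse units below. -/
theorem moderateGrowth_haupt : ModerateGrowth fun τ => haupt (q (g • τ)) := by
  refine ModerateGrowth.of_norm_pow (n := 48) (by norm_num) ?_
  have h := ((((moderateGrowth_etaNorm g (d := 2) (by norm_num)).pow 2).mul
    ((moderateGrowth_etaNorm g (d := 12) (by norm_num)).pow 4)).mul
    ((moderateGrowth_etaNorm_inv g (d := 4) (by norm_num)).pow 4)).mul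
    ((moderateGrowth_etaNorm_inv g (d := 6) (by norm_num)).pow 2)
  refine (congr_arg ModerateGrowth (funext fun τ => ?_)).mpr h
  have := (g • τ).im_pos
  have h4 := norm_pos_iff.2 (e_ne_zero (d := 4) (by norm_num) (g • τ))
  have h6 := norm_pos_iff.2 (e_ne_zero (d := 6) (by norm_num) (g • τ))
  simp only [haupt_q_eq_eta, norm_div, norm_mul, norm_pow, etaNorm]
  field_simp

theorem moderateGrowth_unitA_inv : ModerateGrowth fun τ => (unitA (q (g • τ)))⁻¹ := by
  refine ModerateGrowth.of_norm_pow (n := 48) (by norm_num) ?_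
  have h := (((((moderateGrowth_etaNorm_inv g (d := 3) (by norm_num)).pow 3).mul
    ((moderateGrowth_etaNorm_inv g (d := 2) (by norm_num)).pow 2)).mul
    (moderateGrowth_etaNorm_inv g (d := 12) (by norm_num))).mul
    (moderateGrowth_etaNorm g (d := 1) (by norm_num))).mul
    (((moderateGrowth_etaNorm g (d := 4) (by norm_num)).pow 3).mul
    ((moderateGrowth_etaNorm g (d := 6) (by norm_num)).pow 2))
  refine (congr_arg ModerateGrowth (funext fun τ => ?_)).mpr h
  have := (g • τ).im_pos
  have h3 := norm_pos_iff.2 (e_ne_zero (d := 3) (by norm_num) (g • τ))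
  have h2 := norm_pos_iff.2 (e_ne_zero (d := 2) (by norm_num) (g • τ))
  have h12 := norm_pos_iff.2 (e_ne_zero (d := 12) (by norm_num) (g • τ))
  simp only [unitA_q_eq_eta, norm_inv, norm_div, norm_mul, norm_pow, etaNorm]
  field_simp

theorem moderateGrowth_unitC_inv : ModerateGrowth fun τ => (unitC (q (g • τ)))⁻¹ := by
  refine ModerateGrowth.of_norm_pow (n := 48) (by norm_num) ?_
  have h := (((moderateGrowth_etaNorm_inv g (d := 1) (by norm_num)).pow 3).mul
    (moderateGrowth_etaNorm_inv g (d := 12) (by norm_num))).mul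
    ((moderateGrowth_etaNorm g (d := 3) (by norm_num)).mul
    ((moderateGrowth_etaNorm g (d := 4) (by norm_num)).pow 3))
  refine (congr_arg ModerateGrowth (funext fun τ => ?_)).mpr h
  have := (g • τ).im_pos
  have h1 := norm_pos_iff.2 (e_ne_zero (d := 1) (by norm_num) (g • τ))
  have h12 := norm_pos_iff.2 (e_ne_zero (d := 12) (by norm_num) (g • τ))
  simp only [unitC_q_eq_eta, norm_inv, norm_div, norm_mul, norm_pow, etaNorm]
  field_simp

theorem moderateGrowth_unitD_inv : ModerateGrowth fun τ => (unitD (q (g • τ)))⁻¹ := by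
  refine ModerateGrowth.of_norm_pow (n := 48) (by norm_num) ?_
  have h := (((((moderateGrowth_etaNorm_inv g (d := 2) (by norm_num)).pow 9).mul
    (moderateGrowth_etaNorm_inv g (d := 3) (by norm_num))).mul
    ((moderateGrowth_etaNorm_inv g (d := 12) (by norm_num)).pow 2)).mul
    ((moderateGrowth_etaNorm g (d := 1) (by norm_num)).pow 3)).mul
    (((moderateGrowth_etaNorm g (d := 4) (by norm_num)).pow 6).mul
    ((moderateGrowth_etaNorm g (d := 6) (by norm_num)).pow 3))
  refine (congr_arg ModerateGrowth (funext fun τ => ?_)).mpr h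
  have := (g • τ).im_pos
  have h3 := norm_pos_iff.2 (e_ne_zero (d := 3) (by norm_num) (g • τ))
  have h2 := norm_pos_iff.2 (e_ne_zero (d := 2) (by norm_num) (g • τ))
  have h12 := norm_pos_iff.2 (e_ne_zero (d := 12) (by norm_num) (g • τ))
  simp only [unitD_q_eq_eta, norm_inv, norm_div, norm_mul, norm_pow, etaNorm]
  field_simp

end

/-! ### Modularity and transformation of the functions L -/

/-- Functions of `haupt` whose denominators are products of `1 + x`, `1 - 3x` and `1 + 3x` are weakly
holomorphic modular functions. -/
theorem isWeaklyHolomorphic_of_haupt {R : ℂ → ℂ} {L : ℍ → ℂ} (hL : ∀ τ, L τ = R (haupt (q τ)))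
    (hR : ∀ x : ℂ, 1 + x ≠ 0 → 1 - 3 * x ≠ 0 → 1 + 3 * x ≠ 0 → DifferentiableAt ℂ R x)
    (hg : ∀ x : ℍ → ℂ, ModerateGrowth x → (ModerateGrowth fun τ => (1 + x τ)⁻¹) →
      (ModerateGrowth fun τ => (1 - 3 * x τ)⁻¹) → (ModerateGrowth fun τ => (1 + 3 * x τ)⁻¹) →
      ModerateGrowth fun τ => R (x τ)) : IsWeaklyHolomorphicModularFunction 12 L where
  holo := by
    rw [UpperHalfPlane.mdifferentiable_iff]
    intro z hz
    have hq : ‖Complex.exp (2 * Real.pi * Complex.I * z)‖ < 1 := norm_q_lt_one ⟨z, hz⟩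
    have h0 := Complex.exp_ne_zero (2 * Real.pi * Complex.I * z)
    -- The linear forms in x are eta quotients and so never vanish on ℍ; this is why R may have
    -- poles at x = -1 and x = ±1/3.
    have hA := unitA_ne_zero hq
    have hC := unitC_ne_zero hq
    have hD := unitD_ne_zero hq
    rw [unitA_eq hq] at hA
    rw [unitC_eq hq h0] at hC
    rw [unitD_eq hq h0] at hD
    have h1 : DifferentiableAt ℂ haupt (Complex.exp (2 * Real.pi * Complex.I * z)) :=
      differentiableOn_haupt.differentiableAt (Metric.isOpen_ball.mem_nhds (by simpa using hq))
    have h2 : DifferentiableAt ℂ (fun w : ℂ => Complex.exp (2 * Real.pi * Complex.I * w)) z := by fun_prop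
    have h2' : DifferentiableAt ℂ (fun w => haupt (Complex.exp (2 * Real.pi * Complex.I * w))) z :=
      DifferentiableAt.comp (g := haupt) z h1 h2
    have h3 : DifferentiableAt ℂ (fun w => R (haupt (Complex.exp (2 * Real.pi * Complex.I * w)))) z :=
      DifferentiableAt.comp (g := R) z (hR _ hA hC hD) h2'
    refine h3.differentiableWithinAt.congr (fun w hw => ?_) ?_ <;>
    · rw [Function.comp_apply, hL, q, UpperHalfPlane.ofComplex_apply_of_im_pos (by assumption)]
  invariant := fun g hg' τ => by rw [hL, hL, haupt_q_smul hg']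
  meromorphic_at_cusps := fun g => by
    simp only [hL]
    refine (hg _ (moderateGrowth_haupt g) ?_ ?_ ?_).exists_isBoundedAtImInfty
    · simpa only [unitA_eq (norm_q_lt_one _)] using moderateGrowth_unitA_inv g
    · simpa only [unitC_eq (norm_q_lt_one _) (q_ne_zero _)] using moderateGrowth_unitC_inv g
    · simpa only [unitD_eq (norm_q_lt_one _) (q_ne_zero _)] using moderateGrowth_unitD_inv g

open ModerateGrowth in
theorem isWeaklyHolomorphic_Lped : IsWeaklyHolomorphicModularFunction 12 Lped := by
  refine isWeaklyHolomorphic_of_haupt Lped_eq_ratPed (fun x hA hC hD => ?_) fun x hx hA hC hD => ?_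
  · have := pow_ne_zero 11 hC
    unfold ratPed
    fun_prop (disch := assumption)
  · simp only [ratPed, div_eq_mul_inv, ← inv_pow]
    refine mul ?_ (pow hC 11)
    repeat' first | exact hx | exact const _ | apply pow hx | apply add | apply sub | apply mul

open ModerateGrowth in
theorem isWeaklyHolomorphic_Lpobar : IsWeaklyHolomorphicModularFunction 12 Lpobar := by
  refine isWeaklyHolomorphic_of_haupt Lpobar_eq_ratPobar (fun x hA hC hD => ?_) fun x hx hA hC hD => ?_
  · have := pow_ne_zero 11 hC
    unfold ratPobar
    fun_prop (disch := assumption)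
  · simp only [ratPobar, div_eq_mul_inv, ← inv_pow]
    refine mul ?_ (pow hC 11)
    repeat' first | exact hx | exact const _ | apply pow hx | apply add | apply sub | apply mul

open ModerateGrowth in
theorem isWeaklyHolomorphic_Lpod : IsWeaklyHolomorphicModularFunction 12 Lpod := by
  refine isWeaklyHolomorphic_of_haupt Lpod_eq_ratPod (fun x hA hC hD => ?_) fun x hx hA hC hD => ?_
  · have := mul_ne_zero (pow_ne_zero 2 hA) (pow_ne_zero 10 hC)
    unfold ratPod
    fun_prop (disch := assumption)
  · simp only [ratPod, div_eq_mul_inv, mul_inv, ← inv_pow]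
    refine mul ?_ (mul (pow hA 2) (pow hC 10))
    repeat' first | exact hx | exact const _ | apply pow hx | apply add | apply sub | apply mul

open ModerateGrowth in
theorem isWeaklyHolomorphic_Lpbar : IsWeaklyHolomorphicModularFunction 12 Lpbar := by
  refine isWeaklyHolomorphic_of_haupt Lpbar_eq_ratPbar (fun x hA hC hD => ?_) fun x hx hA hC hD => ?_
  · have := mul_ne_zero (mul_ne_zero (pow_ne_zero 2 hA) (pow_ne_zero 10 hC)) (pow_ne_zero 7 hD)
    unfold ratPbar
    fun_prop (disch := assumption)
  · simp only [ratPbar, div_eq_mul_inv, mul_inv, ← inv_pow]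
    refine mul ?_ (mul (mul (pow hA 2) (pow hC 10)) (pow hD 7))
    repeat' first | exact hx | exact const _ | apply pow hx | apply add | apply sub | apply mul

theorem act_Lped (τ : ℍ) : act Lped gamma τ = 1 / 2 * Lpobar τ := by
  have hq := norm_q_lt_one τ
  have hC := unitC_ne_zero hq
  have hD := unitD_ne_zero hq
  rw [unitC_eq hq (q_ne_zero τ)] at hC
  rw [unitD_eq hq (q_ne_zero τ)] at hD
  rw [act, Lped_eq_ratPed, haupt_q_gamma, ratPed_transform hC hD, Lpobar_eq_ratPobar]

theorem act_Lpod (τ : ℍ) : act Lpod gamma τ = -(1 / 8) * Lpbar τ := by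
  have hq := norm_q_lt_one τ
  have hA := unitA_ne_zero hq
  have hC := unitC_ne_zero hq
  have hD := unitD_ne_zero hq
  rw [unitA_eq hq] at hA
  rw [unitC_eq hq (q_ne_zero τ)] at hC
  rw [unitD_eq hq (q_ne_zero τ)] at hD
  rw [act, Lpod_eq_ratPod, haupt_q_gamma, ratPod_transform hA hC hD, Lpbar_eq_ratPbar]

end InternalCongruence
end

open InternalCongruence in
theorem theorem1p2 :
    -- the matrix of the conjugated Atkin–Lehner involution
    ((gamma : GL (Fin 2) ℝ) : Matrix (Fin 2) (Fin 2) ℝ) = !![46, 28; 36, 22] ∧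
    -- the functions `L` are weakly holomorphic modular functions of level 12
    (IsWeaklyHolomorphicModularFunction 12 Lped ∧ IsWeaklyHolomorphicModularFunction 12 Lpod ∧
      IsWeaklyHolomorphicModularFunction 12 Lpobar ∧
      IsWeaklyHolomorphicModularFunction 12 Lpbar) ∧
    -- the functions `L` encode the internal congruences
    (∀ τ : ℍ,
      HasSum (fun n : ℕ => (f 3 τ ^ 2 * f 4 τ ^ 3) / (f 1 τ ^ 3 * f 12 τ ^ 2) *
        (((ped (3 * n + 1) : ℂ) + (ped (27 * n + 10) : ℂ)) * q τ ^ n)) (Lped τ) ∧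
      HasSum (fun n : ℕ => (f 2 τ ^ 4 * f 4 τ ^ 5 * f 12 τ ^ 2) /
          (f 1 τ * f 3 τ ^ 4 * f 6 τ ^ 5) *
        (((pod (3 * n + 2) : ℂ) + (pod (27 * n + 17) : ℂ)) * q τ ^ (n + 1))) (Lpod τ) ∧
      HasSum (fun n : ℕ => (f 2 τ ^ 9 * f 3 τ ^ 4 * f 12 τ ^ 2) /
          (f 1 τ ^ 6 * f 4 τ ^ 3 * f 6 τ ^ 6) *
        (((pobar (3 * n) : ℂ) - (pobar (27 * n) : ℂ)) * q τ ^ n)) (Lpobar τ) ∧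
      HasSum (fun n : ℕ => (q τ)⁻¹ * ((f 2 τ ^ 19 * f 6 τ) /
          (f 1 τ ^ 6 * f 3 τ ^ 6 * f 4 τ ^ 5 * f 12 τ ^ 2)) *
        (((pbar (3 * n) : ℂ) - (pbar (27 * n) : ℂ)) * q τ ^ (2 * n))) (Lpbar τ)) ∧
    -- the two transformation formulas
    (∀ τ : ℍ, act Lped gamma τ = 1 / 2 * Lpobar τ) ∧
    (∀ τ : ℍ, act Lpod gamma τ = -(1 / 8) * Lpbar τ) := by
  refine ⟨gamma_eq, ⟨isWeaklyHolomorphic_Lped, isWeaklyHolomorphic_Lpod, isWeaklyHolomorphic_Lpobar,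
    isWeaklyHolomorphic_Lpbar⟩, fun τ => ?_, act_Lped, act_Lpod⟩
  have hq := norm_q_lt_one τ
  have h0 := q_ne_zero τ
  rw [Lped_eq, Lpod_eq, Lpobar_eq, Lpbar_eq]
  simp only [f_eq, pow_one]
  refine ⟨(hasSum_pedSection hq h0).mul_left _, ?_, (hasSum_pobarSection hq h0).mul_left _, ?_⟩
  -- The extra factor q produced by U₃ accounts for the exponent n + 1.
  · refine HasSum.mul_left _ (((hasSum_podSection hq h0).mul_left (q τ)).congr_fun fun n => ?_)
    ring
  · have h : ∀ a b c : ℂ, a * (b / c) = c⁻¹ * a * b := fun a b c => by ring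
    rw [h _ (pbarSection (q τ ^ 2))]
    refine HasSum.mul_left _ ((hasSum_pbarSection (norm_pow_lt hq two_ne_zero)
      (pow_ne_zero 2 h0)).congr_fun fun n => ?_)
    rw [pow_mul]
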